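/- Let $k$ be a field and $H$ a Hopf algebra over $k$ with coproduct $\Delta h=h_{(1)}\otimes h_{(2)}$, counit $\epsilon$ and antipode $S$. A (left) crossed $H$-module is a vector space $V$ with a left action $h\triangleright v$ and a left coaction $v\mapsto v^{(\bar 1)}\otimes v^{(\bar 2)}\in H\otimes V$ such that $$h_{(1)}v^{(\bar1)}\otimes h_{(2)}\triangleright v^{(\bar2)}=(h_{(1)}\triangleright v)^{(\bar1)}h_{(2)}\otimes (h_{(1)}\triangleright v)^{(\bar2)};$$ the braiding of crossed modules is $\Psi(v\otimes w)=v^{(\bar1)}\triangleright w\otimes v^{(\bar2)}$. Let $B$ be a braided group in this category: an algebra and a coalgebra, with coproduct $\underline\Delta b=b_{\underline{(1)}}\otimes b_{\underline{(2)}}$, counit $\underline\epsilon$ and antipode $\underline S$, all of whose structure maps are morphisms of crossed modules, such that $\underline\epsilon$ is an algebra map, $\underline\Delta$ is an algebra map into $B\otimes B$ with the product $(a\otimes b)(c\otimes d)=a\Psi(b\otimes c)d$, and $\underline S$ is the convolution inverse of the identity of $B$. The biproduct $P=B\rtimes H$ is the vector space $B\otimes H$ with the Hopf algebra structure $$(b\otimes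 h)(c\otimes g)=b(h_{(1)}\triangleright c)\otimes h_{(2)}g,\qquad \Delta(b\otimes h)=b_{\underline{(1)}}\otimes b_{\underline{(2)}}{}^{(\bar1)}h_{(1)}\otimes b_{\underline{(2)}}{}^{(\bar2)}\otimes h_{(2)},$$ with $\pi(b\otimes h)=\underline\epsilon(b)h$ and $j(h)=1\otimes h$. It is a trivial quantum principal bundle with coaction $\Delta_R=(\mathrm{id}\otimes\pi)\Delta$ of $H$, base $M=\{u\in P:\Delta_Ru=u\otimes1\}=B$ and trivialisation $j$. For an algebra $A$ let $\Omega^1A=\ker(A\otimes A\to A)$ be the universal 1-forms, with $\mathrm d_Uu=1\otimes u-u\otimes1$. Put $\pi_\epsilon(h)=h-\epsilon(h)1$, $\mathrm{Ad}(h)=h_{(2)}\otimes (Sh_{(1)})h_{(3)}$ and $\chi(u\otimes v)=u\Delta_Rv$. A connection is a linear map $\omega_U:\ker\epsilon_H\to\Omega^1P$ with $\chi\circ\omega_U=1\otimes\mathrm{id}$ and $\Delta_R\circ\omega_U=(\omega_U\otimes\mathrm{id})\circ\mathrm{Ad}$ (tensor product coaction on $P\otimes P$). It is strong if $(\mathrm{id}-\Pi)(\mathrm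 d_UP)\subseteq(\Omega^1M)P$, where $\Pi=\cdot\,(\mathrm{id}\otimes\omega_U)\,\chi:\Omega^1P\to\Omega^1P$ is its projection, and left-invariant if $\Delta_L\omega_U(h)=1\otimes\omega_U(h)$ for all $h$, where $\Delta_L(u\otimes v)=u_{(1)}v_{(1)}\otimes u_{(2)}\otimes v_{(2)}$. 1. The assignment $\beta_U\mapsto\omega_U$, $$\omega_U(h)=j(Sh_{(1)})\,\beta_U(\pi_\epsilon(h_{(2)}))\,j(h_{(3)})+j(Sh_{(1)})\,\mathrm d_Uj(h_{(2)}),$$ is a bijection from the set of linear maps $\beta_U:\ker\epsilon_H\to\Omega^1B$ that are left $B$-invariant, $\underline\Delta_L\beta_U(h)=1\otimes\beta_U(h)$, where $$\underline\Delta_L(b\otimes c)=b_{\underline{(1)}}(b_{\underline{(2)}}{}^{(\bar1)}\triangleright c_{\underline{(1)}})\otimes b_{\underline{(2)}}{}^{(\bar2)}\otimes c_{\underline{(2)}},$$ and intertwine the tensor product coaction $\Delta_H$ of $H$ on $\Omega^1B\subseteq B\otimes B$ with the left adjoint coaction, $\Delta_H(\beta_U(h))=h_{(1)}Sh_{(3)}\otimes\beta_U(h_{(2)})$,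 onto the set of strong left-invariant connections on $B\rtimes H$. 2. The assignment $\gamma\mapsto\beta_U$, $\beta_U(h)=\underline S\gamma(h)_{\underline{(1)}}\,\mathrm d_U\gamma(h)_{\underline{(2)}}$, is a bijection from the set of linear maps $\gamma:\ker\epsilon_H\to\ker\underline\epsilon$ with $\Delta_H(\gamma(h))=h_{(1)}Sh_{(3)}\otimes\gamma(h_{(2)})$, where $\Delta_H$ is the coaction of $H$ on $B$, onto the set of the $\beta_U$ in part 1. 3. For each such $\gamma$, the map $i(h)=\gamma(\pi_\epsilon(h_{(1)}))\otimes h_{(2)}+1\otimes h$ is an $\mathrm{Ad}$-covariant splitting $i:\ker\epsilon_H\to\ker\epsilon_P$ of $\pi$, that is, $\pi\circ i=\mathrm{id}$ and $(\mathrm{id}\otimes\pi)\circ\mathrm{Ad}\circ i=(i\otimes\mathrm{id})\circ\mathrm{Ad}$, and the connection $\omega_U$ that corresponds to $\gamma$ by parts 1 and 2 is the canonical connection of $i$, $\omega_U(h)=(S\,i(h)_{(1)})\,\mathrm d_U\,i(h)_{(2)}$. -/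

import Mathlib

open scoped TensorProduct
open Coalgebra

/-! ### Rearrangements of tensor products -/

/-- `x ⊗ y ⊗ x' ⊗ y' ↦ x ⊗ τ (y ⊗ x') ⊗ y'`: exchange of the two middle factors by means of `τ`. -/
noncomputable def midTwist {k X Y X' Y' Z W : Type*} [Field k]
    [AddCommGroup X] [Module k X] [AddCommGroup Y] [Module k Y]
    [AddCommGroup X'] [Module k X'] [AddCommGroup Y'] [Module k Y']
    [AddCommGroup Z] [Module k Z] [AddCommGroup W] [Module k W]
    (τ : Y ⊗[k] X' →ₗ[k] Z ⊗[k] W) :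
    (X ⊗[k] Y) ⊗[k] (X' ⊗[k] Y') →ₗ[k] (X ⊗[k] Z) ⊗[k] (W ⊗[k] Y') :=
  (TensorProduct.assoc k X Z (W ⊗[k] Y')).symm.toLinearMap ∘ₗ
    ((TensorProduct.assoc k Z W Y').toLinearMap ∘ₗ τ.rTensor Y' ∘ₗ
      (TensorProduct.assoc k Y X' Y').symm.toLinearMap).lTensor X ∘ₗ
    (TensorProduct.assoc k X Y (X' ⊗[k] Y')).toLinearMap

/-- The flip `y ⊗ x ↦ x ⊗ y`. -/
noncomputable abbrev tflip (k Y X : Type*) [Field k] [AddCommGroup Y] [Module k Y]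
    [AddCommGroup X] [Module k X] : Y ⊗[k] X →ₗ[k] X ⊗[k] Y :=
  (TensorProduct.comm k Y X).toLinearMap

/-! ### Crossed modules and braided groups -/

/-- The tensor product `v ⊗ w ↦ v⁽¹⁾ w⁽¹⁾ ⊗ (v⁽²⁾ ⊗ w⁽²⁾)` of two maps `V → H ⊗ V`, `W → H ⊗ W`
(used for left coactions of `H`). -/
noncomputable def leftTensorCoact {k H V W : Type*} [Field k] [Ring H] [Algebra k H]
    [AddCommGroup V] [Module k V] [AddCommGroup W] [Module k W]
    (ρ : V →ₗ[k] H ⊗[k] V) (ρ' : W →ₗ[k] H ⊗[k] W) :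
    V ⊗[k] W →ₗ[k] H ⊗[k] (V ⊗[k] W) :=
  (LinearMap.mul' k H).rTensor (V ⊗[k] W) ∘ₗ midTwist (tflip k V H) ∘ₗ TensorProduct.map ρ ρ'

/-- A (left-left) crossed `H`-module: a left `H`-module `h ▷ v` and left `H`-comodule
`v ↦ v⁽¹⁾ ⊗ v⁽²⁾` with
`h₁ v⁽¹⁾ ⊗ h₂ ▷ v⁽²⁾ = (h₁ ▷ v)⁽¹⁾ h₂ ⊗ (h₁ ▷ v)⁽²⁾`. -/
class CrossedModule (k H V : Type*) [Field k] [Ring H] [HopfAlgebra k H]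
    [AddCommGroup V] [Module k V] where
  /-- the action `h ▷ v` -/
  act : H →ₐ[k] Module.End k V
  /-- the coaction `v ↦ v⁽¹⁾ ⊗ v⁽²⁾` -/
  coact : V →ₗ[k] H ⊗[k] V
  counit_coact : ∀ v, TensorProduct.lid k V ((counit (R := k) (A := H)).rTensor V (coact v)) = v
  coassoc_coact : ∀ v, TensorProduct.assoc k H H V ((comul (R := k) (A := H)).rTensor V (coact v)) =
    coact.lTensor H (coact v)
  crossed : ∀ (h : H) (v : V),
    TensorProduct.map (LinearMap.mul' k H) (TensorProduct.lift act.toLinearMap)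
        (midTwist (tflip k H H) (comul (R := k) h ⊗ₜ[k] coact v)) =
      (LinearMap.mul' k H).rTensor V (TensorProduct.rightComm k H V H
        ((coact ∘ₗ act.toLinearMap.flip v).rTensor H (comul (R := k) h)))

namespace CrossedModule

/-- The action as a map `h ⊗ v ↦ h ▷ v`. -/
noncomputable def actMap (k H V : Type*) [Field k] [Ring H] [HopfAlgebra k H]
    [AddCommGroup V] [Module k V] [CrossedModule k H V] : H ⊗[k] V →ₗ[k] V :=
  TensorProduct.lift (act (k := k) (H := H) (V := V)).toLinearMap

/-- The braiding `Ψ (v ⊗ w) = v⁽¹⁾ ▷ w ⊗ v⁽²⁾` of the category of crossed modules. -/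
noncomputable def braiding (k H V W : Type*) [Field k] [Ring H] [HopfAlgebra k H]
    [AddCommGroup V] [Module k V] [CrossedModule k H V]
    [AddCommGroup W] [Module k W] [CrossedModule k H W] : V ⊗[k] W →ₗ[k] W ⊗[k] V :=
  (actMap k H W).rTensor V ∘ₗ (TensorProduct.rightComm k H V W).toLinearMap ∘ₗ
    (coact (k := k) (H := H) (V := V)).rTensor W

end CrossedModule

open CrossedModule

/-- A braided group (Hopf algebra) `B` in the category of crossed `H`-modules. All structure maps
intertwine the action and the coaction of `H`, and the coproduct and counit are
algebra maps, the former into the braided tensor product algebra with product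
`(a ⊗ b)(c ⊗ d) = a Ψ (b ⊗ c) d`. -/
class BraidedGroup (k H B : Type*) [Field k] [Ring H] [HopfAlgebra k H]
    [Ring B] [Algebra k B] [Coalgebra k B] [CrossedModule k H B] where
  act_one : ∀ h : H, act (k := k) h (1 : B) = counit (R := k) h • (1 : B)
  act_mul : ∀ (h : H) (b c : B), act (k := k) h (b * c) =
    LinearMap.mul' k B (TensorProduct.map ((act (k := k) (H := H) (V := B)).toLinearMap.flip b)
      ((act (k := k) (H := H) (V := B)).toLinearMap.flip c) (comul (R := k) h))
  act_counit : ∀ (h : H) (b : B),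
    counit (R := k) (act (k := k) h b) = counit (R := k) h * counit (R := k) b
  act_comul : ∀ (h : H) (b : B), comul (R := k) (act (k := k) h b) =
    TensorProduct.map (actMap k H B) (actMap k H B)
      (midTwist (tflip k H B) (comul (R := k) h ⊗ₜ[k] comul (R := k) b))
  coact_one : coact (k := k) (H := H) (1 : B) = 1 ⊗ₜ[k] 1
  coact_mul : ∀ b c : B, coact (k := k) (H := H) (b * c) = coact (k := k) b * coact (k := k) c
  coact_counit : ∀ b : B, TensorProduct.rid k H
    ((counit (R := k) (A := B)).lTensor H (coact (k := k) b)) = counit (R := k) b • (1 : H)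
  coact_comul : ∀ b : B, (comul (R := k) (A := B)).lTensor H (coact (k := k) (H := H) b) =
    leftTensorCoact (coact (k := k) (H := H)) (coact (k := k) (H := H)) (comul (R := k) b)
  counit_one : counit (R := k) (1 : B) = 1
  counit_mul : ∀ b c : B, counit (R := k) (b * c) = counit (R := k) b * counit (R := k) c
  comul_one : comul (R := k) (1 : B) = 1 ⊗ₜ[k] 1
  comul_mul : ∀ b c : B, comul (R := k) (b * c) =
    TensorProduct.map (LinearMap.mul' k B) (LinearMap.mul' k B)
      (midTwist (braiding k H B B) (comul (R := k) b ⊗ₜ[k] comul (R := k) c))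
  /-- the braided antipode -/
  bantipode : B →ₗ[k] B
  mul_bantipode_rTensor_comul : ∀ b : B,
    LinearMap.mul' k B (bantipode.rTensor B (comul (R := k) b)) = counit (R := k) b • (1 : B)
  mul_bantipode_lTensor_comul : ∀ b : B,
    LinearMap.mul' k B (bantipode.lTensor B (comul (R := k) b)) = counit (R := k) b • (1 : B)
  bantipode_act : ∀ (h : H) (b : B), bantipode (act (k := k) h b) = act (k := k) h (bantipode b)
  coact_bantipode : ∀ b : B,
    coact (k := k) (H := H) (bantipode b) = bantipode.lTensor H (coact (k := k) b)

/-! ### The biproduct Hopf algebra -/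

/-- The underlying vector space `B ⊗ H` of the biproduct. -/
def Biproduct (k H B : Type*) [Field k] [Ring H] [HopfAlgebra k H]
    [Ring B] [Algebra k B] : Type _ := B ⊗[k] H

namespace Biproduct

set_option linter.unusedSectionVars false

section

variable (k H B : Type*) [Field k] [Ring H] [HopfAlgebra k H] [Ring B] [Algebra k B]

noncomputable instance instAddCommGroup : AddCommGroup (Biproduct k H B) := inferInstanceAs (AddCommGroup (B ⊗[k] H))

noncomputable instance instModule : Module k (Biproduct k H B) := inferInstanceAs (Module k (B ⊗[k] H))

/-- The identification of vector spaces `B ⊗ H = Biproduct k H B`. -/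
noncomputable def of : B ⊗[k] H ≃ₗ[k] Biproduct k H B := LinearEquiv.refl k (B ⊗[k] H)

variable [CrossedModule k H B]

/-- `h ⊗ b ↦ h₁ ▷ b ⊗ h₂`. -/
noncomputable def crossMap : H ⊗[k] B →ₗ[k] B ⊗[k] H :=
  (actMap k H B).rTensor H ∘ₗ (TensorProduct.rightComm k H H B).toLinearMap ∘ₗ
    (comul (R := k) (A := H)).rTensor B

/-- `b ⊗ h ↦ b⁽¹⁾ h ⊗ b⁽²⁾`. -/
noncomputable def crossComap : B ⊗[k] H →ₗ[k] H ⊗[k] B :=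
  (LinearMap.mul' k H).rTensor B ∘ₗ (TensorProduct.rightComm k H B H).toLinearMap ∘ₗ
    (coact (k := k) (H := H) (V := B)).rTensor H

/-- The cross product `(b ⊗ h)(c ⊗ g) = b (h₁ ▷ c) ⊗ h₂ g`. -/
noncomputable def mulMap : (B ⊗[k] H) ⊗[k] (B ⊗[k] H) →ₗ[k] B ⊗[k] H :=
  TensorProduct.map (LinearMap.mul' k B) (LinearMap.mul' k H) ∘ₗ midTwist (crossMap k H B)

/-- The cross coproduct `b ⊗ h ↦ (b₁ ⊗ b₂⁽¹⁾ h₁) ⊗ (b₂⁽²⁾ ⊗ h₂)`. -/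
noncomputable def comulMap [Coalgebra k B] : B ⊗[k] H →ₗ[k] (B ⊗[k] H) ⊗[k] (B ⊗[k] H) :=
  midTwist (crossComap k H B) ∘ₗ
    TensorProduct.map (comul (R := k) (A := B)) (comul (R := k) (A := H))

variable {k H B}

theorem crossMap_tmul (h : H) (b : B) : crossMap k H B (h ⊗ₜ b) =
    ((act (k := k) (H := H) (V := B)).toLinearMap.flip b).rTensor H (comul (R := k) h) := by
  simp only [crossMap, LinearMap.comp_apply, LinearMap.rTensor_tmul]
  induction comul (R := k) h using TensorProduct.induction_on with
  | zero => simp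
  | tmul x y => simp [actMap]
  | add x y hx hy => simp only [TensorProduct.add_tmul, map_add, hx, hy]

theorem mulMap_tmul (b c : B) (h g : H) : mulMap k H B ((b ⊗ₜ h) ⊗ₜ (c ⊗ₜ g)) =
    (b ⊗ₜ 1) * crossMap k H B (h ⊗ₜ c) * (1 ⊗ₜ g) := by
  simp only [mulMap, midTwist, LinearMap.comp_apply, LinearEquiv.coe_coe,
    TensorProduct.assoc_tmul, LinearMap.lTensor_tmul, TensorProduct.assoc_symm_tmul,
    LinearMap.rTensor_tmul]
  induction crossMap k H B (h ⊗ₜ c) using TensorProduct.induction_on with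
  | zero => simp
  | tmul x y => simp
  | add x y hx hy =>
    simp only [TensorProduct.add_tmul, TensorProduct.tmul_add, map_add, hx, hy, mul_add, add_mul]

theorem crossMap_mul (h g : H) (b : B) : crossMap k H B ((h * g) ⊗ₜ b) =
    (LinearMap.mul' k H).lTensor B (TensorProduct.assoc k B H H
      ((crossMap k H B ∘ₗ TensorProduct.mk k H B h).rTensor H (crossMap k H B (g ⊗ₜ b)))) := by
  rw [crossMap_tmul, crossMap_tmul, Bialgebra.comul_mul]
  induction comul (R := k) g using TensorProduct.induction_on with
  | zero => simp
  | add x y hx hy => simp only [mul_add, map_add, hx, hy]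
  | tmul x y =>
    simp only [LinearMap.rTensor_tmul, LinearMap.comp_apply, TensorProduct.mk_apply, crossMap_tmul]
    induction comul (R := k) h using TensorProduct.induction_on with
    | zero => simp
    | add x y hx hy => simp only [add_mul, map_add, TensorProduct.add_tmul, hx, hy]
    | tmul x y => simp

theorem crossMap_one_left (b : B) : crossMap k H B (1 ⊗ₜ b) = b ⊗ₜ 1 := by
  simp [crossMap_tmul, Algebra.TensorProduct.one_def]

variable [Coalgebra k B] [BraidedGroup k H B]

theorem crossMap_one_right (h : H) : crossMap k H B (h ⊗ₜ 1) = 1 ⊗ₜ h := by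
  rw [crossMap_tmul]
  have : (act (k := k) (H := H) (V := B)).toLinearMap.flip 1 =
      (LinearMap.toSpanSingleton k B 1) ∘ₗ counit (R := k) (A := H) := by
    ext h; simp [BraidedGroup.act_one]
  rw [this, LinearMap.rTensor_comp_apply, Coalgebra.rTensor_counit_comul]
  simp

theorem crossMap_mul_right (h : H) (b c : B) : crossMap k H B (h ⊗ₜ (b * c)) =
    (LinearMap.mul' k B).rTensor H ((TensorProduct.assoc k B B H).symm
      ((crossMap k H B ∘ₗ (TensorProduct.mk k H B).flip c).lTensor B (crossMap k H B (h ⊗ₜ b)))) := by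
  let F : H ⊗[k] (H ⊗[k] H) →ₗ[k] B ⊗[k] H :=
    (LinearMap.mul' k B ∘ₗ
      TensorProduct.map ((act (k := k) (H := H) (V := B)).toLinearMap.flip b)
      ((act (k := k) (H := H) (V := B)).toLinearMap.flip c)).rTensor H ∘ₗ
      (TensorProduct.assoc k H H H).symm.toLinearMap
  have h1 : crossMap k H B (h ⊗ₜ (b * c)) =
      F (TensorProduct.assoc k H H H ((comul (R := k)).rTensor H (comul (R := k) h))) := by
    rw [crossMap_tmul]
    induction comul (R := k) h using TensorProduct.induction_on with
    | zero => simp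
    | add x y hx hy => simp only [map_add, hx, hy]
    | tmul x y => simp [F, BraidedGroup.act_mul]
  rw [h1, Coalgebra.coassoc_apply, crossMap_tmul]
  induction comul (R := k) h using TensorProduct.induction_on with
  | zero => simp
  | add x y hx hy => simp only [map_add, hx, hy]
  | tmul x y =>
    simp only [F, LinearMap.rTensor_tmul, LinearMap.lTensor_tmul, LinearMap.comp_apply,
      TensorProduct.mk_apply, LinearMap.flip_apply, crossMap_tmul]
    induction comul (R := k) y using TensorProduct.induction_on with
    | zero => simp
    | add x y hx hy => simp only [map_add, TensorProduct.tmul_add, hx, hy]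
    | tmul x y => simp

variable (k H B)

noncomputable instance instOne : One (Biproduct k H B) := ⟨of k H B (1 ⊗ₜ 1)⟩

noncomputable instance instMul : Mul (Biproduct k H B) :=
  ⟨fun x y => of k H B (mulMap k H B ((of k H B).symm x ⊗ₜ (of k H B).symm y))⟩

variable {k H B}

theorem mul_def (x y : B ⊗[k] H) :
    of k H B x * of k H B y = of k H B (mulMap k H B (x ⊗ₜ y)) := rfl

theorem one_def : (1 : Biproduct k H B) = of k H B (1 ⊗ₜ 1) := rfl

theorem induction_on {p : Biproduct k H B → Prop} (x : Biproduct k H B)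
    (hz : p 0) (ht : ∀ b h, p (of k H B (b ⊗ₜ h))) (ha : ∀ x y, p x → p y → p (x + y)) : p x :=
  TensorProduct.induction_on (motive := fun x => p (of k H B x)) x hz ht
    (fun _ _ hx hy => ha _ _ hx hy)

theorem assoc_mul_left (c : B) (t : B ⊗[k] H) : (LinearMap.mul' k B).rTensor H
    ((TensorProduct.assoc k B B H).symm (c ⊗ₜ t)) = (c ⊗ₜ 1) * t := by
  induction t using TensorProduct.induction_on with
  | zero => simp
  | add x y hx hy => simp only [map_add, TensorProduct.tmul_add, mul_add, hx, hy]
  | tmul x y => simp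

theorem assoc_mul_right (d : H) (t : B ⊗[k] H) : (LinearMap.mul' k H).lTensor B
    (TensorProduct.assoc k B H H (t ⊗ₜ d)) = t * (1 ⊗ₜ d) := by
  induction t using TensorProduct.induction_on with
  | zero => simp
  | add x y hx hy => simp only [map_add, TensorProduct.add_tmul, add_mul, hx, hy]
  | tmul x y => simp

theorem mulMap_assoc (x y z : B ⊗[k] H) :
    mulMap k H B (mulMap k H B (x ⊗ₜ y) ⊗ₜ z) = mulMap k H B (x ⊗ₜ mulMap k H B (y ⊗ₜ z)) := by
  induction x using TensorProduct.induction_on with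
  | zero => simp
  | add x y hx hy => simp only [map_add, TensorProduct.add_tmul, hx, hy]
  | tmul a b =>
  induction y using TensorProduct.induction_on with
  | zero => simp
  | add x y hx hy => simp only [map_add, TensorProduct.add_tmul, TensorProduct.tmul_add, hx, hy]
  | tmul c d =>
  induction z using TensorProduct.induction_on with
  | zero => simp
  | add x y hx hy => simp only [map_add, TensorProduct.tmul_add, hx, hy]
  | tmul e f =>
  -- both sides as bilinear expressions in the two twists
  have hL : ∀ t : B ⊗[k] H, mulMap k H B (((a ⊗ₜ 1) * t * (1 ⊗ₜ d)) ⊗ₜ (e ⊗ₜ f)) =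
      (a ⊗ₜ 1) * (LinearMap.mul' k B).rTensor H ((TensorProduct.assoc k B B H).symm
        ((crossMap k H B ∘ₗ (TensorProduct.mk k H B).flip e ∘ₗ
          (LinearMap.mulRight k d)).lTensor B t)) * (1 ⊗ₜ f) := by
    intro t
    induction t using TensorProduct.induction_on with
    | zero => simp
    | add x y hx hy => simp only [map_add, TensorProduct.add_tmul, mul_add, add_mul, hx, hy]
    | tmul c' b' =>
      simp only [Algebra.TensorProduct.tmul_mul_tmul, one_mul, mul_one, mulMap_tmul,
        LinearMap.lTensor_tmul, LinearMap.comp_apply, LinearMap.mulRight_apply,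
        LinearMap.flip_apply, TensorProduct.mk_apply]
      induction crossMap k H B ((b' * d) ⊗ₜ e) using TensorProduct.induction_on with
      | zero => simp
      | add x y hx hy => simp only [map_add, TensorProduct.tmul_add, mul_add, add_mul, hx, hy]
      | tmul c' b' => simp [mul_assoc]
  have hR : ∀ t : B ⊗[k] H, mulMap k H B ((a ⊗ₜ b) ⊗ₜ ((c ⊗ₜ 1) * t * (1 ⊗ₜ f))) =
      (a ⊗ₜ 1) * (LinearMap.mul' k H).lTensor B (TensorProduct.assoc k B H H
      ((crossMap k H B ∘ₗ TensorProduct.mk k H B b ∘ₗ LinearMap.mulLeft k c).rTensor H t)) *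
        (1 ⊗ₜ f) := by
    intro t
    induction t using TensorProduct.induction_on with
    | zero => simp
    | add x y hx hy =>
      simp only [map_add, TensorProduct.tmul_add, mul_add, add_mul, hx, hy]
    | tmul c' b' =>
      simp only [Algebra.TensorProduct.tmul_mul_tmul, one_mul, mul_one, mulMap_tmul,
        LinearMap.rTensor_tmul, LinearMap.comp_apply, LinearMap.mulLeft_apply,
        TensorProduct.mk_apply]
      induction crossMap k H B (b ⊗ₜ (c * c')) using TensorProduct.induction_on with
      | zero => simp
      | add x y hx hy => simp only [map_add, TensorProduct.add_tmul, mul_add, add_mul, hx, hy]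
      | tmul c' b' => simp [mul_assoc]
  rw [mulMap_tmul a c b d, mulMap_tmul c e d f, hL, hR]
  congr 2
  obtain ⟨s, hs⟩ := TensorProduct.exists_finset (crossMap k H B (b ⊗ₜ c))
  obtain ⟨r, hr⟩ := TensorProduct.exists_finset (crossMap k H B (d ⊗ₜ e))
  have e1 : ∀ b' : H, crossMap k H B ((b' * d) ⊗ₜ e) = ∑ j ∈ r,
      crossMap k H B (b' ⊗ₜ j.1) * (1 ⊗ₜ j.2) := by
    intro b'
    rw [crossMap_mul, hr]
    simp [assoc_mul_right]
  have e2 : ∀ e' : B, crossMap k H B (b ⊗ₜ (c * e')) = ∑ i ∈ s,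
      (i.1 ⊗ₜ 1) * crossMap k H B (i.2 ⊗ₜ e') := by
    intro e'
    rw [crossMap_mul_right, hs]
    simp [assoc_mul_left]
  rw [hs, hr]
  simp only [map_sum, LinearMap.lTensor_tmul, LinearMap.rTensor_tmul, LinearMap.comp_apply,
    LinearMap.mulRight_apply, LinearMap.mulLeft_apply, LinearMap.flip_apply,
    TensorProduct.mk_apply, e1, e2, assoc_mul_left, assoc_mul_right, Finset.mul_sum,
    Finset.sum_mul, mul_assoc]
  exact Finset.sum_comm

theorem mul_eq (x y : Biproduct k H B) :
    x * y = of k H B (mulMap k H B ((of k H B).symm x ⊗ₜ (of k H B).symm y)) := rfl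

theorem zero_mul' (x : Biproduct k H B) : 0 * x = 0 := by simp [mul_eq]

theorem mul_zero' (x : Biproduct k H B) : x * 0 = 0 := by simp [mul_eq]

theorem add_mul' (x y z : Biproduct k H B) : (x + y) * z = x * z + y * z := by
  simp [mul_eq, TensorProduct.add_tmul]

theorem mul_add' (x y z : Biproduct k H B) : x * (y + z) = x * y + x * z := by
  simp [mul_eq, TensorProduct.tmul_add]

theorem smul_mul' (r : k) (x y : Biproduct k H B) : (r • x) * y = r • (x * y) := by
  simp [mul_eq, ← TensorProduct.smul_tmul']

theorem mul_smul' (r : k) (x y : Biproduct k H B) : x * (r • y) = r • (x * y) := by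
  simp [mul_eq]

theorem one_mul' (x : Biproduct k H B) : 1 * x = x := by
  induction x using induction_on with
  | hz => exact mul_zero' _
  | ha x y hx hy => rw [mul_add', hx, hy]
  | ht b h => rw [one_def, mul_def, mulMap_tmul, crossMap_one_left]; simp

theorem mul_one' (x : Biproduct k H B) : x * 1 = x := by
  induction x using induction_on with
  | hz => exact zero_mul' _
  | ha x y hx hy => rw [add_mul', hx, hy]
  | ht b h => rw [one_def, mul_def, mulMap_tmul, crossMap_one_right]; simp

noncomputable instance instRing : Ring (Biproduct k H B) :=
  { (inferInstance : AddCommGroup (Biproduct k H B)),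
    (inferInstance : Mul (Biproduct k H B)),
    (inferInstance : One (Biproduct k H B)) with
    mul_assoc := fun x y z => mulMap_assoc x y z
    one_mul := one_mul'
    mul_one := mul_one'
    left_distrib := mul_add'
    right_distrib := add_mul'
    zero_mul := zero_mul'
    mul_zero := mul_zero' }

noncomputable instance instAlgebra : Algebra k (Biproduct k H B) :=
  Algebra.ofModule smul_mul' (fun r x y => mul_smul' r x y)

variable (k H B)

/-- The inclusion `b ↦ b ⊗ 1` of `B`. -/
noncomputable def incl : B →ₐ[k] Biproduct k H B :=
  AlgHom.ofLinearMap ((of k H B).toLinearMap ∘ₗ (TensorProduct.mk k B H).flip 1) rfl (by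
    intro b c
    simp [mul_def, mulMap_tmul, crossMap_one_left])

/-- The inclusion `j h = 1 ⊗ h` of `H`. -/
noncomputable def inclH : H →ₐ[k] Biproduct k H B :=
  AlgHom.ofLinearMap ((of k H B).toLinearMap ∘ₗ TensorProduct.mk k B H 1) rfl (by
    intro b c
    simp [mul_def, mulMap_tmul, crossMap_one_right])

variable {k H B}

theorem incl_apply (b : B) : incl k H B b = of k H B (b ⊗ₜ 1) := rfl

theorem inclH_apply (h : H) : inclH k H B h = of k H B (1 ⊗ₜ h) := rfl

theorem of_tmul (b : B) (h : H) : of k H B (b ⊗ₜ h) = incl k H B b * inclH k H B h := by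
  simp [incl_apply, inclH_apply, mul_def, mulMap_tmul, crossMap_one_left]

theorem inclH_mul_incl (h : H) (b : B) : inclH k H B h * incl k H B b =
    LinearMap.mul' k _ (TensorProduct.map ((incl k H B).toLinearMap ∘ₗ
      (act (k := k) (H := H) (V := B)).toLinearMap.flip b) (inclH k H B).toLinearMap
        (comul (R := k) h)) := by
  rw [incl_apply, inclH_apply, mul_def, mulMap_tmul, crossMap_tmul]
  induction comul (R := k) h using TensorProduct.induction_on with
  | zero => simp
  | add x y hx hy => simp only [map_add, mul_add, add_mul, hx, hy]
  | tmul x y => simp [of_tmul]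

theorem algHom_ext {A : Type*} [Semiring A] [Algebra k A] {f g : Biproduct k H B →ₐ[k] A}
    (h₁ : ∀ b, f (incl k H B b) = g (incl k H B b))
    (h₂ : ∀ h, f (inclH k H B h) = g (inclH k H B h)) : f = g := by
  ext x
  induction x using induction_on with
  | hz => simp
  | ha x y hx hy => simp only [map_add, hx, hy]
  | ht b h => rw [of_tmul, map_mul, map_mul, h₁, h₂]

variable (k H B)

/-- The coaction of `H` on `B` as an algebra map. -/
noncomputable def coactHom : B →ₐ[k] H ⊗[k] B :=
  AlgHom.ofLinearMap (coact (k := k) (H := H)) BraidedGroup.coact_one BraidedGroup.coact_mul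

/-- `b ↦ j b⁽¹⁾ ⊗ b⁽²⁾`. -/
noncomputable def coactP : B →ₐ[k] Biproduct k H B ⊗[k] Biproduct k H B :=
  (Algebra.TensorProduct.map (inclH k H B) (incl k H B)).comp (coactHom k H B)

/-- `h ↦ j h₁ ⊗ j h₂`. -/
noncomputable def comulH : H →ₐ[k] Biproduct k H B ⊗[k] Biproduct k H B :=
  (Algebra.TensorProduct.map (inclH k H B) (inclH k H B)).comp (Bialgebra.comulAlgHom k H)

/-- `b ⊗ c ↦ b j c⁽¹⁾ ⊗ c⁽²⁾`. -/
noncomputable def comulAux : B ⊗[k] B →ₗ[k] Biproduct k H B ⊗[k] Biproduct k H B :=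
  LinearMap.mul' k _ ∘ₗ TensorProduct.map
    (Algebra.TensorProduct.includeLeft.comp (incl k H B) :
      B →ₐ[k] Biproduct k H B ⊗[k] Biproduct k H B).toLinearMap
    (coactP k H B).toLinearMap

/-- `b ↦ b₁ j b₂⁽¹⁾ ⊗ b₂⁽²⁾`. -/
noncomputable def comulB : B →ₗ[k] Biproduct k H B ⊗[k] Biproduct k H B :=
  comulAux k H B ∘ₗ comul (R := k)

/-- The coproduct as a linear map. -/
noncomputable def comulLin : Biproduct k H B →ₗ[k] Biproduct k H B ⊗[k] Biproduct k H B :=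
  TensorProduct.map (of k H B).toLinearMap (of k H B).toLinearMap ∘ₗ comulMap k H B ∘ₗ
    (of k H B).symm.toLinearMap

variable {k H B}

theorem coactP_apply (b : B) : coactP k H B b =
    TensorProduct.map (inclH k H B).toLinearMap (incl k H B).toLinearMap (coact (k := k) b) := rfl

theorem comulH_apply (h : H) : comulH k H B h =
    TensorProduct.map (inclH k H B).toLinearMap (inclH k H B).toLinearMap (comul (R := k) h) := rfl

theorem comulAux_tmul (b c : B) :
    comulAux k H B (b ⊗ₜ c) = (incl k H B b ⊗ₜ 1) * coactP k H B c := rfl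

theorem comulLin_of (b : B) (h : H) :
    comulLin k H B (of k H B (b ⊗ₜ h)) = comulB k H B b * comulH k H B h := by
  simp only [comulLin, comulMap, LinearMap.comp_apply, LinearEquiv.coe_coe,
    LinearEquiv.symm_apply_apply, TensorProduct.map_tmul, comulB, comulH_apply]
  induction comul (R := k) b using TensorProduct.induction_on with
  | zero => simp
  | add x y hx hy => simp only [map_add, add_mul, TensorProduct.add_tmul, hx, hy]
  | tmul b c =>
  induction comul (R := k) h using TensorProduct.induction_on with
  | zero => simp
  | add x y hx hy => simp only [map_add, mul_add, TensorProduct.tmul_add, hx, hy]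
  | tmul h g =>
  simp only [comulAux_tmul, coactP_apply, midTwist, crossComap, LinearMap.comp_apply,
    LinearEquiv.coe_coe,
    TensorProduct.assoc_tmul, LinearMap.lTensor_tmul, TensorProduct.assoc_symm_tmul,
    LinearMap.rTensor_tmul]
  induction coact (k := k) (H := H) c using TensorProduct.induction_on with
  | zero => simp
  | add x y hx hy =>
    simp only [map_add, mul_add, add_mul, TensorProduct.add_tmul, TensorProduct.tmul_add, hx, hy]
  | tmul x y => simp [of_tmul, mul_assoc]

theorem coactP_mul_incl (b c : B) : coactP k H B b * (incl k H B c ⊗ₜ 1) =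
    comulAux k H B (braiding k H B B (b ⊗ₜ c)) := by
  let F : H ⊗[k] (H ⊗[k] B) →ₗ[k] Biproduct k H B ⊗[k] Biproduct k H B :=
    TensorProduct.map (LinearMap.mul' k _ ∘ₗ TensorProduct.map ((incl k H B).toLinearMap ∘ₗ
      (act (k := k) (H := H) (V := B)).toLinearMap.flip c) (inclH k H B).toLinearMap)
      (incl k H B).toLinearMap ∘ₗ (TensorProduct.assoc k H H B).symm.toLinearMap
  have h1 : coactP k H B b * (incl k H B c ⊗ₜ 1) =
      F (TensorProduct.assoc k H H B ((comul (R := k)).rTensor B (coact (k := k) b))) := by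
    rw [coactP_apply]
    induction coact (k := k) (H := H) b using TensorProduct.induction_on with
    | zero => simp
    | add x y hx hy => simp only [map_add, add_mul, hx, hy]
    | tmul x y => simp [F, inclH_mul_incl]
  rw [h1, CrossedModule.coassoc_coact]
  simp only [braiding, LinearMap.comp_apply, LinearMap.rTensor_tmul]
  induction coact (k := k) (H := H) b using TensorProduct.induction_on with
  | zero => simp
  | add x y hx hy => simp only [map_add, TensorProduct.add_tmul, hx, hy]
  | tmul x y =>
    simp only [F, LinearMap.lTensor_tmul, LinearEquiv.coe_coe, TensorProduct.rightComm_tmul,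
      LinearMap.rTensor_tmul, comulAux_tmul, coactP_apply, actMap, TensorProduct.lift.tmul,
      LinearMap.comp_apply]
    induction coact (k := k) (H := H) y using TensorProduct.induction_on with
    | zero => simp
    | add x y hx hy => simp only [map_add, TensorProduct.tmul_add, mul_add, hx, hy]
    | tmul x y => simp

theorem comulB_mul (b c : B) : comulB k H B (b * c) = comulB k H B b * comulB k H B c := by
  simp only [comulB, LinearMap.comp_apply, BraidedGroup.comul_mul (k := k) (H := H)]
  induction comul (R := k) b using TensorProduct.induction_on with
  | zero => simp
  | add x y hx hy => simp only [map_add, add_mul, TensorProduct.add_tmul, hx, hy]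
  | tmul b b' =>
  induction comul (R := k) c using TensorProduct.induction_on with
  | zero => simp
  | add x y hx hy => simp only [map_add, mul_add, TensorProduct.tmul_add, hx, hy]
  | tmul c c' =>
  have : comulAux k H B (b ⊗ₜ b') * comulAux k H B (c ⊗ₜ c') =
      (incl k H B b ⊗ₜ 1) * comulAux k H B (braiding k H B B (b' ⊗ₜ c)) * coactP k H B c' := by
    rw [← coactP_mul_incl, comulAux_tmul, comulAux_tmul]; simp only [mul_assoc]
  rw [this]
  simp only [midTwist, LinearMap.comp_apply, LinearEquiv.coe_coe,
    TensorProduct.assoc_tmul, LinearMap.lTensor_tmul, TensorProduct.assoc_symm_tmul,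
    LinearMap.rTensor_tmul]
  induction braiding k H B B (b' ⊗ₜ c) using TensorProduct.induction_on with
  | zero => simp
  | add x y hx hy =>
    simp only [map_add, mul_add, add_mul, TensorProduct.add_tmul, TensorProduct.tmul_add, hx, hy]
  | tmul x y =>
    simp only [TensorProduct.assoc_tmul, TensorProduct.assoc_symm_tmul, TensorProduct.map_tmul,
      LinearMap.mul'_apply, comulAux_tmul, map_mul]
    rw [← mul_one (1 : Biproduct k H B), ← Algebra.TensorProduct.tmul_mul_tmul]
    simp only [mul_assoc, mul_one]

theorem comulH_mul_incl (h : H) (b : B) : comulH k H B h * (incl k H B b ⊗ₜ 1) =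
    LinearMap.mul' k _ (TensorProduct.map
      ((Algebra.TensorProduct.includeLeft.comp (incl k H B) :
      B →ₐ[k] Biproduct k H B ⊗[k] Biproduct k H B).toLinearMap ∘ₗ
      (act (k := k) (H := H) (V := B)).toLinearMap.flip b) (comulH k H B).toLinearMap
      (comul (R := k) h)) := by
  let F : H ⊗[k] (H ⊗[k] H) →ₗ[k] Biproduct k H B ⊗[k] Biproduct k H B :=
    TensorProduct.map (LinearMap.mul' k _ ∘ₗ TensorProduct.map ((incl k H B).toLinearMap ∘ₗ
      (act (k := k) (H := H) (V := B)).toLinearMap.flip b) (inclH k H B).toLinearMap)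
      (inclH k H B).toLinearMap ∘ₗ (TensorProduct.assoc k H H H).symm.toLinearMap
  have h1 : comulH k H B h * (incl k H B b ⊗ₜ 1) =
      F (TensorProduct.assoc k H H H ((comul (R := k)).rTensor H (comul (R := k) h))) := by
    rw [comulH_apply]
    induction comul (R := k) h using TensorProduct.induction_on with
    | zero => simp
    | add x y hx hy => simp only [map_add, add_mul, hx, hy]
    | tmul x y => simp [F, inclH_mul_incl]
  rw [h1, Coalgebra.coassoc_apply]
  induction comul (R := k) h using TensorProduct.induction_on with
  | zero => simp
  | add x y hx hy => simp only [map_add, hx, hy]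
  | tmul x y =>
    simp only [F, LinearMap.lTensor_tmul, LinearEquiv.coe_coe, TensorProduct.map_tmul,
      LinearMap.comp_apply, AlgHom.toLinearMap_apply, comulH_apply, LinearMap.mul'_apply]
    induction comul (R := k) y using TensorProduct.induction_on with
    | zero => simp
    | add x y hx hy => simp only [map_add, TensorProduct.tmul_add, mul_add, hx, hy]
    | tmul x y => simp

theorem comulH_mul_coactP (h : H) (b : B) : comulH k H B h * coactP k H B b =
    LinearMap.mul' k _ (TensorProduct.map ((coactP k H B).toLinearMap ∘ₗ
      (act (k := k) (H := H) (V := B)).toLinearMap.flip b) (comulH k H B).toLinearMap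
      (comul (R := k) h)) := by
  let Y : H ⊗[k] H →ₗ[k] H ⊗[k] B :=
    TensorProduct.map (LinearMap.mul' k H) (actMap k H B) ∘ₗ midTwist (tflip k H H) ∘ₗ
      (TensorProduct.mk k (H ⊗[k] H) (H ⊗[k] B)).flip (coact (k := k) b)
  let Y' : H ⊗[k] H →ₗ[k] H ⊗[k] B :=
    (LinearMap.mul' k H).rTensor B ∘ₗ (TensorProduct.rightComm k H B H).toLinearMap ∘ₗ
        (coact (k := k) ∘ₗ (act (k := k) (H := H) (V := B)).toLinearMap.flip b).rTensor H
  have hY : ∀ x : H, Y (comul (R := k) x) = Y' (comul (R := k) x) :=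
    fun x => CrossedModule.crossed x b
  let G : (H ⊗[k] B) ⊗[k] H →ₗ[k] Biproduct k H B ⊗[k] Biproduct k H B :=
    LinearMap.mul' k _ ∘ₗ TensorProduct.map
      (TensorProduct.map (inclH k H B).toLinearMap (incl k H B).toLinearMap)
      ((Algebra.TensorProduct.includeRight.comp (inclH k H B) :
      H →ₐ[k] Biproduct k H B ⊗[k] Biproduct k H B).toLinearMap)
  have h1 : comulH k H B h * coactP k H B b = G (Y.rTensor H ((TensorProduct.assoc k H H H).symm
      ((comul (R := k)).lTensor H (comul (R := k) h)))) := by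
    rw [comulH_apply, coactP_apply]
    induction comul (R := k) h using TensorProduct.induction_on with
    | zero => simp
    | add x y hx hy => simp only [map_add, add_mul, hx, hy]
    | tmul x y =>
      simp only [Y, midTwist, tflip]
      induction coact (k := k) (H := H) b using TensorProduct.induction_on with
      | zero => simp
      | add x y hx hy =>
        simp only [map_add, mul_add, LinearMap.comp_add, LinearMap.rTensor_add,
          LinearMap.add_apply, hx, hy]
      | tmul z w =>
        simp only [TensorProduct.map_tmul, AlgHom.toLinearMap_apply,
          Algebra.TensorProduct.tmul_mul_tmul, inclH_mul_incl, LinearMap.lTensor_tmul]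
        induction comul (R := k) y using TensorProduct.induction_on with
        | zero => simp
        | add x y hx hy =>
          simp only [map_add, TensorProduct.tmul_add, hx, hy]
        | tmul p q => simp [G, actMap]
  rw [h1, Coalgebra.coassoc_symm_apply]
  have h2 : Y.rTensor H ((comul (R := k)).rTensor H (comul (R := k) h)) =
      Y'.rTensor H ((comul (R := k)).rTensor H (comul (R := k) h)) := by
    rw [← LinearMap.rTensor_comp_apply, ← LinearMap.rTensor_comp_apply,
      show Y ∘ₗ comul = Y' ∘ₗ comul from LinearMap.ext hY]
  rw [h2, ← Coalgebra.coassoc_symm_apply]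
  induction comul (R := k) h using TensorProduct.induction_on with
  | zero => simp
  | add x y hx hy => simp only [map_add, hx, hy]
  | tmul x y =>
    simp only [LinearMap.lTensor_tmul, TensorProduct.map_tmul,
      LinearMap.comp_apply, AlgHom.toLinearMap_apply, comulH_apply, coactP_apply,
      LinearMap.mul'_apply, LinearMap.flip_apply]
    induction comul (R := k) y using TensorProduct.induction_on with
    | zero => simp
    | add x y hx hy => simp only [map_add, TensorProduct.tmul_add, mul_add, hx, hy]
    | tmul p q =>
      simp only [Y', G, LinearMap.comp_apply, LinearMap.rTensor_tmul,
        TensorProduct.assoc_symm_tmul, LinearMap.flip_apply, AlgHom.toLinearMap_apply]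
      induction coact (k := k) (H := H) (act (k := k) x b) using TensorProduct.induction_on with
      | zero => simp
      | add x y hx hy =>
        simp only [map_add, TensorProduct.add_tmul, add_mul, hx, hy]
      | tmul z w => simp

theorem comulH_mul_comulAux (h : H) (t : B ⊗[k] B) : comulH k H B h * comulAux k H B t =
    LinearMap.mul' k _ (TensorProduct.map (comulAux k H B ∘ₗ
      TensorProduct.map (actMap k H B) (actMap k H B) ∘ₗ midTwist (tflip k H B) ∘ₗ
      (TensorProduct.mk k (H ⊗[k] H) (B ⊗[k] B)).flip t ∘ₗ comul (R := k))
      (comulH k H B).toLinearMap (comul (R := k) h)) := by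
  induction t using TensorProduct.induction_on with
  | zero => simp
  | add x y hx hy =>
    simp only [map_add, mul_add, LinearMap.comp_add, LinearMap.add_comp,
      TensorProduct.map_add_left, LinearMap.add_apply, hx, hy]
  | tmul b c =>
  let i₁ : B →ₗ[k] Biproduct k H B ⊗[k] Biproduct k H B :=
    (Algebra.TensorProduct.includeLeft.comp (incl k H B) :
      B →ₐ[k] Biproduct k H B ⊗[k] Biproduct k H B).toLinearMap
  let F : H ⊗[k] (H ⊗[k] H) →ₗ[k] Biproduct k H B ⊗[k] Biproduct k H B :=
    LinearMap.mul' k _ ∘ₗ TensorProduct.map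
      (i₁ ∘ₗ (act (k := k) (H := H) (V := B)).toLinearMap.flip b)
      (LinearMap.mul' k _ ∘ₗ TensorProduct.map ((coactP k H B).toLinearMap ∘ₗ
      (act (k := k) (H := H) (V := B)).toLinearMap.flip c) (comulH k H B).toLinearMap)
  have h1 : comulH k H B h * comulAux k H B (b ⊗ₜ c) =
      F ((comul (R := k)).lTensor H (comul (R := k) h)) := by
    rw [comulAux_tmul, ← mul_assoc, comulH_mul_incl]
    induction comul (R := k) h using TensorProduct.induction_on with
    | zero => simp
    | add x y hx hy => simp only [map_add, add_mul, hx, hy]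
    | tmul x y => simp [F, i₁, mul_assoc, comulH_mul_coactP]
  rw [h1, ← Coalgebra.coassoc_apply]
  induction comul (R := k) h using TensorProduct.induction_on with
  | zero => simp
  | add x y hx hy => simp only [map_add, hx, hy]
  | tmul x y =>
    simp only [LinearMap.rTensor_tmul, TensorProduct.map_tmul, LinearMap.comp_apply]
    induction comul (R := k) x using TensorProduct.induction_on with
    | zero => simp
    | add x y hx hy =>
      simp only [map_add, TensorProduct.add_tmul, hx, hy]
    | tmul p q => simp [F, i₁, midTwist, actMap, comulAux_tmul, mul_assoc]

theorem comulH_mul_comulB (h : H) (b : B) : comulH k H B h * comulB k H B b =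
    LinearMap.mul' k _ (TensorProduct.map (comulB k H B) (comulH k H B).toLinearMap
      (crossMap k H B (h ⊗ₜ b))) := by
  have : comulB k H B b = comulAux k H B (comul (R := k) b) := rfl
  rw [this, comulH_mul_comulAux, crossMap_tmul, LinearMap.rTensor, ← LinearMap.comp_apply
    (TensorProduct.map _ _) (TensorProduct.map _ _), ← TensorProduct.map_comp, LinearMap.comp_id]
  congr 3
  ext x
  simp only [LinearMap.comp_apply, LinearMap.flip_apply, TensorProduct.mk_apply, comulB,
    AlgHom.toLinearMap_apply, BraidedGroup.act_comul]

theorem comulLin_mul (x y : Biproduct k H B) :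
    comulLin k H B (x * y) = comulLin k H B x * comulLin k H B y := by
  induction x using induction_on with
  | hz => simp
  | ha x y hx hy => simp only [map_add, add_mul, hx, hy]
  | ht b h =>
  induction y using induction_on with
  | hz => simp
  | ha x y hx hy => simp only [map_add, mul_add, hx, hy]
  | ht c g =>
  have key : ∀ t : B ⊗[k] H, comulLin k H B (of k H B ((b ⊗ₜ 1) * t * (1 ⊗ₜ g))) =
      comulB k H B b * LinearMap.mul' k _ (TensorProduct.map (comulB k H B)
        (comulH k H B).toLinearMap t) * comulH k H B g := by
    intro t
    induction t using TensorProduct.induction_on with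
    | zero => simp
    | add x y hx hy => simp only [map_add, mul_add, add_mul, hx, hy]
    | tmul x y => simp [comulLin_of, comulB_mul, mul_assoc]
  rw [mul_def, mulMap_tmul, key, ← comulH_mul_comulB, comulLin_of, comulLin_of]
  simp only [mul_assoc]

theorem coactP_one : coactP k H B 1 = 1 := map_one _

theorem comulB_one : comulB k H B 1 = 1 := by
  rw [comulB, LinearMap.comp_apply, BraidedGroup.comul_one (k := k) (H := H), comulAux_tmul,
    map_one, map_one, mul_one, ← Algebra.TensorProduct.one_def]

variable (k H B)

/-- The coproduct of the biproduct, as an algebra map. -/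
noncomputable def comulHom : Biproduct k H B →ₐ[k] Biproduct k H B ⊗[k] Biproduct k H B :=
  AlgHom.ofLinearMap (comulLin k H B) (by
    rw [one_def, comulLin_of, comulB_one, map_one, one_mul]) comulLin_mul

/-- The counit `b ⊗ h ↦ ε(b) ε(h)` as a linear map. -/
noncomputable def counitLin : Biproduct k H B →ₗ[k] k :=
  LinearMap.mul' k k ∘ₗ TensorProduct.map (counit (R := k) (A := B)) (counit (R := k) (A := H)) ∘ₗ
    (of k H B).symm.toLinearMap

variable {k H B}

theorem counitLin_of (b : B) (h : H) :
    counitLin k H B (of k H B (b ⊗ₜ h)) = counit (R := k) b * counit (R := k) h := by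
  simp [counitLin]

theorem counitLin_mul (x y : Biproduct k H B) :
    counitLin k H B (x * y) = counitLin k H B x * counitLin k H B y := by
  induction x using induction_on with
  | hz => simp
  | ha x y hx hy => simp only [map_add, add_mul, hx, hy]
  | ht b h =>
  induction y using induction_on with
  | hz => simp
  | ha x y hx hy => simp only [map_add, mul_add, hx, hy]
  | ht c g =>
  have key : ∀ t : H ⊗[k] H, counitLin k H B (of k H B ((b ⊗ₜ 1) *
      ((act (k := k) (H := H) (V := B)).toLinearMap.flip c).rTensor H t * (1 ⊗ₜ g))) =
      counit (R := k) b * (counit (R := k) c * counit (R := k) (TensorProduct.lid k H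
        ((counit (R := k)).rTensor H t))) * counit (R := k) g := by
    intro t
    induction t using TensorProduct.induction_on with
    | zero => simp
    | add x y hx hy => simp only [map_add, mul_add, add_mul, hx, hy]
    | tmul x y =>
      simp [counitLin_of, BraidedGroup.counit_mul (k := k) (H := H),
        BraidedGroup.act_counit (k := k) (H := H)]
      ring
  rw [mul_def, mulMap_tmul, crossMap_tmul, key, counitLin_of, counitLin_of]
  simp
  ring

variable (k H B)

/-- The counit of the biproduct, as an algebra map. -/
noncomputable def counitHom : Biproduct k H B →ₐ[k] k :=
  AlgHom.ofLinearMap (counitLin k H B) (by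
    rw [one_def, counitLin_of]; simp [BraidedGroup.counit_one (k := k) (H := H) (B := B)])
    counitLin_mul

variable {k H B}

theorem comulHom_incl (b : B) : comulHom k H B (incl k H B b) = comulB k H B b := by
  change comulLin k H B _ = _
  rw [incl_apply, comulLin_of, map_one, mul_one]

theorem comulHom_inclH (h : H) : comulHom k H B (inclH k H B h) = comulH k H B h := by
  change comulLin k H B _ = _
  rw [inclH_apply, comulLin_of, comulB_one, one_mul]

theorem counitHom_incl (b : B) : counitHom k H B (incl k H B b) = counit (R := k) b := by
  rw [counitHom, AlgHom.ofLinearMap_apply, incl_apply, counitLin_of]; simp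

theorem counitHom_inclH (h : H) : counitHom k H B (inclH k H B h) = counit (R := k) h := by
  rw [counitHom, AlgHom.ofLinearMap_apply, inclH_apply, counitLin_of]; simp [BraidedGroup.counit_one (k := k) (H := H) (B := B)]

variable (k H B)

/-- `x ⊗ y ↦ x ⊗ (y ⊗ 1)`. -/
noncomputable def inc12 : Biproduct k H B ⊗[k] Biproduct k H B →ₐ[k]
    Biproduct k H B ⊗[k] (Biproduct k H B ⊗[k] Biproduct k H B) :=
  Algebra.TensorProduct.map (AlgHom.id k _) Algebra.TensorProduct.includeLeft

/-- `b ↦ j b⁽¹⁾ ⊗ j b⁽²⁾ ⊗ b⁽³⁾`. -/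
noncomputable def coactP₂ : B →ₐ[k] Biproduct k H B ⊗[k] (Biproduct k H B ⊗[k] Biproduct k H B) :=
  (Algebra.TensorProduct.map (inclH k H B) (coactP k H B)).comp (coactHom k H B)

variable {k H B}

theorem inc12_tmul (x y : Biproduct k H B) : inc12 k H B (x ⊗ₜ y) = x ⊗ₜ (y ⊗ₜ 1) := rfl

theorem assoc_comul_coactP (b : B) : Algebra.TensorProduct.assoc k k k _ _ _
    (Algebra.TensorProduct.map (comulHom k H B) (AlgHom.id k _) (coactP k H B b)) =
      coactP₂ k H B b := by
  have e : coactP₂ k H B b = TensorProduct.map (inclH k H B).toLinearMap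
      (TensorProduct.map (inclH k H B).toLinearMap (incl k H B).toLinearMap)
      ((coact (k := k)).lTensor H (coact (k := k) b)) := by
    simp only [coactP₂, AlgHom.comp_apply]
    change TensorProduct.map _ _ (coact (k := k) b) = _
    induction coact (k := k) (H := H) b using TensorProduct.induction_on with
    | zero => simp
    | add x y hx hy => simp only [map_add, hx, hy]
    | tmul x y => rfl
  rw [e, ← CrossedModule.coassoc_coact, coactP_apply]
  induction coact (k := k) (H := H) b using TensorProduct.induction_on with
  | zero => simp
  | add x y hx hy => simp only [map_add, hx, hy]
  | tmul x y =>
    simp only [TensorProduct.map_tmul, AlgHom.toLinearMap_apply, Algebra.TensorProduct.map_tmul,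
      comulHom_inclH, comulH_apply, LinearMap.rTensor_tmul, AlgHom.id_apply]
    induction comul (R := k) x using TensorProduct.induction_on with
    | zero => simp
    | add x y hx hy => simp only [map_add, TensorProduct.add_tmul, hx, hy]
    | tmul x y => simp

theorem assoc_tmul_one (t : Biproduct k H B ⊗[k] Biproduct k H B) :
    Algebra.TensorProduct.assoc k k k _ _ _ (t ⊗ₜ[k] (1 : Biproduct k H B)) = inc12 k H B t := by
  induction t using TensorProduct.induction_on with
  | zero => simp
  | add x y hx hy => simp only [map_add, TensorProduct.add_tmul, hx, hy]
  | tmul x y => simp [inc12]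

theorem map_comulAux (c : B) : TensorProduct.map (inclH k H B).toLinearMap (comulB k H B)
    (coact (k := k) c) = LinearMap.mul' k _ (TensorProduct.map
      ((inc12 k H B).toLinearMap ∘ₗ (coactP k H B).toLinearMap) (coactP₂ k H B).toLinearMap
      (comul (R := k) c)) := by
  rw [comulB, ← LinearMap.comp_id (inclH k H B).toLinearMap, TensorProduct.map_comp,
    LinearMap.comp_apply]
  change TensorProduct.map _ _ ((comul (R := k)).lTensor H _) = _
  rw [BraidedGroup.coact_comul]
  induction comul (R := k) c using TensorProduct.induction_on with
  | zero => simp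
  | add x y hx hy => simp only [map_add, hx, hy]
  | tmul b c =>
  simp only [leftTensorCoact, LinearMap.comp_apply, TensorProduct.map_tmul, LinearMap.mul'_apply,
    AlgHom.toLinearMap_apply, coactP_apply, coactP₂, AlgHom.comp_apply]
  change _ = _ * TensorProduct.map (inclH k H B).toLinearMap (coactP k H B).toLinearMap
    (coact (k := k) c)
  induction coact (k := k) (H := H) b using TensorProduct.induction_on with
  | zero => simp
  | add x y hx hy => simp only [map_add, add_mul, TensorProduct.add_tmul, hx, hy]
  | tmul x y =>
  induction coact (k := k) (H := H) c using TensorProduct.induction_on with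
  | zero => simp
  | add x y hx hy => simp only [map_add, mul_add, TensorProduct.tmul_add, hx, hy]
  | tmul z w => simp [midTwist, inc12, comulAux_tmul]

theorem coassoc_incl (b : B) : Algebra.TensorProduct.assoc k k k _ _ _
    (Algebra.TensorProduct.map (comulHom k H B) (AlgHom.id k _) (comulB k H B b)) =
    Algebra.TensorProduct.map (AlgHom.id k _) (comulHom k H B) (comulB k H B b) := by
  let Q : B ⊗[k] (B ⊗[k] B) →ₗ[k]
      Biproduct k H B ⊗[k] (Biproduct k H B ⊗[k] Biproduct k H B) :=
    LinearMap.mul' k _ ∘ₗ TensorProduct.map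
      (Algebra.TensorProduct.includeLeft.comp (incl k H B) :
        B →ₐ[k] Biproduct k H B ⊗[k] (Biproduct k H B ⊗[k] Biproduct k H B)).toLinearMap
      (LinearMap.mul' k _ ∘ₗ TensorProduct.map
      ((inc12 k H B).toLinearMap ∘ₗ (coactP k H B).toLinearMap) (coactP₂ k H B).toLinearMap)
  have h1 : Algebra.TensorProduct.assoc k k k _ _ _
      (Algebra.TensorProduct.map (comulHom k H B) (AlgHom.id k _) (comulB k H B b)) =
      Q (TensorProduct.assoc k B B B ((comul (R := k)).rTensor B (comul (R := k) b))) := by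
    rw [comulB, LinearMap.comp_apply]
    induction comul (R := k) b using TensorProduct.induction_on with
    | zero => simp
    | add x y hx hy => simp only [map_add, hx, hy]
    | tmul b c =>
      rw [comulAux_tmul, map_mul, map_mul, assoc_comul_coactP, Algebra.TensorProduct.map_tmul,
        comulHom_incl, map_one, assoc_tmul_one, LinearMap.rTensor_tmul, comulB,
        LinearMap.comp_apply]
      induction comul (R := k) b using TensorProduct.induction_on with
      | zero => simp
      | add x y hx hy => simp only [map_add, add_mul, TensorProduct.add_tmul, hx, hy]
      | tmul x y => simp [Q, comulAux_tmul, inc12_tmul, mul_assoc, Algebra.TensorProduct.one_def]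
  rw [h1, Coalgebra.coassoc_apply]
  change _ = Algebra.TensorProduct.map (AlgHom.id k _) (comulHom k H B)
    (comulAux k H B (comul (R := k) b))
  induction comul (R := k) b using TensorProduct.induction_on with
  | zero => simp
  | add x y hx hy => simp only [map_add, hx, hy]
  | tmul b c =>
    have e : Algebra.TensorProduct.map (AlgHom.id k _) (comulHom k H B) (coactP k H B c) =
        TensorProduct.map (inclH k H B).toLinearMap (comulB k H B) (coact (k := k) c) := by
      rw [coactP_apply]
      induction coact (k := k) (H := H) c using TensorProduct.induction_on with
      | zero => simp
      | add x y hx hy => simp only [map_add, hx, hy]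
      | tmul x y => simp [comulHom_incl]
    rw [comulAux_tmul, map_mul, e, map_comulAux]
    simp [Q]

theorem map_counit_coactP (b : B) :
    Algebra.TensorProduct.map (counitHom k H B) (AlgHom.id k _) (coactP k H B b) =
      1 ⊗ₜ incl k H B b := by
  conv_rhs => rw [← CrossedModule.counit_coact (k := k) (H := H) b]
  rw [ coactP_apply]
  induction coact (k := k) (H := H) b using TensorProduct.induction_on with
  | zero => simp
  | add x y hx hy => simp only [map_add, TensorProduct.tmul_add, hx, hy]
  | tmul x y => simp [counitHom_inclH, TensorProduct.smul_tmul']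

theorem map_counit_coactP' (b : B) :
    Algebra.TensorProduct.map (AlgHom.id k _) (counitHom k H B) (coactP k H B b) =
      1 ⊗ₜ counit (R := k) b := by
  have := congrArg (fun x => inclH k H B x ⊗ₜ[k] (1 : k))
    (BraidedGroup.coact_counit (k := k) (H := H) b)
  simp only [map_smul, map_one, TensorProduct.smul_tmul, smul_eq_mul, mul_one] at this
  rw [← this, coactP_apply]
  induction coact (k := k) (H := H) b using TensorProduct.induction_on with
  | zero => simp
  | add x y hx hy => simp only [map_add, TensorProduct.add_tmul, hx, hy]
  | tmul x y => simp [counitHom_incl, TensorProduct.smul_tmul]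

variable (k H B)

noncomputable instance instBialgebra : Bialgebra k (Biproduct k H B) :=
  Bialgebra.ofAlgHom (comulHom k H B) (counitHom k H B)
    (algHom_ext (fun b => by
      simp only [AlgHom.comp_apply, comulHom_incl]
      exact coassoc_incl b)
    (fun h => by
      simp only [AlgHom.comp_apply, comulHom_inclH, comulH_apply]
      have h1 : ∀ t : H ⊗[k] H, Algebra.TensorProduct.assoc k k k _ _ _
          (Algebra.TensorProduct.map (comulHom k H B) (AlgHom.id k _) (TensorProduct.map
            (inclH k H B).toLinearMap (inclH k H B).toLinearMap t)) =
          TensorProduct.map (inclH k H B).toLinearMap (TensorProduct.map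
            (inclH k H B).toLinearMap (inclH k H B).toLinearMap)
            (TensorProduct.assoc k H H H ((comul (R := k)).rTensor H t)) := by
        intro t
        induction t using TensorProduct.induction_on with
        | zero => simp
        | add x y hx hy => simp only [map_add, hx, hy]
        | tmul x y =>
          simp only [TensorProduct.map_tmul, AlgHom.toLinearMap_apply, comulHom_inclH,
            Algebra.TensorProduct.map_tmul, comulH_apply, LinearMap.rTensor_tmul, AlgHom.id_apply]
          induction comul (R := k) x using TensorProduct.induction_on with
          | zero => simp
          | add x y hx hy => simp only [map_add, TensorProduct.add_tmul, hx, hy]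
          | tmul x y => simp
      have h2 : ∀ t : H ⊗[k] H,
          Algebra.TensorProduct.map (AlgHom.id k _) (comulHom k H B) (TensorProduct.map
            (inclH k H B).toLinearMap (inclH k H B).toLinearMap t) =
          TensorProduct.map (inclH k H B).toLinearMap (TensorProduct.map
            (inclH k H B).toLinearMap (inclH k H B).toLinearMap)
            ((comul (R := k)).lTensor H t) := by
        intro t
        induction t using TensorProduct.induction_on with
        | zero => simp
        | add x y hx hy => simp only [map_add, hx, hy]
        | tmul x y => simp [comulHom_inclH, comulH_apply]
      rw [h2, ← Coalgebra.coassoc_apply, ← h1]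
      rfl))
    (algHom_ext (fun b => by
      simp only [AlgHom.comp_apply, comulHom_incl, comulB, LinearMap.comp_apply]
      have h1 : ∀ t : B ⊗[k] B, Algebra.TensorProduct.map (counitHom k H B) (AlgHom.id k _)
          (comulAux k H B t) =
          1 ⊗ₜ incl k H B (TensorProduct.lid k B ((counit (R := k)).rTensor B t)) := by
        intro t
        induction t using TensorProduct.induction_on with
        | zero => simp
        | add x y hx hy => simp only [map_add, TensorProduct.tmul_add, hx, hy]
        | tmul x y =>
          rw [comulAux_tmul, map_mul, map_counit_coactP]
          simp [counitHom_incl, TensorProduct.smul_tmul']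
      rw [h1]
      simp)
    (fun h => by
      simp only [AlgHom.comp_apply, comulHom_inclH, comulH_apply]
      have h1 : ∀ t : H ⊗[k] H, Algebra.TensorProduct.map (counitHom k H B) (AlgHom.id k _)
          (TensorProduct.map (inclH k H B).toLinearMap (inclH k H B).toLinearMap t) =
          1 ⊗ₜ inclH k H B (TensorProduct.lid k H ((counit (R := k)).rTensor H t)) := by
        intro t
        induction t using TensorProduct.induction_on with
        | zero => simp
        | add x y hx hy => simp only [map_add, TensorProduct.tmul_add, hx, hy]
        | tmul x y => simp [counitHom_inclH, TensorProduct.smul_tmul']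
      rw [h1]
      simp))
    (algHom_ext (fun b => by
      simp only [AlgHom.comp_apply, comulHom_incl, comulB, LinearMap.comp_apply]
      have h1 : ∀ t : B ⊗[k] B, Algebra.TensorProduct.map (AlgHom.id k _) (counitHom k H B)
          (comulAux k H B t) =
          incl k H B (TensorProduct.rid k B ((counit (R := k)).lTensor B t)) ⊗ₜ 1 := by
        intro t
        induction t using TensorProduct.induction_on with
        | zero => simp
        | add x y hx hy => simp only [map_add, TensorProduct.add_tmul, hx, hy]
        | tmul x y =>
          rw [comulAux_tmul, map_mul, map_counit_coactP']
          simp [TensorProduct.smul_tmul]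
      rw [h1]
      simp)
    (fun h => by
      simp only [AlgHom.comp_apply, comulHom_inclH, comulH_apply]
      have h1 : ∀ t : H ⊗[k] H, Algebra.TensorProduct.map (AlgHom.id k _) (counitHom k H B)
          (TensorProduct.map (inclH k H B).toLinearMap (inclH k H B).toLinearMap t) =
          inclH k H B (TensorProduct.rid k H ((counit (R := k)).lTensor H t)) ⊗ₜ 1 := by
        intro t
        induction t using TensorProduct.induction_on with
        | zero => simp
        | add x y hx hy => simp only [map_add, TensorProduct.add_tmul, hx, hy]
        | tmul x y => simp [counitHom_inclH, TensorProduct.smul_tmul]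
      rw [h1]
      simp))

variable {k H B}

theorem comul_incl (b : B) : comul (R := k) (incl k H B b) = comulB k H B b := comulHom_incl b

theorem comul_inclH (h : H) : comul (R := k) (inclH k H B h) = comulH k H B h := comulHom_inclH h

theorem counit_incl (b : B) : counit (R := k) (incl k H B b) = counit (R := k) b :=
  counitHom_incl b

theorem counit_inclH (h : H) : counit (R := k) (inclH k H B h) = counit (R := k) h :=
  counitHom_inclH h

open BraidedGroup (bantipode)

variable (k H B)

/-- The antipode `S (b ⊗ h) = j (S (b⁽¹⁾ h)) S̲ b⁽²⁾`. -/
noncomputable def antipodeLin : Biproduct k H B →ₗ[k] Biproduct k H B :=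
  LinearMap.mul' k _ ∘ₗ
    TensorProduct.map ((inclH k H B).toLinearMap ∘ₗ HopfAlgebra.antipode k)
      ((incl k H B).toLinearMap ∘ₗ bantipode (k := k) H) ∘ₗ
    crossComap k H B ∘ₗ (of k H B).symm.toLinearMap

variable {k H B}

theorem antipodeLin_of (b : B) (h : H) : antipodeLin k H B (of k H B (b ⊗ₜ h)) =
    LinearMap.mul' k _ (TensorProduct.map ((inclH k H B).toLinearMap ∘ₗ HopfAlgebra.antipode k ∘ₗ
      LinearMap.mulRight k h) ((incl k H B).toLinearMap ∘ₗ bantipode (k := k) H)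
        (coact (k := k) b)) := by
  simp only [antipodeLin, crossComap, LinearMap.comp_apply, LinearEquiv.coe_coe,
    LinearEquiv.symm_apply_apply, LinearMap.rTensor_tmul]
  induction coact (k := k) (H := H) b using TensorProduct.induction_on with
  | zero => simp
  | add x y hx hy => simp only [map_add, TensorProduct.add_tmul, hx, hy]
  | tmul x y => simp

theorem antipode_left_aux (b : B) (s : H ⊗[k] H) :
    LinearMap.mul' k _ ((antipodeLin k H B).rTensor _ (comulB k H B b *
      TensorProduct.map (inclH k H B).toLinearMap (inclH k H B).toLinearMap s)) =
    counit (R := k) b • inclH k H B (LinearMap.mul' k H ((HopfAlgebra.antipode k).rTensor H s)) := by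
  induction s using TensorProduct.induction_on with
  | zero => simp
  | add x y hx hy => simp only [map_add, mul_add, smul_add, hx, hy]
  | tmul h g =>
  let R : H ⊗[k] (B ⊗[k] B) →ₗ[k] Biproduct k H B :=
    LinearMap.mulRight k (inclH k H B g) ∘ₗ LinearMap.mul' k _ ∘ₗ TensorProduct.map
      ((inclH k H B).toLinearMap ∘ₗ HopfAlgebra.antipode k ∘ₗ LinearMap.mulRight k h)
      ((incl k H B).toLinearMap ∘ₗ LinearMap.mul' k B ∘ₗ (bantipode (k := k) H).rTensor B)
  have h1 : LinearMap.mul' k _ ((antipodeLin k H B).rTensor _ (comulB k H B b *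
      TensorProduct.map (inclH k H B).toLinearMap (inclH k H B).toLinearMap (h ⊗ₜ g))) =
      R (leftTensorCoact (coact (k := k)) (coact (k := k)) (comul (R := k) b)) := by
    rw [comulB, LinearMap.comp_apply]
    induction comul (R := k) b using TensorProduct.induction_on with
    | zero => simp
    | add x y hx hy => simp only [map_add, add_mul, hx, hy]
    | tmul b c =>
    simp only [comulAux_tmul, coactP_apply, leftTensorCoact, LinearMap.comp_apply,
      TensorProduct.map_tmul]
    induction coact (k := k) (H := H) c using TensorProduct.induction_on with
    | zero => simp
    | add x y hx hy => simp only [map_add, mul_add, add_mul, TensorProduct.tmul_add, hx, hy]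
    | tmul z w =>
    simp only [TensorProduct.map_tmul, AlgHom.toLinearMap_apply,
      Algebra.TensorProduct.tmul_mul_tmul, LinearMap.rTensor_tmul, one_mul, mul_assoc]
    rw [← map_mul (inclH k H B), ← of_tmul, antipodeLin_of]
    induction coact (k := k) (H := H) b using TensorProduct.induction_on with
    | zero => simp
    | add x y hx hy => simp only [map_add, TensorProduct.add_tmul, hx, hy]
    | tmul x y => simp [R, midTwist, mul_assoc]
  rw [h1, ← BraidedGroup.coact_comul]
  have h2 : ∀ t : H ⊗[k] B, R ((comul (R := k)).lTensor H t) = inclH k H B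
      (HopfAlgebra.antipode k (TensorProduct.rid k H ((counit (R := k)).lTensor H t) * h) * g) := by
    intro t
    induction t using TensorProduct.induction_on with
    | zero => simp
    | add x y hx hy => simp only [map_add, add_mul, hx, hy]
    | tmul x y =>
      simp [R, BraidedGroup.mul_bantipode_rTensor_comul]
  rw [h2, BraidedGroup.coact_counit]
  simp

theorem antipode_right_aux (c : B) (h : H) :
    LinearMap.mul' k _ ((antipodeLin k H B).lTensor _ (coactP k H B c * comulH k H B h)) =
    counit (R := k) h • incl k H B (bantipode (k := k) H c) := by
  let V : H ⊗[k] H → H ⊗[k] (H ⊗[k] B) →ₗ[k] Biproduct k H B := fun s =>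
    LinearMap.mul' k _ ∘ₗ TensorProduct.map
      ((inclH k H B).toLinearMap ∘ₗ LinearMap.mul' k H ∘ₗ (HopfAlgebra.antipode k).lTensor H ∘ₗ
        LinearMap.mulRight k s)
      ((incl k H B).toLinearMap ∘ₗ bantipode (k := k) H) ∘ₗ
      (TensorProduct.assoc k H H B).symm.toLinearMap
  have V0 : V 0 = 0 := by simp [V]
  have Va : ∀ s t, V (s + t) = V s + V t := by
    intro s t
    have e : LinearMap.mulRight k (s + t) = LinearMap.mulRight k s + LinearMap.mulRight k t := by
      ext; simp [mul_add]
    simp only [V, e, LinearMap.comp_add, LinearMap.add_comp, TensorProduct.map_add_left]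
  have h1 : ∀ s : H ⊗[k] H, LinearMap.mul' k _ ((antipodeLin k H B).lTensor _ (coactP k H B c *
      TensorProduct.map (inclH k H B).toLinearMap (inclH k H B).toLinearMap s)) =
      V s ((coact (k := k)).lTensor H (coact (k := k) c)) := by
    intro s
    induction s using TensorProduct.induction_on with
    | zero => simp [V0]
    | add x y hx hy => simp only [map_add, mul_add, Va, LinearMap.add_apply, hx, hy]
    | tmul h g =>
    rw [coactP_apply]
    induction coact (k := k) (H := H) c using TensorProduct.induction_on with
    | zero => simp
    | add x y hx hy => simp only [map_add, add_mul, hx, hy]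
    | tmul z w =>
    simp only [TensorProduct.map_tmul, AlgHom.toLinearMap_apply,
      Algebra.TensorProduct.tmul_mul_tmul, LinearMap.lTensor_tmul]
    rw [← of_tmul, antipodeLin_of]
    induction coact (k := k) (H := H) w using TensorProduct.induction_on with
    | zero => simp
    | add x y hx hy => simp only [map_add, TensorProduct.tmul_add, hx, hy]
    | tmul x y => simp [V, mul_assoc]
  rw [comulH_apply, h1, ← CrossedModule.coassoc_coact]
  have h2 : ∀ t : H ⊗[k] B, V (comul (R := k) h) (TensorProduct.assoc k H H B
      ((comul (R := k)).rTensor B t)) = counit (R := k) h • incl k H B (bantipode (k := k) H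
        (TensorProduct.lid k B ((counit (R := k)).rTensor B t))) := by
    intro t
    induction t using TensorProduct.induction_on with
    | zero => simp
    | add x y hx hy => simp only [map_add, smul_add, hx, hy]
    | tmul x y =>
      simp only [V, LinearMap.comp_apply, LinearEquiv.coe_coe, LinearMap.rTensor_tmul,
        LinearEquiv.symm_apply_apply, TensorProduct.map_tmul, LinearMap.mulRight_apply,
        ← Bialgebra.comul_mul, HopfAlgebra.mul_antipode_lTensor_comul_apply]
      simp [Algebra.algebraMap_eq_smul_one, smul_smul, mul_comm]
  rw [h2, CrossedModule.counit_coact]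

variable (k H B)

noncomputable instance instHopfAlgebra : HopfAlgebra k (Biproduct k H B) where
  antipode := antipodeLin k H B
  mul_antipode_rTensor_comul := by
    ext x
    induction x using induction_on with
    | hz => simp
    | ha x y hx hy => simp only [map_add, hx, hy]
    | ht b h =>
    rw [LinearMap.comp_apply, LinearMap.comp_apply, of_tmul, Bialgebra.comul_mul, comul_incl,
      comul_inclH, comulH_apply, antipode_left_aux]
    simp [counit_incl, counit_inclH, Algebra.smul_def]
  mul_antipode_lTensor_comul := by
    ext x
    induction x using induction_on with
    | hz => simp
    | ha x y hx hy => simp only [map_add, hx, hy]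
    | ht b h =>
    rw [LinearMap.comp_apply, LinearMap.comp_apply, of_tmul, Bialgebra.comul_mul, comul_incl,
      comul_inclH, comulB, LinearMap.comp_apply]
    have h1 : ∀ (b : B) (t : Biproduct k H B ⊗[k] Biproduct k H B),
        LinearMap.mul' k _ ((antipodeLin k H B).lTensor _ ((incl k H B b ⊗ₜ 1) * t)) =
          incl k H B b * LinearMap.mul' k _ ((antipodeLin k H B).lTensor _ t) := by
      intro b t
      induction t using TensorProduct.induction_on with
      | zero => simp
      | add x y hx hy => simp only [map_add, mul_add, hx, hy]
      | tmul x y => simp [mul_assoc]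
    have h2 : ∀ t : B ⊗[k] B, LinearMap.mul' k _ ((antipodeLin k H B).lTensor _
        (comulAux k H B t * comulH k H B h)) = counit (R := k) h • incl k H B
          (LinearMap.mul' k B ((bantipode (k := k) H).lTensor B t)) := by
      intro t
      induction t using TensorProduct.induction_on with
      | zero => simp
      | add x y hx hy => simp only [map_add, add_mul, smul_add, hx, hy]
      | tmul x y => rw [comulAux_tmul, mul_assoc, h1, antipode_right_aux]; simp
    rw [h2, BraidedGroup.mul_bantipode_lTensor_comul]
    simp [counit_incl, counit_inclH, Algebra.smul_def, mul_comm]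

/-- The projection `π (b ⊗ h) = ε(b) h` as a linear map. -/
noncomputable def projLin : Biproduct k H B →ₗ[k] H :=
  (TensorProduct.lid k H).toLinearMap ∘ₗ (counit (R := k) (A := B)).rTensor H ∘ₗ
    (of k H B).symm.toLinearMap

variable {k H B}

theorem projLin_of (b : B) (h : H) :
    projLin k H B (of k H B (b ⊗ₜ h)) = counit (R := k) b • h := by
  simp [projLin]

theorem projLin_mul (x y : Biproduct k H B) :
    projLin k H B (x * y) = projLin k H B x * projLin k H B y := by
  induction x using induction_on with
  | hz => simp
  | ha x y hx hy => simp only [map_add, add_mul, hx, hy]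
  | ht b h =>
  induction y using induction_on with
  | hz => simp
  | ha x y hx hy => simp only [map_add, mul_add, hx, hy]
  | ht c g =>
  have key : ∀ t : H ⊗[k] H, projLin k H B (of k H B ((b ⊗ₜ 1) *
      ((act (k := k) (H := H) (V := B)).toLinearMap.flip c).rTensor H t * (1 ⊗ₜ g))) =
      counit (R := k) b • counit (R := k) c • (TensorProduct.lid k H
        ((counit (R := k)).rTensor H t) * g) := by
    intro t
    induction t using TensorProduct.induction_on with
    | zero => simp
    | add x y hx hy => simp only [map_add, mul_add, add_mul, smul_add, hx, hy]
    | tmul x y =>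
      simp [projLin_of, BraidedGroup.counit_mul (k := k) (H := H), smul_smul,
        BraidedGroup.act_counit (k := k) (H := H), mul_comm, mul_assoc]
  rw [mul_def, mulMap_tmul, crossMap_tmul, key, projLin_of, projLin_of]
  simp [smul_smul, mul_comm]

variable (k H B)

/-- The projection `π (b ⊗ h) = ε(b) h` as an algebra map. -/
noncomputable def projHom : Biproduct k H B →ₐ[k] H :=
  AlgHom.ofLinearMap (projLin k H B) (by
    rw [one_def, projLin_of]; simp [BraidedGroup.counit_one (k := k) (H := H) (B := B)])
    projLin_mul

variable {k H B}

theorem projHom_incl (b : B) : projHom k H B (incl k H B b) = counit (R := k) b • 1 := by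
  rw [projHom, AlgHom.ofLinearMap_apply, incl_apply, projLin_of]

theorem projHom_inclH (h : H) : projHom k H B (inclH k H B h) = h := by
  rw [projHom, AlgHom.ofLinearMap_apply, inclH_apply, projLin_of]
  simp [BraidedGroup.counit_one (k := k) (H := H) (B := B)]

theorem map_proj_comulH (h : H) : Algebra.TensorProduct.map (projHom k H B) (projHom k H B)
    (comulH k H B h) = comul (R := k) h := by
  rw [comulH_apply]
  induction comul (R := k) h using TensorProduct.induction_on with
  | zero => simp
  | add x y hx hy => simp only [map_add, hx, hy]
  | tmul x y => simp [projHom_inclH]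

theorem map_proj_coactP (b : B) : Algebra.TensorProduct.map (projHom k H B) (projHom k H B)
    (coactP k H B b) = counit (R := k) b • 1 := by
  have e : ∀ t : H ⊗[k] B, Algebra.TensorProduct.map (projHom k H B) (projHom k H B)
      (TensorProduct.map (inclH k H B).toLinearMap (incl k H B).toLinearMap t) =
      (TensorProduct.rid k H ((counit (R := k) (A := B)).lTensor H t)) ⊗ₜ 1 := by
    intro t
    induction t using TensorProduct.induction_on with
    | zero => simp
    | add x y hx hy => simp only [map_add, TensorProduct.add_tmul, hx, hy]
    | tmul x y => simp [projHom_inclH, projHom_incl, TensorProduct.smul_tmul]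
  rw [coactP_apply, e, BraidedGroup.coact_counit, TensorProduct.smul_tmul,
    TensorProduct.tmul_smul, Algebra.TensorProduct.one_def]

theorem map_proj_comulB (b : B) : Algebra.TensorProduct.map (projHom k H B) (projHom k H B)
    (comulB k H B b) = counit (R := k) b • 1 := by
  have e : ∀ t : B ⊗[k] B, Algebra.TensorProduct.map (projHom k H B) (projHom k H B)
      (comulAux k H B t) =
      (counit (R := k) (TensorProduct.lid k B ((counit (R := k)).rTensor B t))) • 1 := by
    intro t
    induction t using TensorProduct.induction_on with
    | zero => simp
    | add x y hx hy => simp only [map_add, add_smul, hx, hy]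
    | tmul x y =>
      rw [comulAux_tmul, map_mul, map_proj_coactP]
      simp [projHom_incl, smul_smul, Algebra.TensorProduct.one_def, TensorProduct.smul_tmul',
        mul_comm]
  rw [comulB, LinearMap.comp_apply, e]
  simp

variable (k H B)

/-- The Hopf algebra projection `π (b ⊗ h) = ε(b) h`. -/
noncomputable def proj : Biproduct k H B →ₐc[k] H :=
  BialgHom.ofAlgHom (projHom k H B)
    (algHom_ext (fun b => by simp [projHom_incl, counit_incl])
      (fun h => by simp [projHom_inclH, counit_inclH]))
    (algHom_ext (fun b => by
        simp only [AlgHom.comp_apply, Bialgebra.comulAlgHom_apply, comul_incl, map_proj_comulB,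
          projHom_incl, map_smul, map_one])
      (fun h => by
        simp only [AlgHom.comp_apply, Bialgebra.comulAlgHom_apply, comul_inclH, map_proj_comulH,
          projHom_inclH]))

variable {k H B}

theorem proj_of (b : B) (h : H) : proj k H B (of k H B (b ⊗ₜ h)) = counit (R := k) b • h :=
  projLin_of b h

end

end Biproduct

/-! ### The universal differential calculus -/

/-- The universal 1-forms `Ω¹A = ker (A ⊗ A → A)`. -/
noncomputable def univForms (k A : Type*) [Field k] [Ring A] [Algebra k A] :
    Submodule k (A ⊗[k] A) := LinearMap.ker (LinearMap.mul' k A)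

namespace univForms

section

variable (k A : Type*) [Field k] [Ring A] [Algebra k A]

/-- The universal differential `d u = 1 ⊗ u - u ⊗ 1`. -/
noncomputable def d : A →ₗ[k] univForms k A :=
  (TensorProduct.mk k A A 1 - (TensorProduct.mk k A A).flip 1).codRestrict _ (fun u => by
    simp [univForms])

/-- The left multiplication `u ⊗ η ↦ u η` of forms, where `u (x ⊗ y) = u x ⊗ y`. -/
noncomputable def lmul : A ⊗[k] univForms k A →ₗ[k] univForms k A :=
  ((LinearMap.mul' k A).rTensor A ∘ₗ (TensorProduct.assoc k A A A).symm.toLinearMap ∘ₗ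
    (univForms k A).subtype.lTensor A).codRestrict _ (fun t => by
      have key : ∀ s : A ⊗[k] (A ⊗[k] A), LinearMap.mul' k A ((LinearMap.mul' k A).rTensor A
          ((TensorProduct.assoc k A A A).symm s)) =
          LinearMap.mul' k A ((LinearMap.mul' k A).lTensor A s) := fun s => by
        induction s using TensorProduct.induction_on with
        | zero => simp
        | add x y hx hy => simp only [map_add, hx, hy]
        | tmul x y =>
          induction y using TensorProduct.induction_on with
          | zero => simp
          | add x y hx hy => simp only [TensorProduct.tmul_add, map_add, hx, hy]
          | tmul y z => simp [mul_assoc]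
      change LinearMap.mul' k A ((LinearMap.mul' k A).rTensor A
          ((TensorProduct.assoc k A A A).symm ((univForms k A).subtype.lTensor A t))) = 0
      rw [key, ← LinearMap.lTensor_comp_apply]
      have : LinearMap.mul' k A ∘ₗ (univForms k A).subtype = 0 :=
        LinearMap.ext fun x => x.2
      rw [this]
      simp)

/-- The right multiplication `η ⊗ v ↦ η v` of forms, where `(x ⊗ y) v = x ⊗ y v`. -/
noncomputable def rmul : univForms k A ⊗[k] A →ₗ[k] univForms k A :=
  ((LinearMap.mul' k A).lTensor A ∘ₗ (TensorProduct.assoc k A A A).toLinearMap ∘ₗ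
    (univForms k A).subtype.rTensor A).codRestrict _ (fun t => by
      have key : ∀ s : (A ⊗[k] A) ⊗[k] A, LinearMap.mul' k A ((LinearMap.mul' k A).lTensor A
          (TensorProduct.assoc k A A A s)) =
          LinearMap.mul' k A ((LinearMap.mul' k A).rTensor A s) := fun s => by
        induction s using TensorProduct.induction_on with
        | zero => simp
        | add x y hx hy => simp only [map_add, hx, hy]
        | tmul x y =>
          induction x using TensorProduct.induction_on with
          | zero => simp
          | add x y hx hy => simp only [TensorProduct.add_tmul, map_add, hx, hy]
          | tmul y z => simp [mul_assoc]
      change LinearMap.mul' k A ((LinearMap.mul' k A).lTensor A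
          (TensorProduct.assoc k A A A ((univForms k A).subtype.rTensor A t))) = 0
      rw [key, ← LinearMap.rTensor_comp_apply]
      have : LinearMap.mul' k A ∘ₗ (univForms k A).subtype = 0 :=
        LinearMap.ext fun x => x.2
      rw [this]
      simp)

/-- `u ⊗ v ↦ u d v`. -/
noncomputable def mulD : A ⊗[k] A →ₗ[k] univForms k A := lmul k A ∘ₗ (d k A).lTensor A

variable {k A}

/-- The map `Ω¹A → Ω¹A'` induced by an algebra map. -/
noncomputable def map {A' : Type*} [Ring A'] [Algebra k A'] (f : A →ₐ[k] A') :
    univForms k A →ₗ[k] univForms k A' :=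
  (TensorProduct.map f.toLinearMap f.toLinearMap).restrict (fun t ht => by
    have key : ∀ s : A ⊗[k] A, LinearMap.mul' k A'
        (TensorProduct.map f.toLinearMap f.toLinearMap s) = f (LinearMap.mul' k A s) := fun s => by
      induction s using TensorProduct.induction_on with
      | zero => simp
      | add x y hx hy => simp only [map_add, hx, hy]
      | tmul x y => simp
    change LinearMap.mul' k A' _ = 0
    rw [key, show LinearMap.mul' k A t = 0 from ht, map_zero])

end

end univForms

/-! ### Augmentation ideals and adjoint coactions -/

/-- The kernel of the counit. -/
noncomputable def augKer (k A : Type*) [Field k] [Ring A] [Algebra k A] [Coalgebra k A] :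
    Submodule k A := LinearMap.ker (counit (R := k) (A := A))

/-- The projection `π_ε h = h - ε(h) 1` onto the kernel of the counit. -/
noncomputable def augProj (k A : Type*) [Field k] [Ring A] [Bialgebra k A] :
    A →ₗ[k] augKer k A :=
  (LinearMap.id - (LinearMap.toSpanSingleton k A 1) ∘ₗ counit (R := k)).codRestrict _ (fun h => by
    change counit (R := k) _ = 0
    simp)

section Adjoint

variable (k A : Type*) [Field k] [Ring A] [HopfAlgebra k A]

/-- The left adjoint coaction `h ↦ h₁ S h₃ ⊗ h₂`. -/
noncomputable def adL : A →ₗ[k] A ⊗[k] A :=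
  (LinearMap.mul' k A ∘ₗ (HopfAlgebra.antipode k).lTensor A).rTensor A ∘ₗ
    (TensorProduct.assoc k A A A).symm.toLinearMap ∘ₗ
    (tflip k A A ∘ₗ comul (R := k)).lTensor A ∘ₗ comul (R := k)

/-- The right adjoint coaction `h ↦ h₂ ⊗ (S h₁) h₃`. -/
noncomputable def adR : A →ₗ[k] A ⊗[k] A :=
  (LinearMap.mul' k A ∘ₗ (HopfAlgebra.antipode k).rTensor A).lTensor A ∘ₗ
    (TensorProduct.assoc k A A A).toLinearMap ∘ₗ
    (tflip k A A ∘ₗ comul (R := k)).rTensor A ∘ₗ comul (R := k)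

end Adjoint

/-! ### Connections on quantum principal bundles with the universal calculus -/

section Bundle

variable {k P H : Type*} [Field k] [Ring P] [Algebra k P] [Ring H] [HopfAlgebra k H]

/-- The base `M = {u ∈ P | Δ_R u = u ⊗ 1}` of a bundle with right coaction `δ = Δ_R`. -/
noncomputable def base (δ : P →ₐ[k] P ⊗[k] H) : Subalgebra k P :=
  AlgHom.equalizer δ Algebra.TensorProduct.includeLeft

/-- The map `χ (u ⊗ v) = u Δ_R v`. -/
noncomputable def canMap (δ : P →ₐ[k] P ⊗[k] H) : P ⊗[k] P →ₗ[k] P ⊗[k] H :=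
  (LinearMap.mul' k P).rTensor H ∘ₗ (TensorProduct.assoc k P P H).symm.toLinearMap ∘ₗ
    δ.toLinearMap.lTensor P

/-- The tensor product coaction of `H` on `P ⊗ P`. -/
noncomputable def rightTensorCoact (δ : P →ₐ[k] P ⊗[k] H) :
    P ⊗[k] P →ₗ[k] (P ⊗[k] P) ⊗[k] H :=
  (LinearMap.mul' k H).lTensor (P ⊗[k] P) ∘ₗ midTwist (tflip k H P) ∘ₗ
    TensorProduct.map δ.toLinearMap δ.toLinearMap

/-- A connection `ω : ker ε → Ω¹P`: `χ ∘ ω = 1 ⊗ id` and `Δ_R ∘ ω = (ω ⊗ id) ∘ Ad`. (As `Ad`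
preserves `ker ε`, the extension `ω ∘ π_ε` of `ω` to `H` may be used on the right-hand side.) -/
structure IsConnection (δ : P →ₐ[k] P ⊗[k] H) (ω : augKer k H →ₗ[k] univForms k P) : Prop where
  canMap_eq : ∀ h : augKer k H, canMap δ (ω h : P ⊗[k] P) = 1 ⊗ₜ[k] (h : H)
  equivariant : ∀ h : augKer k H, rightTensorCoact δ (ω h : P ⊗[k] P) =
    ((univForms k P).subtype ∘ₗ ω ∘ₗ augProj k H).rTensor H (adR k H h)

/-- The projection `Π : Ω¹P → Ω¹P` of a connection, `Π = · ∘ (id ⊗ ω) ∘ χ`. -/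
noncomputable def connProj (δ : P →ₐ[k] P ⊗[k] H) (ω : augKer k H →ₗ[k] univForms k P) :
    univForms k P →ₗ[k] univForms k P :=
  univForms.lmul k P ∘ₗ (ω ∘ₗ augProj k H).lTensor P ∘ₗ canMap δ ∘ₗ (univForms k P).subtype

/-- The subspace `(Ω¹M) P` of `Ω¹P`. -/
noncomputable def strongHor (δ : P →ₐ[k] P ⊗[k] H) : Submodule k (univForms k P) :=
  LinearMap.range (univForms.rmul k P ∘ₗ (univForms.map (base δ).val).rTensor P)

/-- A connection is strong if `(id - Π)(d P) ⊆ (Ω¹M) P`. -/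
def IsStrong (δ : P →ₐ[k] P ⊗[k] H) (ω : augKer k H →ₗ[k] univForms k P) : Prop :=
  ∀ u : P, univForms.d k P u - connProj δ ω (univForms.d k P u) ∈ strongHor δ

/-- The connection
`ω (h) = Φ⁻¹(h₁) β(π_ε h₂) Φ(h₃) + Φ⁻¹(h₁) d Φ(h₂)` on a trivial bundle with trivialisation `Φ` and
convolution inverse `Φ' = Φ⁻¹`, defined by `β : ker ε → Ω¹M`. Here `f : M → P` is the inclusion. -/
noncomputable def connOfForm {M : Type*} [Ring M] [Algebra k M] (f : M →ₐ[k] P)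
    (Φ Φ' : H →ₗ[k] P) (β : augKer k H →ₗ[k] univForms k M) :
    augKer k H →ₗ[k] univForms k P :=
  (univForms.lmul k P ∘ₗ
      TensorProduct.map Φ' (univForms.rmul k P ∘ₗ
        TensorProduct.map (univForms.map f ∘ₗ β ∘ₗ augProj k H) Φ ∘ₗ comul (R := k)) ∘ₗ
      comul (R := k) +
    univForms.mulD k P ∘ₗ TensorProduct.map Φ' Φ ∘ₗ comul (R := k)) ∘ₗ (augKer k H).subtype

end Bundle

/-! ### Homogeneous bundles: the total space is a Hopf algebra -/

section Homogeneous

variable {k P H : Type*} [Field k] [Ring P] [HopfAlgebra k P] [Ring H] [HopfAlgebra k H]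

/-- The right coaction `Δ_R = (id ⊗ π) Δ` defined by a Hopf algebra map `π : P → H`. -/
noncomputable def homogCoact (π : P →ₐc[k] H) : P →ₐ[k] P ⊗[k] H :=
  (Algebra.TensorProduct.map (AlgHom.id k P) (π : P →ₐ[k] H)).comp (Bialgebra.comulAlgHom k P)

/-- The left regular coaction `Δ_L (u ⊗ v) = u₁ v₁ ⊗ (u₂ ⊗ v₂)` of `P` on `P ⊗ P`. -/
noncomputable def leftRegCoact (k P : Type*) [Field k] [Ring P] [HopfAlgebra k P] :
    P ⊗[k] P →ₗ[k] P ⊗[k] (P ⊗[k] P) :=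
  leftTensorCoact (comul (R := k)) (comul (R := k))

/-- Left-invariance `Δ_L (ω h) = 1 ⊗ ω h`. -/
def IsLeftInvariant (ω : augKer k H →ₗ[k] univForms k P) : Prop :=
  ∀ h : augKer k H, leftRegCoact k P (ω h : P ⊗[k] P) = 1 ⊗ₜ[k] (ω h : P ⊗[k] P)

/-- An `Ad`-covariant splitting `i : ker ε_H → ker ε_P` of `π`: `π ∘ i = id` and
`(id ⊗ π) ∘ Ad ∘ i = (i ⊗ id) ∘ Ad`. -/
structure IsSplitting (π : P →ₐc[k] H) (i : augKer k H →ₗ[k] augKer k P) : Prop where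
  proj_eq : ∀ h : augKer k H, π (i h : P) = h
  covariant : ∀ h : augKer k H,
    (π : P →ₐ[k] H).toLinearMap.lTensor P (adR k P (i h : P)) =
      ((augKer k P).subtype ∘ₗ i ∘ₗ augProj k H).rTensor H (adR k H h)

/-- The canonical connection `ω (h) = S i(h)₁ d i(h)₂` associated to `i`. -/
noncomputable def canonicalConn (i : augKer k H →ₗ[k] augKer k P) :
    augKer k H →ₗ[k] univForms k P :=
  univForms.mulD k P ∘ₗ (HopfAlgebra.antipode k).rTensor P ∘ₗ comul (R := k) ∘ₗ
    (augKer k P).subtype ∘ₗ i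

end Homogeneous

/-! ### The biproduct as a trivial bundle over `B` -/

namespace Biproduct

section

variable {k H B : Type*} [Field k] [Ring H] [HopfAlgebra k H] [Ring B] [Algebra k B]
  [Coalgebra k B] [CrossedModule k H B] [BraidedGroup k H B]

theorem homogCoact_apply (x : Biproduct k H B) : homogCoact (proj k H B) x =
    Algebra.TensorProduct.map (AlgHom.id k _) (projHom k H B) (comul (R := k) x) := rfl

theorem homogCoact_incl (b : B) :
    homogCoact (proj k H B) (incl k H B b) = incl k H B b ⊗ₜ 1 := by
  have e : ∀ b : B, Algebra.TensorProduct.map (AlgHom.id k _) (projHom k H B) (coactP k H B b) =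
      counit (R := k) b • 1 := by
    intro b
    have e : ∀ t : H ⊗[k] B, Algebra.TensorProduct.map (AlgHom.id k _) (projHom k H B)
        (TensorProduct.map (inclH k H B).toLinearMap (incl k H B).toLinearMap t) =
        inclH k H B (TensorProduct.rid k H ((counit (R := k) (A := B)).lTensor H t)) ⊗ₜ 1 := by
      intro t
      induction t using TensorProduct.induction_on with
      | zero => simp
      | add x y hx hy => simp only [map_add, TensorProduct.add_tmul, hx, hy]
      | tmul x y => simp [projHom_incl, TensorProduct.smul_tmul]
    rw [coactP_apply, e, BraidedGroup.coact_counit, map_smul, map_one, TensorProduct.smul_tmul,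
      TensorProduct.tmul_smul, Algebra.TensorProduct.one_def]
  have e' : ∀ t : B ⊗[k] B, Algebra.TensorProduct.map (AlgHom.id k _) (projHom k H B)
      (comulAux k H B t) =
      incl k H B (TensorProduct.rid k B ((counit (R := k)).lTensor B t)) ⊗ₜ 1 := by
    intro t
    induction t using TensorProduct.induction_on with
    | zero => simp
    | add x y hx hy => simp only [map_add, TensorProduct.add_tmul, hx, hy]
    | tmul x y => rw [comulAux_tmul, map_mul, e]; simp [TensorProduct.smul_tmul']
  rw [homogCoact_apply, comul_incl, comulB, LinearMap.comp_apply, e']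
  simp

theorem homogCoact_inclH (h : H) : homogCoact (proj k H B) (inclH k H B h) =
    (inclH k H B).toLinearMap.rTensor H (comul (R := k) h) := by
  rw [homogCoact_apply, comul_inclH, comulH_apply]
  induction comul (R := k) h using TensorProduct.induction_on with
  | zero => simp
  | add x y hx hy => simp only [map_add, hx, hy]
  | tmul x y => simp [projHom_inclH]

/-- The base of the bundle is `B`. -/
theorem base_eq : base (homogCoact (proj k H B)) = (incl k H B).range := by
  let f : Biproduct k H B →ₗ[k] B :=
    (TensorProduct.rid k B).toLinearMap ∘ₗ (counit (R := k) (A := H)).lTensor B ∘ₗ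
      (of k H B).symm.toLinearMap
  let F : Biproduct k H B ⊗[k] H →ₗ[k] Biproduct k H B :=
    LinearMap.mul' k _ ∘ₗ TensorProduct.map ((incl k H B).toLinearMap ∘ₗ f)
      (inclH k H B).toLinearMap
  have hF : ∀ x, F (homogCoact (proj k H B) x) = x := by
    intro x
    induction x using induction_on with
    | hz => simp
    | ha x y hx hy => simp only [map_add, hx, hy]
    | ht b h =>
      have : ∀ t : H ⊗[k] H, F ((incl k H B b ⊗ₜ 1) * (inclH k H B).toLinearMap.rTensor H t) =
          incl k H B b * inclH k H B (TensorProduct.lid k H ((counit (R := k)).rTensor H t)) := by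
        intro t
        induction t using TensorProduct.induction_on with
        | zero => simp
        | add x y hx hy => simp only [map_add, mul_add, hx, hy]
        | tmul x y => simp [F, f, ← of_tmul]
      rw [of_tmul, map_mul, homogCoact_incl, homogCoact_inclH, this]
      simp
  ext x
  constructor
  · intro hx
    have hx' : homogCoact (proj k H B) x = x ⊗ₜ 1 := hx
    refine ⟨f x, ?_⟩
    have := hF x
    rw [hx'] at this
    simpa [F] using this
  · rintro ⟨b, rfl⟩
    exact homogCoact_incl b

open WithConv in
/-- `j` is a trivialisation of the bundle: it is unital, equivariant, and
convolution-invertible with inverse `j ∘ S`. -/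
theorem inclH_trivialisation :
    inclH k H B 1 = 1 ∧
    (∀ h : H, homogCoact (proj k H B) (inclH k H B h) =
      (inclH k H B).toLinearMap.rTensor H (comul (R := k) h)) ∧
    toConv (inclH k H B).toLinearMap *
      toConv ((inclH k H B).toLinearMap ∘ₗ HopfAlgebra.antipode k) = 1 ∧
    toConv ((inclH k H B).toLinearMap ∘ₗ HopfAlgebra.antipode k) *
      toConv (inclH k H B).toLinearMap = 1 := by
  refine ⟨map_one _, homogCoact_inclH, ?_, ?_⟩
  · ext h
    have : ∀ t : H ⊗[k] H, LinearMap.mul' k _ (TensorProduct.map (inclH k H B).toLinearMap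
        ((inclH k H B).toLinearMap ∘ₗ HopfAlgebra.antipode k) t) =
        inclH k H B (LinearMap.mul' k H ((HopfAlgebra.antipode k).lTensor H t)) := by
      intro t
      induction t using TensorProduct.induction_on with
      | zero => simp
      | add x y hx hy => simp only [map_add, hx, hy]
      | tmul x y => simp
    simp [this]
  · ext h
    have : ∀ t : H ⊗[k] H, LinearMap.mul' k _ (TensorProduct.map
        ((inclH k H B).toLinearMap ∘ₗ HopfAlgebra.antipode k) (inclH k H B).toLinearMap t) =
        inclH k H B (LinearMap.mul' k H ((HopfAlgebra.antipode k).rTensor H t)) := by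
      intro t
      induction t using TensorProduct.induction_on with
      | zero => simp
      | add x y hx hy => simp only [map_add, hx, hy]
      | tmul x y => simp
    simp [this]

end

end Biproduct

/-! ### Data on the braided group -/

section Braided

variable {k H B : Type*} [Field k] [Ring H] [HopfAlgebra k H] [Ring B] [Algebra k B]
  [Coalgebra k B] [CrossedModule k H B]

variable (k H B) in
/-- The braided left coaction
`b ⊗ c ↦ b₁ Ψ(b₂ ⊗ c₁) ⊗ c₂ = b₁ (b₂⁽¹⁾ ▷ c₁) ⊗ (b₂⁽²⁾ ⊗ c₂)` of `B` on `B ⊗ B`. -/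
noncomputable def braidedLeftCoact : B ⊗[k] B →ₗ[k] B ⊗[k] (B ⊗[k] B) :=
  (LinearMap.mul' k B).rTensor (B ⊗[k] B) ∘ₗ midTwist (braiding k H B B) ∘ₗ
    TensorProduct.map (comul (R := k)) (comul (R := k))

/-- `β` takes values in the forms that are invariant under the braided coaction of `B`. -/
def IsBraidedInvariant (β : augKer k H →ₗ[k] univForms k B) : Prop :=
  ∀ h : augKer k H, braidedLeftCoact k H B (β h : B ⊗[k] B) = 1 ⊗ₜ[k] (β h : B ⊗[k] B)

/-- A map `f` from `ker ε` to a space `V` with left coaction `ρ` of `H` intertwines it with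
the left adjoint coaction: `ρ (f h) = h₁ S h₃ ⊗ f(h₂)`. (As the left adjoint coaction
preserves `ker ε`, the extension `f ∘ π_ε` of `f` to `H` may be used on the right-hand side.) -/
def IntertwinesAd {V : Type*} [AddCommGroup V] [Module k V] (ρ : V →ₗ[k] H ⊗[k] V)
    (f : augKer k H →ₗ[k] V) : Prop :=
  ∀ h : augKer k H, ρ (f h) = (f ∘ₗ augProj k H).lTensor H (adL k H h)

variable (k H B) in
/-- The left coaction `b ⊗ c ↦ b⁽¹⁾ c⁽¹⁾ ⊗ (b⁽²⁾ ⊗ c⁽²⁾)` of `H` on `B ⊗ B`. -/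
noncomputable def coactTensor : B ⊗[k] B →ₗ[k] H ⊗[k] (B ⊗[k] B) :=
  leftTensorCoact (coact (k := k) (H := H) (V := B)) (coact (k := k) (H := H) (V := B))

variable (k H B) in
/-- The maps `β : ker ε_H → Ω¹B` that are left `B`-invariant under the braided coproduct and
intertwine the left `H`-coaction on `Ω¹B` with the left adjoint coaction. -/
def invariantForms : Set (augKer k H →ₗ[k] univForms k B) :=
  {β | IsBraidedInvariant β ∧ IntertwinesAd (coactTensor k H B) ((univForms k B).subtype ∘ₗ β)}

variable (k H B) in
/-- The maps `γ : ker ε_H → ker ε_B` that intertwine the left `H`-coaction with the left adjoint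
coaction. -/
def adIntertwiners : Set (augKer k H →ₗ[k] augKer k B) :=
  {γ | IntertwinesAd (coact (k := k) (H := H) (V := B)) ((augKer k B).subtype ∘ₗ γ)}

variable [BraidedGroup k H B]

variable (k H B) in
/-- The strong left-invariant connections on the biproduct, as a homogeneous bundle by `π`. -/
def strongLeftInvariantConnections : Set (augKer k H →ₗ[k] univForms k (Biproduct k H B)) :=
  {ω | IsConnection (homogCoact (Biproduct.proj k H B)) ω ∧
    IsStrong (homogCoact (Biproduct.proj k H B)) ω ∧ IsLeftInvariant ω}

/-- The connection `ω (h) = j(S h₁) β(π_ε h₂) j(h₃) + j(S h₁) d j(h₂)` on the biproduct as a trivial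
bundle, with trivialisation `j (h) = 1 ⊗ h` and its convolution inverse `j ∘ S`. -/
noncomputable def biproductConn (β : augKer k H →ₗ[k] univForms k B) :
    augKer k H →ₗ[k] univForms k (Biproduct k H B) :=
  connOfForm (Biproduct.incl k H B) (Biproduct.inclH k H B).toLinearMap
    ((Biproduct.inclH k H B).toLinearMap ∘ₗ HopfAlgebra.antipode k) β

/-- `β (h) = S̲ γ(h)₁ d γ(h)₂`. -/
noncomputable def formOfMap (γ : augKer k H →ₗ[k] augKer k B) :
    augKer k H →ₗ[k] univForms k B :=
  univForms.mulD k B ∘ₗ (BraidedGroup.bantipode (k := k) H).rTensor B ∘ₗ comul (R := k) ∘ₗ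
    (augKer k B).subtype ∘ₗ γ

/-- `i (h) = γ(π_ε h₁) ⊗ h₂ + 1 ⊗ h`. -/
noncomputable def splittingOfMap (γ : augKer k H →ₗ[k] augKer k B) :
    augKer k H →ₗ[k] augKer k (Biproduct k H B) :=
  ((Biproduct.of k H B).toLinearMap ∘ₗ
    (((augKer k B).subtype ∘ₗ γ ∘ₗ augProj k H).rTensor H ∘ₗ comul (R := k) +
      TensorProduct.mk k B H 1) ∘ₗ (augKer k H).subtype).codRestrict _ (fun h => by
    have e : ∀ x : B ⊗[k] H, counit (R := k) (Biproduct.of k H B x) =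
        LinearMap.mul' k k (TensorProduct.map (counit (R := k)) (counit (R := k)) x) :=
      fun x => rfl
    have e0 : counit (R := k) ∘ₗ (augKer k B).subtype ∘ₗ γ ∘ₗ augProj k H = 0 :=
      LinearMap.ext fun x => (γ (augProj k H x)).2
    rw [augKer, LinearMap.mem_ker, LinearMap.comp_apply, LinearEquiv.coe_coe, e,
      LinearMap.comp_apply, LinearMap.add_apply, map_add, map_add, LinearMap.comp_apply,
      LinearMap.rTensor, ← LinearMap.comp_apply (TensorProduct.map _ _) (TensorProduct.map _ _),
      ← TensorProduct.map_comp, e0]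
    have : counit (R := k) (h : H) = 0 := h.2
    simp [this])

end Braided

/-! ### Convolution -/

section Convolution

open WithConv LinearMap

variable {k C A A' : Type*} [Field k] [AddCommGroup C] [Module k C] [Coalgebra k C]
  [Ring A] [Algebra k A] [Ring A'] [Algebra k A']

/-! Put κ(c) = S c₁ ⊗ c₂. The canonical map u ⊗ v ↦ u v₁ ⊗ v₂ of a Hopf algebra turns the left
coaction on the tensor square into the coproduct of the left factor, and κ(c) into 1 ⊗ c. The
left-invariant tensors are therefore exactly the κ(c), and c is recovered by ε ⊗ id. The argument
needs only that the coproduct is multiplicative for a product on C ⊗ C built from some exchange map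
τ. So `galois_coact` serves both P (τ the flip) and the braided group B (τ the braiding). On B it
gives the bijection between γ and β at once, because counit, coproduct and braided antipode are all
H-colinear (`formOfMap_bijOn`).

On P, a left-invariant ω is κ ∘ i for a unique i : ker ε_H → ker ε_P. Under κ the tensor product
coaction becomes (id ⊗ π) Ad (`rightTensorCoact_leftInvariant`), so the equivariance of ω becomes
the Ad-covariance of i, and χ ∘ ω becomes 1 ⊗ π ∘ i. Extend i to p : H → P by p(1) = 1. Strongness
makes p colinear for the left coaction (π ⊗ id) Δ (`leftColinear_of_isStrong`). For a left colinear
p, Ad-covariance is the same as right colinearity (`adR_covariant_iff_rightColinear`). Right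
colinear maps are exactly the maps γ(h₁) ⊗ h₂ (`crossLift_rightColinear`, `eq_crossLift`), and such
a map is left colinear exactly when γ intertwines with the left adjoint coaction
(`intertwiner_iff_leftColinear`). Hence the i of a strong left-invariant connection is the splitting
of some γ. Finally `leftInvariant_crossLift` identifies κ(γ(h₁) ⊗ h₂) with j(S h₁) κ_B(γ(h₂)) j(h₃),
where κ_B is the analogue of κ for the braided antipode. This is the given formula for the
connection of β = κ_B ∘ γ, so the bijection between β and ω follows by passing through γ.

All this is computed in convolution algebras of maps on H, after extending β, γ, ω and i to H by 1 ↦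
1. The inhomogeneous terms in the formulas for ω and i are then absorbed, adjoint coactions become
conjugation by an algebra map and its convolution inverse, and Sweedler calculations become
cancellations in an associative algebra. The lemma below is the device: a linear map compatible with
products of values is compatible with convolution products. -/

theorem toConv_comp_convMul {T : A →ₗ[k] A'} {f g : WithConv (C →ₗ[k] A)}
    {f' g' : WithConv (C →ₗ[k] A')} (h : ∀ x y, T (f x * g y) = f' x * g' y) :
    toConv (T ∘ₗ (f * g).ofConv) = f' * g' := by
  ext c
  change T (mul' k A (TensorProduct.map f.ofConv g.ofConv (comul c))) =
    mul' k A' (TensorProduct.map f'.ofConv g'.ofConv (comul c))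
  induction comul (R := k) c using TensorProduct.induction_on with
  | zero => simp
  | add x y hx hy => simp only [map_add, hx, hy]
  | tmul x y => exact h x y

theorem toConv_algHom_comp_convMul (φ : A →ₐ[k] A') (f g : WithConv (C →ₗ[k] A)) :
    toConv (φ.toLinearMap ∘ₗ (f * g).ofConv) =
      toConv (φ.toLinearMap ∘ₗ f.ofConv) * toConv (φ.toLinearMap ∘ₗ g.ofConv) :=
  toConv_comp_convMul fun _ _ => map_mul φ _ _

theorem toConv_algHom_comp_one (φ : A →ₐ[k] A') :
    toConv (φ.toLinearMap ∘ₗ (1 : WithConv (C →ₗ[k] A)).ofConv) = 1 := by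
  ext c
  exact φ.commutes _

end Convolution

/-! ### Convolution inverses of algebra maps on a Hopf algebra -/

section ConvolutionInverse

open WithConv LinearMap

variable {k H A : Type*} [Field k] [Ring H] [HopfAlgebra k H] [Ring A] [Algebra k A]

/-- Composition with an algebra map preserves convolution products and the unit, so it carries the
inverse pair S, id to an inverse pair. -/
theorem conv_antipode_mul (φ : H →ₐ[k] A) :
    toConv (φ.toLinearMap ∘ₗ HopfAlgebra.antipode k) * toConv φ.toLinearMap = 1 := by
  have := toConv_algHom_comp_convMul φ (toConv (HopfAlgebra.antipode k (A := H)))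
    (toConv LinearMap.id)
  rw [antipode_mul_id, toConv_algHom_comp_one] at this
  exact this.symm

theorem conv_mul_antipode (φ : H →ₐ[k] A) :
    toConv φ.toLinearMap * toConv (φ.toLinearMap ∘ₗ HopfAlgebra.antipode k) = 1 := by
  have := toConv_algHom_comp_convMul φ (toConv LinearMap.id)
    (toConv (HopfAlgebra.antipode k (A := H)))
  rw [id_mul_antipode, toConv_algHom_comp_one] at this
  exact this.symm

/-- Bialgebra maps commute with the antipodes. -/
theorem bialgHom_comp_antipode {P : Type*} [Ring P] [HopfAlgebra k P] (π : P →ₐc[k] H) (p : P) :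
    π (HopfAlgebra.antipode k p) = HopfAlgebra.antipode k (π p) := by
  -- π ∘ S and S ∘ π are a left and a right convolution inverse of π, hence equal.
  have h₁ := conv_antipode_mul (π : P →ₐ[k] H)
  have h₂ : toConv (π : P →ₐ[k] H).toLinearMap *
      toConv (HopfAlgebra.antipode k ∘ₗ (π : P →ₐ[k] H).toLinearMap) = 1 := by
    have := convMul_comp_coalgHom_distrib (toConv LinearMap.id)
      (toConv (HopfAlgebra.antipode k (A := H))) (π : P →ₗc[k] H)
    rw [id_mul_antipode] at this
    have := congrArg toConv this.symm
    refine Eq.trans this ?_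
    ext p
    change algebraMap k H (counit (R := k) (π p)) = algebraMap k H (counit (R := k) p)
    simp
  have := congrArg (fun f => f p) (left_inv_eq_right_inv h₁ h₂)
  exact this

end ConvolutionInverse

/-! ### The canonical map of a coalgebra with product -/

section Canonical

open WithConv LinearMap Algebra.TensorProduct

variable (k C : Type*) [Field k] [Ring C] [Algebra k C] [Coalgebra k C]

/-- The inclusion `x ↦ x ⊗ 1` as a linear map. -/
noncomputable abbrev tinl (k A B : Type*) [Field k] [Ring A] [Algebra k A] [Ring B] [Algebra k B] :
    A →ₗ[k] A ⊗[k] B :=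
  (includeLeft : A →ₐ[k] A ⊗[k] B).toLinearMap

/-- The inclusion `y ↦ 1 ⊗ y` as a linear map. -/
noncomputable abbrev tinr (k A B : Type*) [Field k] [Ring A] [Algebra k A] [Ring B] [Algebra k B] :
    B →ₗ[k] A ⊗[k] B :=
  (includeRight : B →ₐ[k] A ⊗[k] B).toLinearMap

/-- The map `u ⊗ v ↦ u v₁ ⊗ v₂`. -/
noncomputable def galois : C ⊗[k] C →ₗ[k] C ⊗[k] C :=
  mul' k (C ⊗[k] C) ∘ₗ TensorProduct.map (tinl k C C) comul

/-- The map `u ⊗ v ↦ ε(u) v`. -/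
noncomputable def counitLeft : C ⊗[k] C →ₗ[k] C :=
  (TensorProduct.lid k C).toLinearMap ∘ₗ (counit (R := k)).rTensor C

variable {k C}

/-- The map `c ↦ S c₁ ⊗ c₂`. -/
noncomputable def leftInvariant (S : C →ₗ[k] C) : C →ₗ[k] C ⊗[k] C := S.rTensor C ∘ₗ comul

/-- The map `u ⊗ v ↦ u S v₁ ⊗ v₂`. -/
noncomputable def galoisInv (S : C →ₗ[k] C) : C ⊗[k] C →ₗ[k] C ⊗[k] C :=
  mul' k (C ⊗[k] C) ∘ₗ TensorProduct.map (tinl k C C) (leftInvariant S)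

theorem galois_tmul (u v : C) : galois k C (u ⊗ₜ v) = (u ⊗ₜ 1) * comul v := rfl

theorem galoisInv_tmul (S : C →ₗ[k] C) (u v : C) :
    galoisInv S (u ⊗ₜ v) = (u ⊗ₜ 1) * leftInvariant S v := rfl

theorem counitLeft_tmul (u v : C) : counitLeft k C (u ⊗ₜ v) = counit (R := k) u • v := by
  simp [counitLeft]

theorem counitLeft_comul (c : C) : counitLeft k C (comul c) = c := by
  simp [counitLeft]

theorem galois_mul (u : C) (t : C ⊗[k] C) :
    galois k C ((u ⊗ₜ 1) * t) = (u ⊗ₜ 1) * galois k C t := by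
  induction t using TensorProduct.induction_on with
  | zero => simp
  | add x y hx hy => simp only [map_add, mul_add, hx, hy]
  | tmul x y => simp [galois_tmul, ← mul_assoc]

theorem galoisInv_mul (S : C →ₗ[k] C) (u : C) (t : C ⊗[k] C) :
    galoisInv S ((u ⊗ₜ 1) * t) = (u ⊗ₜ 1) * galoisInv S t := by
  induction t using TensorProduct.induction_on with
  | zero => simp
  | add x y hx hy => simp only [map_add, mul_add, hx, hy]
  | tmul x y => simp [galoisInv_tmul, ← mul_assoc]

/-- Writing c₁ ⊗ c₂ as the product (c₁ ⊗ 1)(1 ⊗ c₂) lets coproducts enter convolution calculations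
as two separate factors, each of which can be cancelled. -/
theorem toConv_comul : toConv (comul (R := k) (A := C)) =
    toConv (tinl k C C) * toConv (tinr k C C) := by
  ext c
  rw [convMul_apply]
  change comul (R := k) c = mul' k _ (TensorProduct.map (tinl k C C) (tinr k C C) (comul c))
  induction comul (R := k) c using TensorProduct.induction_on with
  | zero => simp
  | add x y hx hy => rw [map_add, map_add, ← hx, ← hy]
  | tmul x y => simp

theorem toConv_leftInvariant (S : C →ₗ[k] C) : toConv (leftInvariant S) =
    toConv (tinl k C C ∘ₗ S) * toConv (tinr k C C) := by
  ext c
  rw [convMul_apply]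
  change S.rTensor C (comul (R := k) c) =
    mul' k _ (TensorProduct.map (tinl k C C ∘ₗ S) (tinr k C C) (comul c))
  induction comul (R := k) c using TensorProduct.induction_on with
  | zero => simp
  | add x y hx hy => rw [map_add, map_add, map_add, ← hx, ← hy]
  | tmul x y => simp

theorem midTwist_tmul {X Y X' Y' Z W : Type*} [AddCommGroup X] [Module k X] [AddCommGroup Y]
    [Module k Y] [AddCommGroup X'] [Module k X'] [AddCommGroup Y'] [Module k Y']
    [AddCommGroup Z] [Module k Z] [AddCommGroup W] [Module k W]
    (τ : Y ⊗[k] X' →ₗ[k] Z ⊗[k] W) (x : X) (y : Y) (x' : X') (y' : Y') :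
    midTwist τ ((x ⊗ₜ y) ⊗ₜ (x' ⊗ₜ y')) = (TensorProduct.assoc k X Z (W ⊗[k] Y')).symm
      (x ⊗ₜ TensorProduct.assoc k Z W Y' (τ (y ⊗ₜ x') ⊗ₜ y')) := by
  simp [midTwist]

/-- If the coproduct is multiplicative with respect to the product on `C ⊗ C` defined by `τ`, then
the coaction of `C` on `C ⊗ C` defined by `τ` corresponds by the canonical map to the coproduct on
the left factor. -/
theorem galois_coact {τ : C ⊗[k] C →ₗ[k] C ⊗[k] C}
    (hτ : ∀ b c : C, comul (R := k) (b * c) = TensorProduct.map (mul' k C) (mul' k C)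
      (midTwist τ (comul (R := k) b ⊗ₜ comul (R := k) c))) (t : C ⊗[k] C) :
    (galois k C).lTensor C ((mul' k C).rTensor (C ⊗[k] C) (midTwist τ
      (TensorProduct.map comul comul t))) =
    TensorProduct.assoc k C C C ((comul (R := k)).rTensor C (galois k C t)) := by
  induction t using TensorProduct.induction_on with
  | zero => simp
  | add x y hx hy => simp only [map_add, hx, hy]
  | tmul u v =>
  -- `M s` is left multiplication by s for the product on C ⊗ C defined by τ.
  let M : C ⊗[k] C → C ⊗[k] C →ₗ[k] C ⊗[k] C := fun s =>
    TensorProduct.map (mul' k C) (mul' k C) ∘ₗ midTwist τ ∘ₗ TensorProduct.mk k _ _ s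
  have h (r : C ⊗[k] C) : (comul (R := k)).rTensor C ((u ⊗ₜ 1) * r) =
      (M (comul u)).rTensor C ((comul (R := k)).rTensor C r) := by
    induction r using TensorProduct.induction_on with
    | zero => simp
    | add x y hx hy => simp only [map_add, mul_add, hx, hy]
    | tmul c d => simp [M, hτ]
  -- For s = a ⊗ b and r = c ⊗ d, both sides are (a ⊗ 1) τ(b ⊗ c) in the first two legs, multiplied
  -- on the right by 1 ⊗ Δd.
  have h' (s r : C ⊗[k] C) : (galois k C).lTensor C ((mul' k C).rTensor (C ⊗[k] C)
      (midTwist τ (s ⊗ₜ r))) = TensorProduct.assoc k C C C ((M s).rTensor C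
        ((TensorProduct.assoc k C C C).symm ((comul (R := k)).lTensor C r))) := by
    induction s using TensorProduct.induction_on with
    | zero => simp [M]
    | add x y hx hy =>
      have : M (x + y) = M x + M y := by simp [M, LinearMap.comp_add]
      simp only [TensorProduct.add_tmul, map_add, this, rTensor_add, LinearMap.add_apply, hx, hy]
    | tmul a b =>
    induction r using TensorProduct.induction_on with
    | zero => simp
    | add x y hx hy => simp only [TensorProduct.tmul_add, map_add, hx, hy]
    | tmul c d =>
    have h₁ (w : C ⊗[k] C) : (galois k C).lTensor C ((mul' k C).rTensor (C ⊗[k] C)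
        ((TensorProduct.assoc k C C (C ⊗[k] C)).symm
          (a ⊗ₜ TensorProduct.assoc k C C C (w ⊗ₜ d)))) =
        Algebra.TensorProduct.map (AlgHom.id k C) includeLeft ((a ⊗ₜ 1) * w) *
          (1 ⊗ₜ comul d) := by
      induction w using TensorProduct.induction_on with
      | zero => simp
      | add x y hx hy =>
        simp only [TensorProduct.add_tmul, TensorProduct.tmul_add, map_add, mul_add, add_mul,
          hx, hy]
      | tmul x y => simp [galois_tmul]
    have h₂ (r : C ⊗[k] C) : TensorProduct.assoc k C C C ((M (a ⊗ₜ b)).rTensor C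
        ((TensorProduct.assoc k C C C).symm (c ⊗ₜ r))) =
        Algebra.TensorProduct.map (AlgHom.id k C) includeLeft ((a ⊗ₜ 1) * τ (b ⊗ₜ c)) *
          (1 ⊗ₜ r) := by
      induction r using TensorProduct.induction_on with
      | zero => simp
      | add x y hx hy => simp only [TensorProduct.tmul_add, map_add, mul_add, hx, hy]
      | tmul e f =>
        simp only [TensorProduct.assoc_symm_tmul, rTensor_tmul, M, LinearMap.comp_apply,
          TensorProduct.mk_apply, midTwist_tmul]
        induction τ (b ⊗ₜ c) using TensorProduct.induction_on with
        | zero => simp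
        | add x y hx hy =>
          simp only [TensorProduct.add_tmul, TensorProduct.tmul_add, map_add, mul_add, add_mul,
            hx, hy]
        | tmul x y => simp
    rw [midTwist_tmul, h₁, lTensor_tmul, h₂]
  rw [galois_tmul, h, TensorProduct.map_tmul, h', Coalgebra.coassoc_symm_apply]

section

variable {S : C →ₗ[k] C}

/-- The canonical map is linear for left multiplication, so its composite with κ is the convolution
product of S(·) ⊗ 1 with Δ. Factoring Δ into the two inclusions, S cancels against the first and 1 ⊗
c remains. Only a left convolution inverse of the identity is needed. -/
theorem galois_leftInvariant (hS : toConv S * toConv LinearMap.id = 1) (c : C) :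
    galois k C (leftInvariant S c) = 1 ⊗ₜ c := by
  have h₁ : toConv (galois k C ∘ₗ leftInvariant S) = toConv (tinl k C C ∘ₗ S) * toConv comul := by
    have := toConv_leftInvariant S
    rw [← ofConv_toConv (leftInvariant S), this]
    refine toConv_comp_convMul fun x y => ?_
    change galois k C ((S x ⊗ₜ 1) * (1 ⊗ₜ y)) = (S x ⊗ₜ 1) * comul y
    rw [galois_mul, galois_tmul, ← one_def, one_mul]
  have h₂ : toConv (tinl k C C ∘ₗ S) * toConv (tinl k C C) = 1 := by
    have := toConv_algHom_comp_convMul (includeLeft : C →ₐ[k] C ⊗[k] C) (toConv S)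
      (toConv LinearMap.id)
    rw [hS, toConv_algHom_comp_one] at this
    exact this.symm
  rw [toConv_comul, ← mul_assoc, h₂, one_mul] at h₁
  exact congrArg (fun f => f c) h₁

/-- Left linearity reduces this to the coproduct, where the identity cancels against S in the other
order. This makes the canonical map injective, which is what identifies tensors from their images.
-/
theorem galoisInv_galois (hS : toConv LinearMap.id * toConv S = 1) (t : C ⊗[k] C) :
    galoisInv S (galois k C t) = t := by
  have h₁ : toConv (galoisInv S ∘ₗ comul) = toConv (tinl k C C) * toConv (leftInvariant S) := by
    rw [← ofConv_toConv (comul (R := k) (A := C)), toConv_comul]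
    refine toConv_comp_convMul fun x y => ?_
    change galoisInv S ((x ⊗ₜ 1) * (1 ⊗ₜ y)) = (x ⊗ₜ 1) * leftInvariant S y
    rw [galoisInv_mul, galoisInv_tmul, ← one_def, one_mul]
  have h₂ : toConv (tinl k C C) * toConv (tinl k C C ∘ₗ S) = 1 := by
    have := toConv_algHom_comp_convMul (includeLeft : C →ₐ[k] C ⊗[k] C) (toConv LinearMap.id)
      (toConv S)
    rw [hS, toConv_algHom_comp_one] at this
    exact this.symm
  rw [toConv_leftInvariant, ← mul_assoc, h₂, one_mul] at h₁
  have h₃ (c : C) : galoisInv S (comul c) = 1 ⊗ₜ c := congrArg (fun f => f c) h₁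
  induction t using TensorProduct.induction_on with
  | zero => simp
  | add x y hx hy => simp only [map_add, hx, hy]
  | tmul x y => simp [galois_tmul, galoisInv_mul, h₃]

theorem eq_leftInvariant (hS : toConv LinearMap.id * toConv S = 1) {t : C ⊗[k] C} {c : C}
    (h : galois k C t = 1 ⊗ₜ c) : t = leftInvariant S c := by
  rw [← galoisInv_galois hS t, h, galoisInv_tmul, ← one_def, one_mul]

/-- Multiplicativity of ε reduces this to the counit axiom for v₁ ⊗ v₂. Thus the label c of κ(c) can
be read off without passing through the canonical map. -/
theorem counitLeft_galois
    (hε : ∀ b c : C, counit (R := k) (b * c) = counit (R := k) b * counit (R := k) c)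
    (t : C ⊗[k] C) : counitLeft k C (galois k C t) = counitLeft k C t := by
  have h (u : C) (s : C ⊗[k] C) :
      counitLeft k C ((u ⊗ₜ 1) * s) = counit (R := k) u • counitLeft k C s := by
    induction s using TensorProduct.induction_on with
    | zero => simp
    | add x y hx hy => simp only [map_add, mul_add, smul_add, hx, hy]
    | tmul x y => simp [counitLeft_tmul, hε, mul_smul]
  induction t using TensorProduct.induction_on with
  | zero => simp
  | add x y hx hy => simp only [map_add, hx, hy]
  | tmul x y => rw [galois_tmul, h, counitLeft_comul, counitLeft_tmul]

theorem counitLeft_leftInvariant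
    (hε : ∀ b c : C, counit (R := k) (b * c) = counit (R := k) b * counit (R := k) c)
    (hε₁ : counit (R := k) (1 : C) = 1)
    (hS : toConv S * toConv LinearMap.id = 1) (c : C) :
    counitLeft k C (leftInvariant S c) = c := by
  rw [← counitLeft_galois hε, galois_leftInvariant hS, counitLeft_tmul, hε₁, one_smul]

/-- A coaction `L` of `C` on `C ⊗ C` that corresponds to the coproduct on the left factor by the
canonical map has the invariants `S c₁ ⊗ c₂`. -/
theorem coact_leftInvariant {L : C ⊗[k] C →ₗ[k] C ⊗[k] (C ⊗[k] C)}
    (hL : ∀ t, (galois k C).lTensor C (L t) =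
      TensorProduct.assoc k C C C ((comul (R := k)).rTensor C (galois k C t)))
    (h₁ : comul (R := k) (1 : C) = 1 ⊗ₜ 1)
    (hS : toConv S * toConv LinearMap.id = 1) (hS' : toConv LinearMap.id * toConv S = 1) (c : C) :
    L (leftInvariant S c) = 1 ⊗ₜ leftInvariant S c := by
  have h : galoisInv S ∘ₗ galois k C = LinearMap.id := LinearMap.ext (galoisInv_galois hS')
  -- Undo the canonical map on the last two legs. On the right stands Δ1 ⊗ c = 1 ⊗ 1 ⊗ c, and 1 ⊗ c
  -- comes from κ(c).
  have := congrArg ((galoisInv S).lTensor C) (hL (leftInvariant S c))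
  rw [← lTensor_comp_apply, h, lTensor_id, LinearMap.id_apply, galois_leftInvariant hS] at this
  rw [this, rTensor_tmul, h₁, TensorProduct.assoc_tmul, lTensor_tmul, galoisInv_tmul, ← one_def,
    one_mul]

/-- Apply id ⊗ ε ⊗ id to the compatibility `hL`. The right side collapses to the image of t under
the canonical map by the counit axiom. For invariant t the left side is 1 ⊗ (ε ⊗ id)t, the image of
a κ, and the canonical map is injective. -/
theorem eq_leftInvariant_of_coact_eq {L : C ⊗[k] C →ₗ[k] C ⊗[k] (C ⊗[k] C)}
    (hL : ∀ t, (galois k C).lTensor C (L t) =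
      TensorProduct.assoc k C C C ((comul (R := k)).rTensor C (galois k C t)))
    (hε : ∀ b c : C, counit (R := k) (b * c) = counit (R := k) b * counit (R := k) c)
    (hS' : toConv LinearMap.id * toConv S = 1) {t : C ⊗[k] C}
    (ht : L t = 1 ⊗ₜ t) : t = leftInvariant S (counitLeft k C t) := by
  apply eq_leftInvariant hS'
  have h : counitLeft k C ∘ₗ galois k C = counitLeft k C := LinearMap.ext (counitLeft_galois hε)
  have h' (s : C ⊗[k] C) : (counitLeft k C).lTensor C
      (TensorProduct.assoc k C C C ((comul (R := k)).rTensor C s)) = s := by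
    induction s using TensorProduct.induction_on with
    | zero => simp
    | add x y hx hy => simp only [map_add, hx, hy]
    | tmul x y =>
      have (r : C ⊗[k] C) : (counitLeft k C).lTensor C (TensorProduct.assoc k C C C (r ⊗ₜ y)) =
          TensorProduct.rid k C ((counit (R := k)).lTensor C r) ⊗ₜ y := by
        induction r using TensorProduct.induction_on with
        | zero => simp
        | add x y hx hy => simp only [map_add, TensorProduct.add_tmul, hx, hy]
        | tmul x y => simp [counitLeft_tmul, TensorProduct.smul_tmul]
      rw [rTensor_tmul, this]
      simp
  have := congrArg ((counitLeft k C).lTensor C) (hL t)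
  rw [← lTensor_comp_apply, h, h', ht, lTensor_tmul] at this
  exact this.symm

end

end Canonical

/-! ### Extension of maps from the augmentation ideal -/

section Augmentation

open WithConv LinearMap Algebra.TensorProduct

variable {k H : Type*} [Field k] [Ring H] [HopfAlgebra k H]

theorem augProj_coe (h : augKer k H) : augProj k H h = h := by
  have : counit (R := k) (h : H) = 0 := h.2
  ext
  simp [augProj, this]

theorem augProj_one : augProj k H 1 = 0 := by
  ext
  simp [augProj]

theorem augProj_add (h : H) : (augProj k H h : H) + counit (R := k) h • 1 = h := by
  simp [augProj]

/-- H is the direct sum of ker ε and k1, so identities between unital extensions need to be checked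
only on ker ε. -/
theorem linearMap_ext_augKer {V : Type*} [AddCommGroup V] [Module k V] {f g : H →ₗ[k] V}
    (h₁ : f 1 = g 1) (h : ∀ x : augKer k H, f x = g x) : f = g := by
  ext x
  rw [← augProj_add (k := k) x, map_add, map_add, h, map_smul, map_smul, h₁]

variable {A : Type*} [Ring A] [Algebra k A]

/-- The extension of a map on `ker ε` to `H` by `1 ↦ 1`. -/
noncomputable def augExt (f : augKer k H →ₗ[k] A) : H →ₗ[k] A :=
  f ∘ₗ augProj k H + Algebra.linearMap k A ∘ₗ counit

theorem augExt_coe (f : augKer k H →ₗ[k] A) (h : augKer k H) : augExt f h = f h := by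
  have : counit (R := k) (h : H) = 0 := h.2
  simp [augExt, augProj_coe, this]

theorem augExt_one (f : augKer k H →ₗ[k] A) : augExt f 1 = 1 := by
  simp [augExt, augProj_one]

theorem augExt_unique {f : augKer k H →ₗ[k] A} {g : H →ₗ[k] A} (h₁ : g 1 = 1)
    (h : ∀ x : augKer k H, g x = f x) : g = augExt f :=
  linearMap_ext_augKer (by rw [h₁, augExt_one]) fun x => by rw [h, augExt_coe]

/-- The extension by 1 ↦ 0, which is what π_ε produces in the definitions, differs from the unital
extension by the convolution unit. Every inhomogeneous term in the formulas is absorbed by this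
shift. -/
theorem toConv_comp_augProj (f : augKer k H →ₗ[k] A) :
    toConv (f ∘ₗ augProj k H) = toConv (augExt f) - 1 :=
  eq_sub_of_add_eq rfl

theorem comp_augExt {A' : Type*} [Ring A'] [Algebra k A'] (f : augKer k H →ₗ[k] A)
    (T : A →ₗ[k] A') (hT : T 1 = 1) : T ∘ₗ augExt f = augExt (T ∘ₗ f) :=
  augExt_unique (by simp [augExt_one, hT]) fun x => by simp [augExt_coe]

/-- The left adjoint coaction is conjugation: the legs h₁ and S h₃ are mutually inverse elements of
the convolution algebra, with g(h₂) between them in the other tensor factor. -/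
theorem lTensor_adL (g : H →ₗ[k] A) (h : H) : g.lTensor H (adL k H h) =
    (toConv (tinl k H A) * (toConv (tinr k H A ∘ₗ g) *
      toConv (tinl k H A ∘ₗ HopfAlgebra.antipode k))) h := by
  rw [convMul_apply]
  simp only [adL, LinearMap.comp_apply]
  induction comul (R := k) h using TensorProduct.induction_on with
  | zero => simp
  | add x y hx hy => simp only [map_add, hx, hy]
  | tmul x y =>
    rw [TensorProduct.map_tmul, LinearMap.lTensor_tmul, LinearMap.comp_apply, mul'_apply]
    change _ = _ * mul' k _ (TensorProduct.map _ _ (comul (R := k) y))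
    induction comul (R := k) y using TensorProduct.induction_on with
    | zero => simp
    | add x y hx hy => simp only [map_add, TensorProduct.tmul_add, mul_add, hx, hy]
    | tmul y z => simp

theorem rTensor_adR (g : H →ₗ[k] A) (h : H) : g.rTensor H (adR k H h) =
    (toConv (tinr k A H ∘ₗ HopfAlgebra.antipode k) * toConv (tinl k A H ∘ₗ g) *
      toConv (tinr k A H)) h := by
  rw [convMul_apply]
  simp only [adR, LinearMap.comp_apply]
  induction comul (R := k) h using TensorProduct.induction_on with
  | zero => simp
  | add x y hx hy => simp only [map_add, hx, hy]
  | tmul x y =>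
    rw [TensorProduct.map_tmul, LinearMap.rTensor_tmul, LinearMap.comp_apply, mul'_apply]
    change _ = mul' k _ (TensorProduct.map _ _ (comul (R := k) x)) * _
    induction comul (R := k) x using TensorProduct.induction_on with
    | zero => simp
    | add x y hx hy => simp only [map_add, TensorProduct.add_tmul, add_mul, hx, hy]
    | tmul y z => simp

theorem toConv_adR : toConv (adR k H) = toConv (tinr k H H ∘ₗ HopfAlgebra.antipode k) *
    toConv (tinl k H H) * toConv (tinr k H H) := by
  ext h
  have := rTensor_adR (LinearMap.id : H →ₗ[k] H) h
  rw [rTensor_id, LinearMap.id_apply] at this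
  exact this

theorem convMul_apply_one (f g : WithConv (H →ₗ[k] A)) : (f * g) 1 = f 1 * g 1 := by
  simp [convMul_apply, Algebra.TensorProduct.one_def]

theorem comp_augExt_sub_one {A' : Type*} [Ring A'] [Algebra k A'] (φ : A →ₐ[k] A')
    (f : augKer k H →ₗ[k] A) : toConv (φ.toLinearMap ∘ₗ f ∘ₗ augProj k H) =
      toConv (φ.toLinearMap ∘ₗ augExt f) - 1 := by
  rw [comp_augExt f _ (map_one φ), ← toConv_comp_augProj]
  rfl

/-- The intertwining property with the left adjoint coaction in terms of convolution products. -/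
theorem intertwinesAd_iff {ρ : A →ₗ[k] H ⊗[k] A} (hρ : ρ 1 = 1) (f : augKer k H →ₗ[k] A) :
    IntertwinesAd ρ f ↔ toConv (ρ ∘ₗ augExt f) = toConv (tinl k H A) *
      toConv (tinr k H A ∘ₗ augExt f) * toConv (tinl k H A ∘ₗ HopfAlgebra.antipode k) := by
  have key (h : augKer k H) : (f ∘ₗ augProj k H).lTensor H (adL k H h) =
      (toConv (tinl k H A) * toConv (tinr k H A ∘ₗ augExt f) *
        toConv (tinl k H A ∘ₗ HopfAlgebra.antipode k)) h := by
    have hh : counit (R := k) (h : H) = 0 := h.2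
    -- Replacing the extension by zero with the unital one subtracts the conjugate of the
    -- convolution unit, which is ε(·)1 and vanishes on ker ε.
    rw [lTensor_adL, ← mul_assoc, comp_augExt_sub_one, mul_sub, sub_mul, mul_one,
      conv_mul_antipode]
    change _ - algebraMap k (H ⊗[k] A) (counit (R := k) (h : H)) = _
    rw [hh, map_zero, sub_zero]
    rfl
  constructor
  · intro hf
    refine toConv_injective.eq_iff.mpr (linearMap_ext_augKer ?_ fun h => ?_)
    · change ρ (augExt f 1) = (_ * _ : WithConv (H →ₗ[k] H ⊗[k] A)) 1
      rw [convMul_apply_one, convMul_apply_one, augExt_one, hρ]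
      simp [augExt_one, Algebra.TensorProduct.one_def]
    · change ρ (augExt f h) = _
      rw [augExt_coe, hf h, key]
      rfl
  · intro hf h
    have := congrArg (fun g => g (h : H)) hf
    rw [key, ← this, ← augExt_coe f]
    rfl

/-- Covariance under the right adjoint coaction in terms of convolution products. -/
theorem adR_covariant_iff {ρ : A →ₗ[k] A ⊗[k] H} (hρ : ρ 1 = 1) (f : augKer k H →ₗ[k] A) :
    (∀ h : augKer k H, ρ (f h) = (f ∘ₗ augProj k H).rTensor H (adR k H h)) ↔
      toConv (ρ ∘ₗ augExt f) = toConv (tinr k A H ∘ₗ HopfAlgebra.antipode k) *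
      toConv (tinl k A H ∘ₗ augExt f) * toConv (tinr k A H) := by
  have key (h : augKer k H) : (f ∘ₗ augProj k H).rTensor H (adR k H h) =
      (toConv (tinr k A H ∘ₗ HopfAlgebra.antipode k) *
      toConv (tinl k A H ∘ₗ augExt f) * toConv (tinr k A H)) h := by
    have hh : counit (R := k) (h : H) = 0 := h.2
    -- As for the left adjoint coaction: the convolution unit is fixed by conjugation and vanishes
    -- on ker ε.
    rw [rTensor_adR, comp_augExt_sub_one, mul_sub, sub_mul, mul_one, conv_antipode_mul]
    change _ - algebraMap k (A ⊗[k] H) (counit (R := k) (h : H)) = _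
    rw [hh, map_zero, sub_zero]
    rfl
  constructor
  · intro hf
    refine toConv_injective.eq_iff.mpr (linearMap_ext_augKer ?_ fun h => ?_)
    · change ρ (augExt f 1) = (_ * _ : WithConv (H →ₗ[k] A ⊗[k] H)) 1
      rw [convMul_apply_one, convMul_apply_one, augExt_one, hρ]
      simp [augExt_one, Algebra.TensorProduct.one_def]
    · change ρ (augExt f h) = _
      rw [augExt_coe, hf h, key]
      rfl
  · intro hf h
    have := congrArg (fun g => g (h : H)) hf
    rw [key, ← this, ← augExt_coe f]
    rfl

theorem IntertwinesAd.comp {V W : Type*} [AddCommGroup V] [Module k V] [AddCommGroup W]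
    [Module k W] {ρ : V →ₗ[k] H ⊗[k] V} {ρ' : W →ₗ[k] H ⊗[k] W} {f : augKer k H →ₗ[k] V}
    (hf : IntertwinesAd ρ f) (σ : V →ₗ[k] W) (hσ : ∀ v, ρ' (σ v) = σ.lTensor H (ρ v)) :
    IntertwinesAd ρ' (σ ∘ₗ f) := fun h => by
  rw [LinearMap.comp_apply, hσ, hf h, ← lTensor_comp_apply]
  rfl

end Augmentation

/-! ### Invariant forms on a Hopf algebra -/

section HopfInvariants

open WithConv LinearMap Algebra.TensorProduct

theorem univForms.coe_lmul {k A : Type*} [Field k] [Ring A] [Algebra k A] (u : A)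
    (η : univForms k A) :
    (univForms.lmul k A (u ⊗ₜ η) : A ⊗[k] A) = (u ⊗ₜ 1) * (η : A ⊗[k] A) := by
  change (mul' k A).rTensor A ((TensorProduct.assoc k A A A).symm (u ⊗ₜ (η : A ⊗[k] A))) = _
  induction (η : A ⊗[k] A) using TensorProduct.induction_on with
  | zero => simp
  | add x y hx hy => simp only [TensorProduct.tmul_add, map_add, mul_add, hx, hy]
  | tmul x y => simp

theorem univForms.coe_rmul {k A : Type*} [Field k] [Ring A] [Algebra k A] (u : A)
    (η : univForms k A) :
    (univForms.rmul k A (η ⊗ₜ u) : A ⊗[k] A) = (η : A ⊗[k] A) * (1 ⊗ₜ u) := by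
  change (mul' k A).lTensor A (TensorProduct.assoc k A A A ((η : A ⊗[k] A) ⊗ₜ u)) = _
  induction (η : A ⊗[k] A) using TensorProduct.induction_on with
  | zero => simp
  | add x y hx hy => simp only [TensorProduct.add_tmul, map_add, add_mul, hx, hy]
  | tmul x y => simp

theorem univForms.coe_d {k A : Type*} [Field k] [Ring A] [Algebra k A] (u : A) :
    (univForms.d k A u : A ⊗[k] A) = 1 ⊗ₜ u - u ⊗ₜ 1 := rfl

/-- The form u d v is u ⊗ v − uv ⊗ 1. The correction vanishes on tensors with product zero, which is
how forms S c₁ d c₂ with ε(c) = 0 become the plain tensors κ(c). -/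
theorem univForms.coe_mulD {k A : Type*} [Field k] [Ring A] [Algebra k A] (t : A ⊗[k] A) :
    (univForms.mulD k A t : A ⊗[k] A) = t - mul' k A t ⊗ₜ 1 := by
  induction t using TensorProduct.induction_on with
  | zero => simp
  | add x y hx hy => simp only [map_add, TensorProduct.add_tmul, Submodule.coe_add, hx, hy]; abel
  | tmul x y =>
    rw [univForms.mulD, LinearMap.comp_apply, lTensor_tmul, univForms.coe_lmul, univForms.coe_d]
    simp [mul_sub]

theorem univForms.coe_map {k A A' : Type*} [Field k] [Ring A] [Algebra k A] [Ring A'] [Algebra k A']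
    (f : A →ₐ[k] A') (η : univForms k A) : (univForms.map f η : A' ⊗[k] A') =
      Algebra.TensorProduct.map f f (η : A ⊗[k] A) := rfl

/-- Guarantees that ε ⊗ id maps universal forms into the augmentation ideal. -/
theorem counit_counitLeft {k C : Type*} [Field k] [Ring C] [Algebra k C] [Coalgebra k C]
    (hε : ∀ b c : C, counit (R := k) (b * c) = counit (R := k) b * counit (R := k) c)
    (t : C ⊗[k] C) : counit (R := k) (counitLeft k C t) = counit (R := k) (mul' k C t) := by
  induction t using TensorProduct.induction_on with
  | zero => simp
  | add x y hx hy => simp only [map_add, hx, hy]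
  | tmul x y => simp [counitLeft_tmul, hε]

variable {k P H : Type*} [Field k] [Ring P] [HopfAlgebra k P] [Ring H] [HopfAlgebra k H]

theorem galois_leftRegCoact (t : P ⊗[k] P) : (galois k P).lTensor P (leftRegCoact k P t) =
    TensorProduct.assoc k P P P ((comul (R := k)).rTensor P (galois k P t)) := by
  refine galois_coact (τ := tflip k P P) (fun b c => ?_) t
  rw [Bialgebra.comul_mul]
  induction comul (R := k) b using TensorProduct.induction_on with
  | zero => simp
  | add x y hx hy => simp only [TensorProduct.add_tmul, map_add, add_mul, hx, hy]
  | tmul x y =>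
  induction comul (R := k) c using TensorProduct.induction_on with
  | zero => simp
  | add x y hx hy => simp only [TensorProduct.tmul_add, map_add, mul_add, hx, hy]
  | tmul z w => simp [midTwist]

/-- The left-invariant forms on a Hopf algebra are the forms `S p₁ d p₂`. -/
theorem leftRegCoact_eq_iff (t : P ⊗[k] P) : leftRegCoact k P t = 1 ⊗ₜ t ↔
    t = leftInvariant (HopfAlgebra.antipode k) (counitLeft k P t) := by
  constructor
  · exact eq_leftInvariant_of_coact_eq galois_leftRegCoact Bialgebra.counit_mul id_mul_antipode
  · intro h
    rw [h]
    exact coact_leftInvariant galois_leftRegCoact Bialgebra.comul_one antipode_mul_id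
      id_mul_antipode _

/-- The correction S i(h)₁ i(h)₂ ⊗ 1 in S i(h)₁ d i(h)₂ is ε(i(h)) 1 ⊗ 1, which is zero. -/
theorem coe_canonicalConn (i : augKer k H →ₗ[k] augKer k P) (h : augKer k H) :
    (canonicalConn i h : P ⊗[k] P) = leftInvariant (HopfAlgebra.antipode k) (i h : P) := by
  have : counit (R := k) (i h : P) = 0 := (i h).2
  simp [canonicalConn, univForms.coe_mulD, leftInvariant, this]

theorem counitLeft_leftInvariant_antipode (p : P) :
    counitLeft k P (leftInvariant (HopfAlgebra.antipode k) p) = p :=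
  counitLeft_leftInvariant Bialgebra.counit_mul Bialgebra.counit_one antipode_mul_id p

theorem leftInvariant_one :
    leftInvariant (HopfAlgebra.antipode k) (1 : P) = 1 := by
  simp [leftInvariant, Algebra.TensorProduct.one_def]

/-- On a homogeneous bundle χ is the canonical map of P followed by π on the right leg. Hence
χ(κ(p)) = 1 ⊗ π(p), and the first connection axiom for κ ∘ i says that i splits π. -/
theorem canMap_homogCoact (π : P →ₐc[k] H) (t : P ⊗[k] P) : canMap (homogCoact π) t =
    (π : P →ₐ[k] H).toLinearMap.lTensor P (galois k P t) := by
  induction t using TensorProduct.induction_on with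
  | zero => simp
  | add x y hx hy => simp only [map_add, hx, hy]
  | tmul u v =>
    simp only [canMap, homogCoact, galois_tmul, LinearMap.comp_apply, lTensor_tmul,
      AlgHom.toLinearMap_apply, AlgHom.comp_apply, Bialgebra.comulAlgHom_apply]
    induction comul (R := k) v using TensorProduct.induction_on with
    | zero => simp
    | add x y hx hy => simp only [map_add, mul_add, TensorProduct.tmul_add, hx, hy]
    | tmul x y => simp

theorem toConv_homogCoact (π : P →ₐc[k] H) : toConv (homogCoact π).toLinearMap =
    toConv (tinl k P H) * toConv (tinr k P H ∘ₗ (π : P →ₐ[k] H).toLinearMap) := by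
  have := toConv_algHom_comp_convMul (Algebra.TensorProduct.map (AlgHom.id k P) (π : P →ₐ[k] H))
    (toConv (tinl k P P)) (toConv (tinr k P P))
  rw [← toConv_comul] at this
  refine Eq.trans this ?_
  congr 2
  ext
  simp

/-- The tensor product coaction on the left-invariant forms is the adjoint coaction. -/
theorem rightTensorCoact_leftInvariant (π : P →ₐc[k] H) (p : P) :
    rightTensorCoact (homogCoact π) (leftInvariant (HopfAlgebra.antipode k) p) =
      (leftInvariant (HopfAlgebra.antipode k)).rTensor H
        ((π : P →ₐ[k] H).toLinearMap.lTensor P (adR k P p)) := by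
  let π' : P →ₐ[k] H := π
  let e : P ⊗[k] H →ₐ[k] (P ⊗[k] P) ⊗[k] H :=
    Algebra.TensorProduct.map includeLeft (AlgHom.id k H)
  let e' : P ⊗[k] H →ₐ[k] (P ⊗[k] P) ⊗[k] H :=
    Algebra.TensorProduct.map includeRight (AlgHom.id k H)
  let e₁ : P →ₐ[k] (P ⊗[k] P) ⊗[k] H := includeLeft.comp includeLeft
  let e₂ : P →ₐ[k] (P ⊗[k] P) ⊗[k] H := includeLeft.comp includeRight
  let e₃ : P →ₐ[k] (P ⊗[k] P) ⊗[k] H := includeRight.comp π'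
  let S : P →ₗ[k] P := HopfAlgebra.antipode k
  -- The legs of (P ⊗ P) ⊗ H are included by e₁, e₂ and, through π, e₃. The coaction placed on the
  -- first or on the second copy of P is then e₁ * e₃ or e₂ * e₃.
  have he : toConv (e.comp (homogCoact π)).toLinearMap =
      toConv e₁.toLinearMap * toConv e₃.toLinearMap := by
    have := toConv_algHom_comp_convMul e (toConv (tinl k P H))
      (toConv (tinr k P H ∘ₗ (π : P →ₐ[k] H).toLinearMap))
    rw [← toConv_homogCoact] at this
    refine Eq.trans this ?_
    congr 2
  have he' : toConv (e'.comp (homogCoact π)).toLinearMap =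
      toConv e₂.toLinearMap * toConv e₃.toLinearMap := by
    have := toConv_algHom_comp_convMul e' (toConv (tinl k P H))
      (toConv (tinr k P H ∘ₗ (π : P →ₐ[k] H).toLinearMap))
    rw [← toConv_homogCoact] at this
    refine Eq.trans this ?_
    congr 2
  have hmul (s r : P ⊗[k] H) : (mul' k H).lTensor (P ⊗[k] P) (midTwist (tflip k H P) (s ⊗ₜ r)) =
      e s * e' r := by
    induction s using TensorProduct.induction_on with
    | zero => simp
    | add x y hx hy => simp only [TensorProduct.add_tmul, map_add, add_mul, hx, hy]
    | tmul a b =>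
    induction r using TensorProduct.induction_on with
    | zero => simp
    | add x y hx hy => simp only [TensorProduct.tmul_add, map_add, mul_add, hx, hy]
    | tmul c d => simp [midTwist, e, e']
  -- The inverse of e₁ * e₃ is the product of the inverses in reverse order. Uniqueness of inverses
  -- here replaces the antimultiplicativity of S under the coproduct.
  have hinv : toConv ((e.comp (homogCoact π)).toLinearMap ∘ₗ S) =
      toConv (e₃.toLinearMap ∘ₗ S) * toConv (e₁.toLinearMap ∘ₗ S) := by
    refine left_inv_eq_right_inv (conv_antipode_mul _) ?_
    rw [he, mul_assoc, ← mul_assoc (toConv e₃.toLinearMap), conv_mul_antipode, one_mul,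
      conv_mul_antipode]
  have hL : toConv (rightTensorCoact (homogCoact π) ∘ₗ leftInvariant S) =
      toConv ((e.comp (homogCoact π)).toLinearMap ∘ₗ S) *
        toConv (e'.comp (homogCoact π)).toLinearMap := by
    rw [← ofConv_toConv (leftInvariant S), toConv_leftInvariant]
    refine toConv_comp_convMul fun x y => ?_
    change rightTensorCoact (homogCoact π) ((S x ⊗ₜ 1) * (1 ⊗ₜ y)) = _
    rw [tmul_mul_tmul, one_mul, mul_one]
    exact hmul _ _
  -- The outer factors of Ad live in the last leg, on which κ ⊗ π is an algebra map on either side.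
  -- So they come out as e₃ ∘ S and e₃ around the middle factor κ = (e₁ ∘ S) * e₂.
  have hR : toConv ((leftInvariant S).rTensor H ∘ₗ π'.toLinearMap.lTensor P ∘ₗ adR k P) =
      toConv (e₃.toLinearMap ∘ₗ S) * (toConv (e₁.toLinearMap ∘ₗ S) * toConv e₂.toLinearMap) *
        toConv e₃.toLinearMap := by
    have hl (x : P) (t : P ⊗[k] P) : (leftInvariant S).rTensor H (π'.toLinearMap.lTensor P
        ((1 ⊗ₜ x) * t)) = e₃ x * (leftInvariant S).rTensor H (π'.toLinearMap.lTensor P t) := by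
      induction t using TensorProduct.induction_on with
      | zero => simp
      | add x y hx hy => simp only [map_add, mul_add, hx, hy]
      | tmul a b => simp [e₃]
    have hr (x : P) (t : P ⊗[k] P) : (leftInvariant S).rTensor H (π'.toLinearMap.lTensor P
        (t * (1 ⊗ₜ x))) = (leftInvariant S).rTensor H (π'.toLinearMap.lTensor P t) * e₃ x := by
      induction t using TensorProduct.induction_on with
      | zero => simp
      | add x y hx hy => simp only [map_add, add_mul, hx, hy]
      | tmul a b => simp [e₃]
    have h₂ : toConv (e₁.toLinearMap ∘ₗ S) * toConv e₂.toLinearMap =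
        toConv (((leftInvariant S).rTensor H ∘ₗ π'.toLinearMap.lTensor P) ∘ₗ tinl k P P) := by
      have := toConv_algHom_comp_convMul (includeLeft : P ⊗[k] P →ₐ[k] (P ⊗[k] P) ⊗[k] H)
        (toConv (tinl k P P ∘ₗ S)) (toConv (tinr k P P))
      rw [← toConv_leftInvariant] at this
      refine Eq.trans this.symm ?_
      congr 1
      ext p
      simp
    have h₃ : toConv (((leftInvariant S).rTensor H ∘ₗ π'.toLinearMap.lTensor P) ∘ₗ
        (toConv (tinr k P P ∘ₗ S) * toConv (tinl k P P)).ofConv) = toConv (e₃.toLinearMap ∘ₗ S) *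
          (toConv (e₁.toLinearMap ∘ₗ S) * toConv e₂.toLinearMap) := by
      rw [h₂]
      exact toConv_comp_convMul fun x y => hl _ _
    rw [← ofConv_toConv (adR k P), toConv_adR, ← LinearMap.comp_assoc, ← h₃]
    exact toConv_comp_convMul fun x y => hr _ _
  have : toConv (rightTensorCoact (homogCoact π) ∘ₗ leftInvariant S) =
      toConv ((leftInvariant S).rTensor H ∘ₗ π'.toLinearMap.lTensor P ∘ₗ adR k P) := by
    rw [hL, hR, hinv, he']
    simp only [mul_assoc]
  exact congrArg (fun f => f p) this

end HopfInvariants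

/-! ### Invariant forms on a braided group -/

section BraidedInvariants

open WithConv LinearMap Algebra.TensorProduct BraidedGroup

variable {k H B : Type*} [Field k] [Ring H] [HopfAlgebra k H] [Ring B] [Algebra k B]
  [Coalgebra k B] [CrossedModule k H B] [BraidedGroup k H B]

variable (k H B) in
theorem bantipode_mul_id : toConv (bantipode (k := k) (B := B) H) * toConv LinearMap.id = 1 := by
  ext b
  rw [convMul_apply, convOne_apply, Algebra.algebraMap_eq_smul_one]
  exact mul_bantipode_rTensor_comul (H := H) b

variable (k H B) in
theorem id_mul_bantipode : toConv LinearMap.id * toConv (bantipode (k := k) (B := B) H) = 1 := by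
  ext b
  rw [convMul_apply, convOne_apply, Algebra.algebraMap_eq_smul_one]
  exact mul_bantipode_lTensor_comul (H := H) b

/-- The forms on `B` that are invariant under the braided coaction are the forms `S̲ b₁ d b₂`. -/
theorem braidedLeftCoact_eq_iff (t : B ⊗[k] B) : braidedLeftCoact k H B t = 1 ⊗ₜ t ↔
    t = leftInvariant (bantipode (k := k) H) (counitLeft k B t) := by
  have hL := galois_coact (BraidedGroup.comul_mul (k := k) (H := H) (B := B))
  constructor
  · exact eq_leftInvariant_of_coact_eq (L := braidedLeftCoact k H B) hL
      (BraidedGroup.counit_mul (H := H)) (id_mul_bantipode k H B)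
  · intro h
    rw [h]
    exact coact_leftInvariant (L := braidedLeftCoact k H B) hL
      (BraidedGroup.comul_one (H := H)) (bantipode_mul_id k H B) (id_mul_bantipode k H B) _

theorem counitLeft_leftInvariant_bantipode (b : B) :
    counitLeft k B (leftInvariant (bantipode (k := k) H) b) = b :=
  counitLeft_leftInvariant (BraidedGroup.counit_mul (H := H)) (BraidedGroup.counit_one (H := H))
    (bantipode_mul_id k H B) b

variable (k H B) in
theorem bantipode_one : bantipode (k := k) H (1 : B) = 1 := by
  have := mul_bantipode_rTensor_comul (k := k) (H := H) (1 : B)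
  rw [BraidedGroup.comul_one (H := H), BraidedGroup.counit_one (H := H)] at this
  simpa using this

variable (k H B) in
theorem leftInvariant_bantipode_one : leftInvariant (bantipode (k := k) H) (1 : B) = 1 := by
  rw [leftInvariant, LinearMap.comp_apply, BraidedGroup.comul_one (H := H), rTensor_tmul,
    bantipode_one, Algebra.TensorProduct.one_def]

/-- Both ingredients of κ, the braided coproduct and the braided antipode, are colinear. -/
theorem coactTensor_leftInvariant (b : B) :
    coactTensor k H B (leftInvariant (bantipode (k := k) H) b) =
      (leftInvariant (bantipode (k := k) H)).lTensor H (coact (k := k) b) := by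
  have h (t : B ⊗[k] B) : coactTensor k H B ((bantipode (k := k) H).rTensor B t) =
      ((bantipode (k := k) H).rTensor B).lTensor H (coactTensor k H B t) := by
    induction t using TensorProduct.induction_on with
    | zero => simp
    | add x y hx hy => simp only [map_add, hx, hy]
    | tmul b c =>
    simp only [coactTensor, leftTensorCoact, LinearMap.comp_apply, rTensor_tmul,
      TensorProduct.map_tmul, coact_bantipode]
    induction coact (k := k) (H := H) b using TensorProduct.induction_on with
    | zero => simp
    | add x y hx hy => simp only [map_add, TensorProduct.add_tmul, hx, hy]
    | tmul x y =>
    induction coact (k := k) (H := H) c using TensorProduct.induction_on with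
    | zero => simp
    | add x y hx hy => simp only [map_add, TensorProduct.tmul_add, hx, hy]
    | tmul z w => simp [midTwist]
  rw [leftInvariant, LinearMap.comp_apply, h, coactTensor, ← coact_comul, ← lTensor_comp_apply]

/-- The braided counit is colinear for the trivial coaction, so it can be applied to the first
factor before or after coacting. -/
theorem coact_counitLeft (t : B ⊗[k] B) : coact (k := k) (H := H) (counitLeft k B t) =
    (counitLeft k B).lTensor H (coactTensor k H B t) := by
  induction t using TensorProduct.induction_on with
  | zero => simp
  | add x y hx hy => simp only [map_add, hx, hy]
  | tmul b c =>
  have h (s t : H ⊗[k] B) : (counitLeft k B).lTensor H ((mul' k H).rTensor (B ⊗[k] B)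
      (midTwist (tflip k B H) (s ⊗ₜ t))) =
      (TensorProduct.rid k H ((counit (R := k)).lTensor H s) ⊗ₜ 1) * t := by
    induction s using TensorProduct.induction_on with
    | zero => simp
    | add x y hx hy => simp only [map_add, TensorProduct.add_tmul, add_mul, hx, hy]
    | tmul x y =>
    induction t using TensorProduct.induction_on with
    | zero => simp
    | add x y hx hy => simp only [map_add, TensorProduct.tmul_add, mul_add, hx, hy]
    | tmul z w => simp [midTwist, counitLeft_tmul, TensorProduct.smul_tmul']
  simp only [coactTensor, leftTensorCoact, LinearMap.comp_apply, TensorProduct.map_tmul]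
  rw [h, coact_counit, counitLeft_tmul, map_smul, ← TensorProduct.smul_tmul', smul_mul_assoc,
    ← Algebra.TensorProduct.one_def, one_mul]

theorem coe_formOfMap (γ : augKer k H →ₗ[k] augKer k B) (h : augKer k H) :
    (formOfMap γ h : B ⊗[k] B) = leftInvariant (bantipode (k := k) H) (γ h : B) := by
  have h0 : counit (R := k) (γ h : B) = 0 := (γ h).2
  rw [formOfMap, LinearMap.comp_apply, univForms.coe_mulD]
  simp only [LinearMap.comp_apply, Submodule.subtype_apply, mul_bantipode_rTensor_comul, h0,
    leftInvariant]
  simp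

/-- The inverse is β ↦ (ε ⊗ id) ∘ β. Braided invariance says that β has values in the image of κ,
where κ and ε ⊗ id are mutually inverse. Both are H-colinear, so the intertwining property passes in
each direction. -/
theorem formOfMap_bijOn : Set.BijOn formOfMap (adIntertwiners k H B) (invariantForms k H B) := by
  refine ⟨fun γ hγ => ⟨fun h => ?_, ?_⟩, fun γ _ γ' _ hγ => ?_, fun β hβ => ?_⟩
  · rw [braidedLeftCoact_eq_iff, coe_formOfMap, counitLeft_leftInvariant_bantipode]
  · have : (univForms k B).subtype ∘ₗ formOfMap γ =
        leftInvariant (bantipode (k := k) H) ∘ₗ (augKer k B).subtype ∘ₗ γ :=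
      LinearMap.ext (coe_formOfMap γ)
    rw [this]
    exact IntertwinesAd.comp hγ _ coactTensor_leftInvariant
  · ext h
    have := congrArg (fun β => counitLeft k B (β h : B ⊗[k] B)) hγ
    simpa only [coe_formOfMap, counitLeft_leftInvariant_bantipode] using this
  · let γ : augKer k H →ₗ[k] augKer k B :=
      (counitLeft k B ∘ₗ (univForms k B).subtype ∘ₗ β).codRestrict _ fun h => by
        change counit (R := k) (counitLeft k B (β h : B ⊗[k] B)) = 0
        rw [counit_counitLeft (BraidedGroup.counit_mul (H := H)),
          show mul' k B (β h : B ⊗[k] B) = 0 from (β h).2, map_zero]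
    refine ⟨γ, ?_, ?_⟩
    · exact IntertwinesAd.comp hβ.2 (counitLeft k B) coact_counitLeft
    · ext h : 2
      rw [coe_formOfMap]
      exact ((braidedLeftCoact_eq_iff _).1 (hβ.1 h)).symm

end BraidedInvariants

/-! ### Equivariant maps into the total space -/

section Colinear

open WithConv LinearMap Algebra.TensorProduct

variable {k P H : Type*} [Field k] [Ring P] [HopfAlgebra k P] [Ring H] [HopfAlgebra k H]

/-- The left coaction `(π ⊗ id) Δ` defined by a Hopf algebra map `π : P → H`. -/
noncomputable def homogLeftCoact (π : P →ₐc[k] H) : P →ₐ[k] H ⊗[k] P :=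
  (Algebra.TensorProduct.map (π : P →ₐ[k] H) (AlgHom.id k P)).comp (Bialgebra.comulAlgHom k P)

theorem toConv_homogLeftCoact (π : P →ₐc[k] H) : toConv (homogLeftCoact π).toLinearMap =
    toConv (tinl k H P ∘ₗ (π : P →ₐ[k] H).toLinearMap) * toConv (tinr k H P) := by
  have := toConv_algHom_comp_convMul (Algebra.TensorProduct.map (π : P →ₐ[k] H) (AlgHom.id k P))
    (toConv (tinl k P P)) (toConv (tinr k P P))
  rw [← toConv_comul] at this
  refine Eq.trans this ?_
  congr 2
  ext
  simp

/-- Since π ∘ S = S ∘ π, applying π to the last leg of p₂ ⊗ (S p₁) p₃ leaves S π(p₁) multiplying the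
right coaction of p₂. The adjoint coaction is thus expressed through the two one-sided coactions. -/
theorem toConv_lTensor_adR (π : P →ₐc[k] H) :
    toConv ((π : P →ₐ[k] H).toLinearMap.lTensor P ∘ₗ adR k P) =
    toConv (tinr k P H ∘ₗ HopfAlgebra.antipode k ∘ₗ (π : P →ₐ[k] H).toLinearMap) *
      toConv (homogCoact π).toLinearMap := by
  let φ := Algebra.TensorProduct.map (AlgHom.id k P) (π : P →ₐ[k] H)
  have h₁ := toConv_algHom_comp_convMul φ (toConv (tinr k P P ∘ₗ HopfAlgebra.antipode k) *
    toConv (tinl k P P)) (toConv (tinr k P P))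
  rw [← toConv_adR, toConv_algHom_comp_convMul] at h₁
  rw [toConv_homogCoact, ← mul_assoc]
  refine Eq.trans h₁ ?_
  congr 2
  · congr 1
    ext p
    simp [φ, bialgHom_comp_antipode]
  · congr 1
    ext p
    simp [φ]

/-- For a left colinear map, covariance under the adjoint coaction amounts to right
colinearity. -/
theorem adR_covariant_iff_rightColinear (π : P →ₐc[k] H) {p : H →ₗ[k] P}
    (hp : toConv ((homogLeftCoact π).toLinearMap ∘ₗ p) =
      toConv (tinl k H P) * toConv (tinr k H P ∘ₗ p)) :
    toConv (((π : P →ₐ[k] H).toLinearMap.lTensor P ∘ₗ adR k P) ∘ₗ p) =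
      toConv (tinr k P H ∘ₗ HopfAlgebra.antipode k) * toConv (tinl k P H ∘ₗ p) *
        toConv (tinr k P H) ↔
    toConv ((homogCoact π).toLinearMap ∘ₗ p) =
      toConv (tinl k P H ∘ₗ p) * toConv (tinr k P H) := by
  -- The map x ⊗ y ↦ (1 ⊗ S x) Δ_R(y). Projected Ad factors through the left coaction by it, so left
  -- colinearity of p turns projected Ad ∘ p into (S h₁)-multiplication of Δ_R p(h₂).
  let G : H ⊗[k] P →ₗ[k] P ⊗[k] H := mul' k _ ∘ₗ
    TensorProduct.map (tinr k P H ∘ₗ HopfAlgebra.antipode k) (homogCoact π).toLinearMap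
  have hG (x : H) (y : P) : G ((x ⊗ₜ 1) * (1 ⊗ₜ y)) =
      (1 ⊗ₜ HopfAlgebra.antipode k x) * homogCoact π y := by
    simp [G]
  have h₁ : (π : P →ₐ[k] H).toLinearMap.lTensor P ∘ₗ adR k P =
      G ∘ₗ (homogLeftCoact π).toLinearMap := by
    apply toConv_injective
    rw [toConv_lTensor_adR, ← ofConv_toConv (homogLeftCoact π).toLinearMap, toConv_homogLeftCoact]
    exact (toConv_comp_convMul fun x y => hG _ _).symm
  have h₂ : toConv (((π : P →ₐ[k] H).toLinearMap.lTensor P ∘ₗ adR k P) ∘ₗ p) =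
      toConv (tinr k P H ∘ₗ HopfAlgebra.antipode k) *
        toConv ((homogCoact π).toLinearMap ∘ₗ p) := by
    rw [h₁, LinearMap.comp_assoc, ← ofConv_toConv ((homogLeftCoact π).toLinearMap ∘ₗ p), hp]
    exact toConv_comp_convMul fun x y => hG _ _
  rw [h₂, mul_assoc]
  constructor
  · intro h
    -- Both sides carry the invertible left factor 1 ⊗ S(·); convolving with its inverse removes it.
    have := congrArg (fun f => toConv (tinr k P H) * f) h
    simpa only [← mul_assoc, conv_mul_antipode, one_mul] using this
  · intro h
    rw [h]

end Colinear

/-! ### Connections on the biproduct -/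

section ConnOfForm

open WithConv LinearMap Algebra.TensorProduct

variable {k P H M : Type*} [Field k] [Ring P] [Algebra k P] [Ring H] [HopfAlgebra k H]
  [Ring M] [Algebra k M]

/-- The connection defined by a form as a convolution product. -/
theorem coe_connOfForm (f : M →ₐ[k] P) (Φ Φ' : H →ₗ[k] P) (hΦ : toConv Φ' * toConv Φ = 1)
    (β : augKer k H →ₗ[k] univForms k M) (h : augKer k H) :
    (connOfForm f Φ Φ' β h : P ⊗[k] P) = (toConv (tinl k P P ∘ₗ Φ') *
      (toConv ((Algebra.TensorProduct.map f f).toLinearMap ∘ₗ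
        augExt ((univForms k M).subtype ∘ₗ β)) * toConv (tinr k P P ∘ₗ Φ))) h := by
  have hh : counit (R := k) (h : H) = 0 := h.2
  have h₁ (g : H →ₗ[k] univForms k P) (t : H ⊗[k] H) :
      (univForms.lmul k P (TensorProduct.map Φ' g t) : P ⊗[k] P) =
        mul' k _ (TensorProduct.map (tinl k P P ∘ₗ Φ') ((univForms k P).subtype ∘ₗ g) t) := by
    induction t using TensorProduct.induction_on with
    | zero => simp
    | add x y hx hy => simp only [map_add, Submodule.coe_add, hx, hy]
    | tmul x y => simp [univForms.coe_lmul]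
  have h₂ (g : H →ₗ[k] univForms k P) (t : H ⊗[k] H) :
      (univForms.rmul k P (TensorProduct.map g Φ t) : P ⊗[k] P) =
        mul' k _ (TensorProduct.map ((univForms k P).subtype ∘ₗ g) (tinr k P P ∘ₗ Φ) t) := by
    induction t using TensorProduct.induction_on with
    | zero => simp
    | add x y hx hy => simp only [map_add, Submodule.coe_add, hx, hy]
    | tmul x y => simp [univForms.coe_rmul]
  have h₃ : (univForms k P).subtype ∘ₗ univForms.rmul k P ∘ₗ
      TensorProduct.map (univForms.map f ∘ₗ β ∘ₗ augProj k H) Φ ∘ₗ comul (R := k) =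
      (toConv ((Algebra.TensorProduct.map f f).toLinearMap ∘ₗ
        ((univForms k M).subtype ∘ₗ β) ∘ₗ augProj k H) * toConv (tinr k P P ∘ₗ Φ)).ofConv := by
    ext x
    exact h₂ _ _
  have h₄ (t : H ⊗[k] H) : TensorProduct.map Φ' Φ t =
      mul' k _ (TensorProduct.map (tinl k P P ∘ₗ Φ') (tinr k P P ∘ₗ Φ) t) := by
    induction t using TensorProduct.induction_on with
    | zero => simp
    | add x y hx hy => rw [map_add, map_add, map_add, ← hx, ← hy]
    | tmul x y => simp
  -- As Φ' is a convolution inverse of Φ, the term uv ⊗ 1 of the differential vanishes on ker ε, and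
  -- Φ'(h₁) d Φ(h₂) is the tensor Φ'(h₁) ⊗ Φ(h₂).
  have h₅ : mul' k P (TensorProduct.map Φ' Φ (comul (R := k) (h : H))) = 0 := by
    have := congrArg (fun f => f (h : H)) hΦ
    simpa [hh] using this
  simp only [connOfForm, LinearMap.comp_apply, LinearMap.add_apply, Submodule.coe_add,
    Submodule.subtype_apply, univForms.coe_mulD, h₅, TensorProduct.zero_tmul, sub_zero]
  rw [h₁, h₃, comp_augExt_sub_one, h₄]
  change (toConv (tinl k P P ∘ₗ Φ') * ((_ - 1) * toConv (tinr k P P ∘ₗ Φ)) +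
    toConv (tinl k P P ∘ₗ Φ') * toConv (tinr k P P ∘ₗ Φ) : WithConv (H →ₗ[k] P ⊗[k] P)) (h : H) = _
  congr 2
  -- The −1 from extending β by zero cancels the differential term exactly.
  rw [sub_mul, mul_sub, one_mul, sub_add_cancel]

end ConnOfForm

/-! ### Left and right colinear maps from H to the biproduct -/

namespace Biproduct

section

open WithConv LinearMap Algebra.TensorProduct BraidedGroup

variable {k H B : Type*} [Field k] [Ring H] [HopfAlgebra k H] [Ring B] [Algebra k B]
  [Coalgebra k B] [CrossedModule k H B] [BraidedGroup k H B]

/-- In b₁ b₂⁽¹⁾ ⊗ b₂⁽²⁾ the projection replaces b₁ by ε(b₁), and the counit axiom leaves the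
coaction of b. So the crossed module coaction of H on B is induced from the coproduct of P. -/
theorem homogLeftCoact_incl (b : B) : homogLeftCoact (proj k H B) (incl k H B b) =
    Algebra.TensorProduct.map (AlgHom.id k H) (incl k H B) (coact (k := k) b) := by
  have h (c : B) : Algebra.TensorProduct.map (projHom k H B) (AlgHom.id k _) (coactP k H B c) =
      Algebra.TensorProduct.map (AlgHom.id k H) (incl k H B) (coact (k := k) c) := by
    rw [coactP_apply]
    induction coact (k := k) (H := H) c using TensorProduct.induction_on with
    | zero => simp
    | add x y hx hy => simp only [map_add, hx, hy]
    | tmul x y => simp [projHom_inclH]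
  have h' (t : B ⊗[k] B) : Algebra.TensorProduct.map (projHom k H B) (AlgHom.id k _)
      (comulAux k H B t) =
      Algebra.TensorProduct.map (AlgHom.id k H) (incl k H B)
        (coact (k := k) (counitLeft k B t)) := by
    induction t using TensorProduct.induction_on with
    | zero => simp
    | add x y hx hy => simp only [map_add, hx, hy]
    | tmul x y =>
      rw [comulAux_tmul, map_mul, h, counitLeft_tmul, map_smul, map_smul, map_tmul, projHom_incl,
        map_one, ← TensorProduct.smul_tmul', smul_mul_assoc, ← Algebra.TensorProduct.one_def,
        one_mul]
  have := h' (comul (R := k) b)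
  rw [counitLeft_comul] at this
  rw [← this]
  change Algebra.TensorProduct.map (projHom k H B) (AlgHom.id k _)
    (comul (R := k) (incl k H B b)) = _
  rw [comul_incl]
  rfl

variable (k H B) in
theorem toConv_comul_inclH : toConv (comul (R := k) ∘ₗ (inclH k H B).toLinearMap) =
    toConv (tinl k (Biproduct k H B) (Biproduct k H B) ∘ₗ (inclH k H B).toLinearMap) *
    toConv (tinr k (Biproduct k H B) (Biproduct k H B) ∘ₗ (inclH k H B).toLinearMap) := by
  have := toConv_algHom_comp_convMul (Algebra.TensorProduct.map (inclH k H B) (inclH k H B))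
    (toConv (tinl k H H)) (toConv (tinr k H H))
  rw [← toConv_comul] at this
  have h : comul (R := k) ∘ₗ (inclH k H B).toLinearMap =
      (Algebra.TensorProduct.map (inclH k H B) (inclH k H B)).toLinearMap ∘ₗ comul (R := k) :=
    LinearMap.ext comul_inclH
  rw [h]
  refine Eq.trans this ?_
  congr 2

variable (k H B) in
theorem toConv_homogLeftCoact_inclH :
    toConv ((homogLeftCoact (proj k H B)).toLinearMap ∘ₗ (inclH k H B).toLinearMap) =
    toConv (tinl k H (Biproduct k H B)) *
    toConv (tinr k H (Biproduct k H B) ∘ₗ (inclH k H B).toLinearMap) := by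
  have := toConv_algHom_comp_convMul (Algebra.TensorProduct.map (projHom k H B)
      (AlgHom.id k (Biproduct k H B)))
    (toConv (tinl k (Biproduct k H B) (Biproduct k H B) ∘ₗ (inclH k H B).toLinearMap))
    (toConv (tinr k (Biproduct k H B) (Biproduct k H B) ∘ₗ (inclH k H B).toLinearMap))
  rw [← toConv_comul_inclH] at this
  refine Eq.trans this ?_
  congr 2 <;> (ext; simp [projHom_inclH])

variable (k H B) in
theorem toConv_homogCoact_inclH :
    toConv ((homogCoact (proj k H B)).toLinearMap ∘ₗ (inclH k H B).toLinearMap) =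
    toConv (tinl k (Biproduct k H B) H ∘ₗ (inclH k H B).toLinearMap) *
    toConv (tinr k (Biproduct k H B) H) := by
  have := toConv_algHom_comp_convMul (Algebra.TensorProduct.map
      (AlgHom.id k (Biproduct k H B)) (projHom k H B))
    (toConv (tinl k (Biproduct k H B) (Biproduct k H B) ∘ₗ (inclH k H B).toLinearMap))
    (toConv (tinr k (Biproduct k H B) (Biproduct k H B) ∘ₗ (inclH k H B).toLinearMap))
  rw [← toConv_comul_inclH] at this
  refine Eq.trans this ?_
  congr 2 <;> (ext; simp [projHom_inclH])

/-- The map `h ↦ γ(h₁) ⊗ h₂` to the biproduct. -/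
noncomputable def crossLift (γ : H →ₗ[k] B) : H →ₗ[k] Biproduct k H B :=
  (toConv ((incl k H B).toLinearMap ∘ₗ γ) * toConv (inclH k H B).toLinearMap).ofConv

theorem toConv_crossLift (γ : H →ₗ[k] B) : toConv (crossLift γ) =
    toConv ((incl k H B).toLinearMap ∘ₗ γ) * toConv (inclH k H B).toLinearMap := rfl

theorem toConv_algHom_crossLift {A : Type*} [Ring A] [Algebra k A] (φ : Biproduct k H B →ₐ[k] A)
    (γ : H →ₗ[k] B) : toConv (φ.toLinearMap ∘ₗ crossLift γ) =
    toConv (φ.toLinearMap ∘ₗ (incl k H B).toLinearMap ∘ₗ γ) *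
      toConv (φ.toLinearMap ∘ₗ (inclH k H B).toLinearMap) :=
  toConv_algHom_comp_convMul φ _ _

/-- The maps `γ(h₁) ⊗ h₂` are right colinear. -/
theorem crossLift_rightColinear (γ : H →ₗ[k] B) :
    toConv ((homogCoact (proj k H B)).toLinearMap ∘ₗ crossLift γ) =
      toConv (tinl k (Biproduct k H B) H ∘ₗ crossLift γ) * toConv (tinr k (Biproduct k H B) H) := by
  rw [toConv_algHom_crossLift, toConv_homogCoact_inclH, toConv_algHom_crossLift, mul_assoc]
  congr 2
  ext h
  exact homogCoact_incl (γ h)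

variable (k H B) in
/-- The projection `b ⊗ h ↦ b ε(h)`. -/
noncomputable def retract : Biproduct k H B →ₗ[k] B :=
  (TensorProduct.rid k B).toLinearMap ∘ₗ (counit (R := k) (A := H)).lTensor B ∘ₗ
    (of k H B).symm.toLinearMap

theorem retract_of (b : B) (h : H) :
    retract k H B (of k H B (b ⊗ₜ h)) = counit (R := k) h • b := by
  simp [retract]

theorem retract_incl (b : B) : retract k H B (incl k H B b) = b := by
  rw [incl_apply, retract_of, Bialgebra.counit_one, one_smul]

theorem counit_retract (x : Biproduct k H B) :
    counit (R := k) (retract k H B x) = counit (R := k) x := by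
  induction x using induction_on with
  | hz => simp
  | ha x y hx hy => simp only [map_add, hx, hy]
  | ht b h =>
    rw [retract_of, of_tmul, Bialgebra.counit_mul, counit_incl, counit_inclH, map_smul, mul_comm,
      smul_eq_mul]

theorem retract_mul_inclH (x : Biproduct k H B) (h : H) :
    retract k H B (x * inclH k H B h) = counit (R := k) h • retract k H B x := by
  induction x using induction_on with
  | hz => simp
  | ha x y hx hy => simp only [map_add, add_mul, smul_add, hx, hy]
  | ht b g =>
    rw [of_tmul, mul_assoc, ← map_mul, ← of_tmul, ← of_tmul, retract_of, retract_of,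
      Bialgebra.counit_mul, mul_comm, mul_smul]

/-- Applying the counit to the H leg of γ(h₁) ⊗ h₂ makes the factor j into the convolution unit. In
particular γ is determined by the lifted map. -/
theorem retract_crossLift (γ : H →ₗ[k] B) : retract k H B ∘ₗ crossLift γ = γ := by
  have : toConv (retract k H B ∘ₗ crossLift γ) = toConv γ * 1 := by
    refine toConv_comp_convMul fun x y => ?_
    change retract k H B (incl k H B (γ x) * inclH k H B y) = γ x * algebraMap k B (counit y)
    rw [retract_mul_inclH, retract_incl, Algebra.algebraMap_eq_smul_one, mul_smul_comm, mul_one]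
  rw [mul_one] at this
  exact toConv_injective this

/-- Right colinear maps are of the form `γ(h₁) ⊗ h₂`. -/
theorem eq_crossLift {p : H →ₗ[k] Biproduct k H B}
    (hp : toConv ((homogCoact (proj k H B)).toLinearMap ∘ₗ p) =
      toConv (tinl k (Biproduct k H B) H ∘ₗ p) * toConv (tinr k (Biproduct k H B) H)) :
    p = crossLift (retract k H B ∘ₗ p) := by
  -- F sends (b ⊗ h) ⊗ g to ε(h) b ⊗ g, hence recovers x from Δ_R x. Applied to the colinearity
  -- equation it gives p(h) on the left and r(p(h₁)) ⊗ h₂ on the right, r being `retract`.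
  let F : Biproduct k H B ⊗[k] H →ₗ[k] Biproduct k H B :=
    LinearMap.mul' k _ ∘ₗ TensorProduct.map ((incl k H B).toLinearMap ∘ₗ retract k H B)
      (inclH k H B).toLinearMap
  have hF : F ∘ₗ (homogCoact (proj k H B)).toLinearMap = LinearMap.id := by
    ext x
    induction x using induction_on with
    | hz => simp
    | ha x y hx hy => simp only [map_add, hx, hy]
    | ht b h =>
      have (t : H ⊗[k] H) : F ((incl k H B b ⊗ₜ 1) * (inclH k H B).toLinearMap.rTensor H t) =
          incl k H B b * inclH k H B (TensorProduct.lid k H ((counit (R := k)).rTensor H t)) := by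
        induction t using TensorProduct.induction_on with
        | zero => simp
        | add x y hx hy => simp only [map_add, mul_add, hx, hy]
        | tmul x y => simp [F, ← of_tmul, retract_of]
      rw [LinearMap.comp_apply, AlgHom.toLinearMap_apply, of_tmul, map_mul, homogCoact_incl,
        homogCoact_inclH, this]
      simp
  apply toConv_injective
  have h := congrArg (fun f => toConv (F ∘ₗ f.ofConv)) hp
  dsimp only at h
  rw [← LinearMap.comp_assoc, hF, LinearMap.id_comp] at h
  refine h.trans (toConv_comp_convMul fun x y => ?_)
  change F ((p x ⊗ₜ 1) * (1 ⊗ₜ y)) = _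
  simp [F]

/-- The intertwiners of the left adjoint coaction correspond to the left colinear maps. -/
theorem intertwiner_iff_leftColinear (γ : H →ₗ[k] B) :
    toConv (coact (k := k) (H := H) ∘ₗ γ) = toConv (tinl k H B) * toConv (tinr k H B ∘ₗ γ) *
        toConv (tinl k H B ∘ₗ HopfAlgebra.antipode k) ↔
    toConv ((homogLeftCoact (proj k H B)).toLinearMap ∘ₗ crossLift γ) =
      toConv (tinl k H (Biproduct k H B)) * toConv (tinr k H (Biproduct k H B) ∘ₗ crossLift γ) := by
  let φ : H ⊗[k] B →ₐ[k] H ⊗[k] Biproduct k H B :=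
    Algebra.TensorProduct.map (AlgHom.id k H) (incl k H B)
  -- The inclusion of B is split by `retract`, so the intertwining equation may be tested inside H ⊗
  -- P.
  have hφ : Function.Injective fun f : H →ₗ[k] H ⊗[k] B => toConv (φ.toLinearMap ∘ₗ f) := by
    intro f g h
    have hr : (retract k H B).lTensor H ∘ₗ φ.toLinearMap = LinearMap.id := by
      ext x y
      simp [φ, retract_incl]
    have := congrArg (fun f => (retract k H B).lTensor H ∘ₗ f.ofConv) h
    simpa only [← LinearMap.comp_assoc, hr, LinearMap.id_comp] using this
  have h₁ : toConv (φ.toLinearMap ∘ₗ (toConv (tinl k H B) * toConv (tinr k H B ∘ₗ γ) *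
        toConv (tinl k H B ∘ₗ HopfAlgebra.antipode k)).ofConv) =
      toConv (tinl k H (Biproduct k H B)) *
        toConv (tinr k H (Biproduct k H B) ∘ₗ (incl k H B).toLinearMap ∘ₗ γ) *
        toConv (tinl k H (Biproduct k H B) ∘ₗ HopfAlgebra.antipode k) := by
    rw [toConv_algHom_comp_convMul, toConv_algHom_comp_convMul]
    congr 2
  have h₂ : toConv ((homogLeftCoact (proj k H B)).toLinearMap ∘ₗ (incl k H B).toLinearMap ∘ₗ γ) =
      toConv (φ.toLinearMap ∘ₗ coact (k := k) (H := H) ∘ₗ γ) := by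
    ext h
    exact homogLeftCoact_incl (γ h)
  rw [toConv_algHom_crossLift, toConv_homogLeftCoact_inclH, toConv_algHom_crossLift, h₂]
  trans toConv (φ.toLinearMap ∘ₗ coact (k := k) (H := H) ∘ₗ γ) =
      toConv (tinl k H (Biproduct k H B)) *
        toConv (tinr k H (Biproduct k H B) ∘ₗ (incl k H B).toLinearMap ∘ₗ γ) *
        toConv (tinl k H (Biproduct k H B) ∘ₗ HopfAlgebra.antipode k)
  · rw [← h₁]
    constructor
    · intro h
      rw [← h]
    · intro h
      exact congrArg toConv (hφ h)
  -- The left colinearity equation is the intertwining equation convolved on the right by h₁ ⊗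
  -- j(h₂). This factor is invertible, so one passes between the two by multiplying by it or by its
  -- inverse.
  · have ha := conv_antipode_mul (includeLeft : H →ₐ[k] H ⊗[k] Biproduct k H B)
    have ha' := conv_mul_antipode (includeLeft : H →ₐ[k] H ⊗[k] Biproduct k H B)
    have hd := conv_mul_antipode
      ((includeRight : Biproduct k H B →ₐ[k] H ⊗[k] Biproduct k H B).comp (inclH k H B))
    rw [AlgHom.comp_toLinearMap] at hd
    constructor
    · intro h
      rw [h]
      simp only [mul_assoc]
      rw [← mul_assoc (toConv (tinl k H (Biproduct k H B) ∘ₗ _)), ha, one_mul]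
    · intro h
      have := congrArg (fun f => f * toConv ((tinr k H (Biproduct k H B) ∘ₗ
        (inclH k H B).toLinearMap) ∘ₗ HopfAlgebra.antipode k) *
          toConv (tinl k H (Biproduct k H B) ∘ₗ HopfAlgebra.antipode k)) h
      simp only [mul_assoc] at this ⊢
      simpa only [← mul_assoc (toConv (tinr k H (Biproduct k H B) ∘ₗ (inclH k H B).toLinearMap)),
        hd, one_mul, ha', mul_one] using this

end

end Biproduct

/-! ### Left-invariant and strong connections on a homogeneous bundle -/

section HomogeneousConnections

open WithConv LinearMap Algebra.TensorProduct

variable {k P H : Type*} [Field k] [Ring P] [HopfAlgebra k P] [Ring H] [HopfAlgebra k H]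

theorem galois_mul_right (t : P ⊗[k] P) (y : P) :
    galois k P (t * (1 ⊗ₜ y)) = galois k P t * comul y := by
  induction t using TensorProduct.induction_on with
  | zero => simp
  | add x y hx hy => simp only [map_add, add_mul, hx, hy]
  | tmul u v => simp [galois_tmul, mul_assoc]

theorem counitLeft_mul_left (u : P) (t : P ⊗[k] P) :
    counitLeft k P ((u ⊗ₜ 1) * t) = counit (R := k) u • counitLeft k P t := by
  induction t using TensorProduct.induction_on with
  | zero => simp
  | add x y hx hy => simp only [map_add, mul_add, smul_add, hx, hy]
  | tmul x y => simp [counitLeft_tmul, mul_smul]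

/-- The canonical connection of a splitting is a connection. -/
theorem IsSplitting.isConnection {π : P →ₐc[k] H} {i : augKer k H →ₗ[k] augKer k P}
    (hi : IsSplitting π i) : IsConnection (homogCoact π) (canonicalConn i) where
  canMap_eq h := by
    rw [canMap_homogCoact, coe_canonicalConn, galois_leftInvariant antipode_mul_id, lTensor_tmul]
    exact congrArg _ (hi.proj_eq h)
  equivariant h := by
    rw [coe_canonicalConn, rightTensorCoact_leftInvariant, hi.covariant, ← rTensor_comp_apply]
    congr 2
    ext x : 1
    exact (coe_canonicalConn i _).symm

/-- The values are of the form κ(p), and such tensors are invariant whatever i is. -/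
theorem isLeftInvariant_canonicalConn (i : augKer k H →ₗ[k] augKer k P) :
    IsLeftInvariant (canonicalConn i) := fun h => by
  rw [leftRegCoact_eq_iff, coe_canonicalConn, counitLeft_leftInvariant_antipode]

/-- The map `h ↦ (ε ⊗ id) ω(h)` defined by a connection. -/
noncomputable def counitForm (ω : augKer k H →ₗ[k] univForms k P) : augKer k H →ₗ[k] augKer k P :=
  (counitLeft k P ∘ₗ (univForms k P).subtype ∘ₗ ω).codRestrict _ fun h => by
    change counit (R := k) (counitLeft k P (ω h : P ⊗[k] P)) = 0
    rw [counit_counitLeft Bialgebra.counit_mul,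
      show mul' k P (ω h : P ⊗[k] P) = 0 from (ω h).2, map_zero]

/-- A left-invariant form is the canonical connection of its splitting. -/
theorem canonicalConn_counitForm {ω : augKer k H →ₗ[k] univForms k P} (hω : IsLeftInvariant ω) :
    canonicalConn (counitForm ω) = ω := by
  ext h : 2
  rw [coe_canonicalConn]
  exact ((leftRegCoact_eq_iff _).1 (hω h)).symm

theorem counitForm_canonicalConn (i : augKer k H →ₗ[k] augKer k P) :
    counitForm (canonicalConn i) = i := by
  ext h
  change counitLeft k P (canonicalConn i h : P ⊗[k] P) = i h
  rw [coe_canonicalConn, counitLeft_leftInvariant_antipode]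

/-- Write ω = κ ∘ i. Equivariance then reads (κ ⊗ id) of the projected Ad of i, and ε ⊗ id, a left
inverse of κ, removes κ from both sides. -/
theorem counitForm_covariant {π : P →ₐc[k] H} {ω : augKer k H →ₗ[k] univForms k P}
    (hc : IsConnection (homogCoact π) ω) (hω : IsLeftInvariant ω) (h : augKer k H) :
    (π : P →ₐ[k] H).toLinearMap.lTensor P (adR k P (counitForm ω h : P)) =
      ((augKer k P).subtype ∘ₗ counitForm ω ∘ₗ augProj k H).rTensor H (adR k H h) := by
  have h₁ := hc.equivariant h
  rw [show (ω h : P ⊗[k] P) = leftInvariant (HopfAlgebra.antipode k) (counitForm ω h : P) from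
    (leftRegCoact_eq_iff _).1 (hω h), rightTensorCoact_leftInvariant] at h₁
  have h₂ := congrArg ((counitLeft k P).rTensor H) h₁
  rw [← rTensor_comp_apply, ← rTensor_comp_apply,
    show counitLeft k P ∘ₗ leftInvariant (HopfAlgebra.antipode k) = LinearMap.id from
      LinearMap.ext counitLeft_leftInvariant_antipode, rTensor_id, LinearMap.id_apply] at h₂
  exact h₂

/-- Since χ(d u) = Δ_R u − u ⊗ 1 and π_ε kills 1, only Δ_R u contributes. -/
theorem coe_connProj_d (δ : P →ₐ[k] P ⊗[k] H) (ω : augKer k H →ₗ[k] univForms k P) (u : P) :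
    (connProj δ ω (univForms.d k P u) : P ⊗[k] P) = mul' k _ (TensorProduct.map (tinl k P P)
      ((univForms k P).subtype ∘ₗ ω ∘ₗ augProj k H) (δ u)) := by
  have h₁ (t : P ⊗[k] H) : (univForms.lmul k P ((ω ∘ₗ augProj k H).lTensor P t) : P ⊗[k] P) =
      mul' k _ (TensorProduct.map (tinl k P P)
        ((univForms k P).subtype ∘ₗ ω ∘ₗ augProj k H) t) := by
    induction t using TensorProduct.induction_on with
    | zero => simp
    | add x y hx hy => simp only [map_add, Submodule.coe_add, hx, hy]
    | tmul x y => simp [univForms.coe_lmul]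
  have h₂ : canMap δ (univForms.d k P u : P ⊗[k] P) = δ u - u ⊗ₜ 1 := by
    rw [univForms.coe_d, map_sub]
    have (t : P ⊗[k] H) : (mul' k P).rTensor H ((TensorProduct.assoc k P P H).symm (1 ⊗ₜ t)) =
        t := by
      induction t using TensorProduct.induction_on with
      | zero => simp
      | add x y hx hy => simp only [TensorProduct.tmul_add, map_add, hx, hy]
      | tmul x y => simp
    simp [canMap, this, Algebra.TensorProduct.one_def]
  change (univForms.lmul k P ((ω ∘ₗ augProj k H).lTensor P
    (canMap δ (univForms.d k P u : P ⊗[k] P))) : P ⊗[k] P) = _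
  rw [h₁, h₂, map_sub, map_sub]
  simp [augProj_one]

/-- A test for strongness: a form in (Ω¹M)P has its left leg in M, and there π agrees with ε(·)1. -/
theorem rTensor_eq_of_mem_strongHor {π : P →ₐc[k] H} {t : univForms k P}
    (ht : t ∈ strongHor (homogCoact π)) :
    (π : P →ₐ[k] H).toLinearMap.rTensor P (t : P ⊗[k] P) =
      1 ⊗ₜ counitLeft k P (t : P ⊗[k] P) := by
  -- Apply ε ⊗ id to Δ_R m = m ⊗ 1: the left side becomes π(m).
  have hπ (m : base (homogCoact π)) : π (m : P) = counit (R := k) (m : P) • (1 : H) := by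
    have h : homogCoact π (m : P) = (m : P) ⊗ₜ 1 := m.2
    have h₁ := congrArg (fun t => TensorProduct.lid k H ((counit (R := k)).rTensor H t)) h
    have h₂ (s : P ⊗[k] P) : TensorProduct.lid k H ((counit (R := k)).rTensor H
        (Algebra.TensorProduct.map (AlgHom.id k P) (π : P →ₐ[k] H) s)) =
        π (counitLeft k P s) := by
      induction s using TensorProduct.induction_on with
      | zero => simp
      | add x y hx hy => simp only [map_add, hx, hy]
      | tmul x y => simp [counitLeft_tmul]
    have h₃ := h₂ (comul (R := k) (m : P))
    rw [counitLeft_comul] at h₃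
    rw [← h₃]
    refine Eq.trans h₁ ?_
    simp
  obtain ⟨s, rfl⟩ := ht
  rw [LinearMap.comp_apply]
  induction s using TensorProduct.induction_on with
  | zero => simp
  | add x y hx hy => simp only [map_add, Submodule.coe_add, TensorProduct.tmul_add, hx, hy]
  | tmul η y =>
    rw [rTensor_tmul, univForms.coe_rmul, univForms.coe_map]
    induction (η : base (homogCoact π) ⊗[k] base (homogCoact π)) using
      TensorProduct.induction_on with
    | zero => simp
    | add x y hx hy => simp only [map_add, add_mul, TensorProduct.tmul_add, hx, hy]
    | tmul m m' =>
      simp [counitLeft_tmul, hπ, TensorProduct.smul_tmul]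

end HomogeneousConnections

/-! ### Strong left-invariant connections on the biproduct -/

namespace Biproduct

section

open WithConv LinearMap Algebra.TensorProduct BraidedGroup

variable {k H B : Type*} [Field k] [Ring H] [HopfAlgebra k H] [Ring B] [Algebra k B]
  [Coalgebra k B] [CrossedModule k H B] [BraidedGroup k H B]

/-- Compares the two canonical maps: on B ⊗ B that of P is that of B followed by b ⊗ c ↦ b c⁽¹⁾ ⊗
c⁽²⁾, because the coproduct of P on B is the braided one followed by this map. It links the two
antipodes without a formula for S on P. -/
theorem galois_map_incl (t : B ⊗[k] B) : galois k (Biproduct k H B)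
    (Algebra.TensorProduct.map (incl k H B) (incl k H B) t) =
      comulAux k H B (galois k B t) := by
  have h (u : B) (r : B ⊗[k] B) : comulAux k H B ((u ⊗ₜ 1) * r) =
      (incl k H B u ⊗ₜ 1) * comulAux k H B r := by
    induction r using TensorProduct.induction_on with
    | zero => simp
    | add x y hx hy => simp only [map_add, mul_add, hx, hy]
    | tmul x y => simp [comulAux_tmul, ← mul_assoc]
  induction t using TensorProduct.induction_on with
  | zero => simp
  | add x y hx hy => simp only [map_add, hx, hy]
  | tmul x y => rw [map_tmul, galois_tmul, comul_incl, galois_tmul, h]; rfl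

theorem galois_map_incl_leftInvariant (b : B) : galois k (Biproduct k H B)
    (Algebra.TensorProduct.map (incl k H B) (incl k H B)
      (leftInvariant (bantipode (k := k) H) b)) = coactP k H B b := by
  rw [galois_map_incl, galois_leftInvariant (bantipode_mul_id k H B), comulAux_tmul, map_one,
    ← Algebra.TensorProduct.one_def, one_mul]

/-- The left-invariant forms of the map `γ(h₁) ⊗ h₂` in terms of the forms
`S̲ γ(h)₁ d γ(h)₂` on `B`. -/
theorem leftInvariant_crossLift {γ : H →ₗ[k] B}
    (hγ : toConv (coact (k := k) (H := H) ∘ₗ γ) = toConv (tinl k H B) *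
      toConv (tinr k H B ∘ₗ γ) * toConv (tinl k H B ∘ₗ HopfAlgebra.antipode k)) (h : H) :
    leftInvariant (HopfAlgebra.antipode k) (crossLift γ h) =
      (toConv (tinl k (Biproduct k H B) (Biproduct k H B) ∘ₗ
          (inclH k H B).toLinearMap ∘ₗ HopfAlgebra.antipode k) *
        (toConv ((Algebra.TensorProduct.map (incl k H B) (incl k H B)).toLinearMap ∘ₗ
          leftInvariant (bantipode (k := k) H) ∘ₗ γ) *
        toConv (tinr k (Biproduct k H B) (Biproduct k H B) ∘ₗ (inclH k H B).toLinearMap))) h := by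
  let P := Biproduct k H B
  let j := (inclH k H B).toLinearMap
  let X : WithConv (H →ₗ[k] P ⊗[k] P) := toConv
    ((Algebra.TensorProduct.map (incl k H B) (incl k H B)).toLinearMap ∘ₗ
      leftInvariant (bantipode (k := k) H) ∘ₗ γ)
  -- The canonical map sends the form of γ(h) on B to γ(h)⁽¹⁾ ⊗ γ(h)⁽²⁾, which the intertwining
  -- property rewrites as j(h₁ S h₃) ⊗ γ(h₂).
  have h₁ : toConv (galois k P ∘ₗ X.ofConv) = toConv (tinl k P P ∘ₗ j) *
      toConv (tinr k P P ∘ₗ (incl k H B).toLinearMap ∘ₗ γ) *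
      toConv (tinl k P P ∘ₗ j ∘ₗ HopfAlgebra.antipode k) := by
    let φ := Algebra.TensorProduct.map (inclH k H B) (incl k H B)
    have e : toConv (galois k P ∘ₗ X.ofConv) =
        toConv (φ.toLinearMap ∘ₗ coact (k := k) (H := H) ∘ₗ γ) := by
      ext x
      exact galois_map_incl_leftInvariant (γ x)
    rw [e, ← ofConv_toConv (coact (k := k) (H := H) ∘ₗ γ), hγ, toConv_algHom_comp_convMul,
      toConv_algHom_comp_convMul]
    congr 2
  have h₂ : toConv (galois k P ∘ₗ (X * toConv (tinr k P P ∘ₗ j)).ofConv) =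
      toConv (galois k P ∘ₗ X.ofConv) * toConv (comul (R := k) ∘ₗ j) :=
    toConv_comp_convMul fun x y => galois_mul_right _ _
  have h₃ : toConv (galois k P ∘ₗ (toConv (tinl k P P ∘ₗ j ∘ₗ HopfAlgebra.antipode k) *
        (X * toConv (tinr k P P ∘ₗ j))).ofConv) =
      toConv (tinl k P P ∘ₗ j ∘ₗ HopfAlgebra.antipode k) *
        toConv (galois k P ∘ₗ (X * toConv (tinr k P P ∘ₗ j)).ofConv) :=
    toConv_comp_convMul fun x y => galois_mul _ _
  have h₄ := conv_antipode_mul ((includeLeft : P →ₐ[k] P ⊗[k] P).comp (inclH k H B))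
  rw [AlgHom.comp_toLinearMap, LinearMap.comp_assoc] at h₄
  have h₅ : toConv (galois k P ∘ₗ (toConv (tinl k P P ∘ₗ j ∘ₗ HopfAlgebra.antipode k) *
        (X * toConv (tinr k P P ∘ₗ j))).ofConv) = toConv (tinr k P P ∘ₗ crossLift γ) := by
    -- The canonical map takes the right-hand side to j(S h₁) j(h₂) j(S h₄) j(h₅) ⊗ γ(h₃) j(h₆).
    -- Both pairs in the left leg cancel, leaving 1 ⊗ γ(h₁) j(h₂), the image of κ(γ(h₁) ⊗ h₂).
    rw [h₃, h₂, h₁, toConv_comul_inclH, toConv_algHom_crossLift]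
    simp only [mul_assoc]
    rw [← mul_assoc (toConv (tinl k P P ∘ₗ j ∘ₗ HopfAlgebra.antipode k)) (toConv (tinl k P P ∘ₗ j)),
      h₄, one_mul]
    rw [← mul_assoc (toConv (tinl k P P ∘ₗ j ∘ₗ HopfAlgebra.antipode k)) (toConv (tinl k P P ∘ₗ j)),
      h₄, one_mul]
  exact (eq_leftInvariant id_mul_antipode (congrArg (fun f => f h) h₅)).symm

theorem coe_biproductConn (β : augKer k H →ₗ[k] univForms k B) (h : augKer k H) :
    (biproductConn β h : Biproduct k H B ⊗[k] Biproduct k H B) =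
      (toConv (tinl k (Biproduct k H B) (Biproduct k H B) ∘ₗ
          (inclH k H B).toLinearMap ∘ₗ HopfAlgebra.antipode k) *
        (toConv ((Algebra.TensorProduct.map (incl k H B) (incl k H B)).toLinearMap ∘ₗ
          augExt ((univForms k B).subtype ∘ₗ β)) *
        toConv (tinr k (Biproduct k H B) (Biproduct k H B) ∘ₗ (inclH k H B).toLinearMap))) h :=
  coe_connOfForm _ _ _ (conv_antipode_mul (inclH k H B)) β h

theorem crossLift_one {γ : H →ₗ[k] B} (hγ : γ 1 = 1) : crossLift γ 1 = 1 := by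
  change (toConv _ * toConv _ : WithConv (H →ₗ[k] Biproduct k H B)) 1 = 1
  rw [convMul_apply_one]
  simp [hγ]

theorem coe_splittingOfMap (γ : augKer k H →ₗ[k] augKer k B) (h : augKer k H) :
    (splittingOfMap γ h : Biproduct k H B) =
      crossLift (augExt ((augKer k B).subtype ∘ₗ γ)) (h : H) := by
  have h₁ (f : H →ₗ[k] B) (t : H ⊗[k] H) : of k H B (f.rTensor H t) = mul' k _
      (TensorProduct.map ((incl k H B).toLinearMap ∘ₗ f) (inclH k H B).toLinearMap t) := by
    induction t using TensorProduct.induction_on with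
    | zero => simp
    | add x y hx hy => simp only [map_add, hx, hy]
    | tmul x y => simp [of_tmul]
  have h₂ := comp_augExt_sub_one (incl k H B) ((augKer k B).subtype ∘ₗ γ)
  have h₃ : toConv (crossLift (augExt ((augKer k B).subtype ∘ₗ γ))) =
      toConv ((incl k H B).toLinearMap ∘ₗ ((augKer k B).subtype ∘ₗ γ) ∘ₗ augProj k H) *
        toConv (inclH k H B).toLinearMap + toConv (inclH k H B).toLinearMap := by
    rw [h₂, sub_mul, one_mul, sub_add_cancel, toConv_crossLift]
  refine Eq.trans ?_ (congrArg (fun f => f (h : H)) h₃).symm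
  change of k H B (((augKer k B).subtype ∘ₗ γ ∘ₗ augProj k H).rTensor H (comul (R := k) (h : H)) +
    1 ⊗ₜ (h : H)) = _
  rw [map_add, h₁]
  rfl

/-- The summand 1 ⊗ h in the splitting is what the unital extension of γ contributes, so the
extended splitting is the single convolution product γ * j. -/
theorem augExt_splittingOfMap (γ : augKer k H →ₗ[k] augKer k B) :
    augExt ((augKer k (Biproduct k H B)).subtype ∘ₗ splittingOfMap γ) =
      crossLift (augExt ((augKer k B).subtype ∘ₗ γ)) :=
  (augExt_unique (crossLift_one (augExt_one _)) fun x => (coe_splittingOfMap γ x).symm).symm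

theorem mem_adIntertwiners_iff (γ : augKer k H →ₗ[k] augKer k B) : γ ∈ adIntertwiners k H B ↔
    toConv (coact (k := k) (H := H) ∘ₗ augExt ((augKer k B).subtype ∘ₗ γ)) =
      toConv (tinl k H B) * toConv (tinr k H B ∘ₗ augExt ((augKer k B).subtype ∘ₗ γ)) *
        toConv (tinl k H B ∘ₗ HopfAlgebra.antipode k) :=
  intertwinesAd_iff coact_one _

/-- The connection that corresponds to `γ` is the canonical connection of its splitting. -/
theorem biproductConn_formOfMap {γ : augKer k H →ₗ[k] augKer k B}
    (hγ : γ ∈ adIntertwiners k H B) :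
    biproductConn (formOfMap γ) = canonicalConn (P := Biproduct k H B) (splittingOfMap γ) := by
  have h₁ : augExt ((univForms k B).subtype ∘ₗ formOfMap γ) =
      leftInvariant (bantipode (k := k) H) ∘ₗ augExt ((augKer k B).subtype ∘ₗ γ) := by
    rw [comp_augExt _ _ (leftInvariant_bantipode_one k H B)]
    congr 1
    exact LinearMap.ext (coe_formOfMap γ)
  ext h : 2
  rw [coe_biproductConn, h₁, coe_canonicalConn, coe_splittingOfMap,
    leftInvariant_crossLift ((mem_adIntertwiners_iff γ).1 hγ)]

theorem adR_one {A : Type*} [Ring A] [HopfAlgebra k A] : adR k A 1 = 1 := by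
  simp [adR, Algebra.TensorProduct.one_def]

theorem lTensor_adR_one {P : Type*} [Ring P] [HopfAlgebra k P] (π : P →ₐc[k] H) :
    ((π : P →ₐ[k] H).toLinearMap.lTensor P ∘ₗ adR k P) 1 = 1 := by
  simp [adR_one, Algebra.TensorProduct.one_def]

/-- The map `γ(π_ε h₁) ⊗ h₂ + 1 ⊗ h` is an `Ad`-covariant splitting. -/
theorem isSplitting_splittingOfMap {γ : augKer k H →ₗ[k] augKer k B}
    (hγ : γ ∈ adIntertwiners k H B) : IsSplitting (proj k H B) (splittingOfMap γ) where
  proj_eq h := by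
    rw [coe_splittingOfMap]
    have h₁ := toConv_algHom_crossLift (projHom k H B) (augExt ((augKer k B).subtype ∘ₗ γ))
    -- On B the projection is ε(·)1, and γ has values in ker ε; its unital extension projects to the
    -- convolution unit.
    have h₂ : toConv ((projHom k H B).toLinearMap ∘ₗ (incl k H B).toLinearMap ∘ₗ
        augExt ((augKer k B).subtype ∘ₗ γ)) = 1 := by
      refine toConv_injective.eq_iff.mpr (linearMap_ext_augKer ?_ fun x => ?_)
      · simp [augExt_one]
      · have hx : counit (R := k) (x : H) = 0 := x.2
        have hγx : counit (R := k) (γ x : B) = 0 := (γ x).2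
        simp [augExt_coe, projHom_incl, hx, hγx]
    rw [h₂, one_mul] at h₁
    exact (congrArg (fun f => f (h : H)) h₁).trans (projHom_inclH _)
  covariant := by
    have hL := (intertwiner_iff_leftColinear _).1 ((mem_adIntertwiners_iff γ).1 hγ)
    have h := (adR_covariant_iff_rightColinear _ hL).2 (crossLift_rightColinear _)
    rw [← augExt_splittingOfMap] at h
    exact (adR_covariant_iff (lTensor_adR_one (proj k H B)) _).2 h

/-- The projection of a connection on the differentials `d (b ⊗ h)`. -/
theorem coe_connProj_d_mul (ω : augKer k H →ₗ[k] univForms k (Biproduct k H B)) (b : B) (h : H) :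
    (connProj (homogCoact (proj k H B)) ω
      (univForms.d k _ (incl k H B b * inclH k H B h)) : Biproduct k H B ⊗[k] Biproduct k H B) =
    (incl k H B b ⊗ₜ 1) *
      ((toConv (tinl k (Biproduct k H B) (Biproduct k H B) ∘ₗ (inclH k H B).toLinearMap) *
        toConv (augExt ((univForms k (Biproduct k H B)).subtype ∘ₗ ω))) h -
        inclH k H B h ⊗ₜ 1) := by
  let P := Biproduct k H B
  let W : H →ₗ[k] P ⊗[k] P := ((univForms k P).subtype ∘ₗ ω) ∘ₗ augProj k H
  have h₁ (t : H ⊗[k] H) : mul' k _ (TensorProduct.map (tinl k P P) W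
      ((incl k H B b ⊗ₜ 1) * (inclH k H B).toLinearMap.rTensor H t)) =
      (incl k H B b ⊗ₜ 1) * mul' k _ (TensorProduct.map
        (tinl k P P ∘ₗ (inclH k H B).toLinearMap) W t) := by
    induction t using TensorProduct.induction_on with
    | zero => simp
    | add x y hx hy => simp only [map_add, mul_add, hx, hy]
    | tmul x y => simp [← mul_assoc]
  have h₂ : toConv (tinl k P P ∘ₗ (inclH k H B).toLinearMap) * toConv W =
      toConv (tinl k P P ∘ₗ (inclH k H B).toLinearMap) *
        toConv (augExt ((univForms k P).subtype ∘ₗ ω)) -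
      toConv (tinl k P P ∘ₗ (inclH k H B).toLinearMap) := by
    rw [toConv_comp_augProj, mul_sub, mul_one]
  rw [coe_connProj_d, map_mul, homogCoact_incl, homogCoact_inclH]
  refine (h₁ (comul h)).trans ?_
  congr 1
  exact congrArg (fun f => f h) h₂

theorem rmul_map_incl_mem_strongHor (η : univForms k B) (y : Biproduct k H B) :
    univForms.rmul k _ (univForms.map (incl k H B) η ⊗ₜ y) ∈
      strongHor (homogCoact (proj k H B)) := by
  let f : B →ₐ[k] base (homogCoact (proj k H B)) :=
    (incl k H B).codRestrict _ fun b => homogCoact_incl b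
  refine ⟨univForms.map f η ⊗ₜ y, ?_⟩
  rw [LinearMap.comp_apply, rTensor_tmul]
  congr 2
  ext : 1
  rw [univForms.coe_map, univForms.coe_map, univForms.coe_map]
  induction (η : B ⊗[k] B) using TensorProduct.induction_on with
  | zero => simp
  | add x y hx hy => simp only [map_add, hx, hy]
  | tmul x y => rfl

/-- The connections defined by forms on `B` are strong. -/
theorem isStrong_biproductConn (β : augKer k H →ₗ[k] univForms k B) :
    IsStrong (homogCoact (proj k H B)) (biproductConn β) := by
  let P := Biproduct k H B
  let j := (inclH k H B).toLinearMap
  let φ := Algebra.TensorProduct.map (incl k H B) (incl k H B)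
  let X := toConv (φ.toLinearMap ∘ₗ ((univForms k B).subtype ∘ₗ β) ∘ₗ augProj k H)
  have h₁ : toConv (augExt ((univForms k P).subtype ∘ₗ biproductConn β)) =
      toConv (tinl k P P ∘ₗ j ∘ₗ HopfAlgebra.antipode k) *
        (toConv (φ.toLinearMap ∘ₗ augExt ((univForms k B).subtype ∘ₗ β)) *
          toConv (tinr k P P ∘ₗ j)) := by
    refine toConv_injective.eq_iff.mpr (augExt_unique ?_ fun x => (coe_biproductConn β x).symm).symm
    change (toConv _ * (toConv _ * toConv _) : WithConv (H →ₗ[k] P ⊗[k] P)) 1 = 1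
    rw [convMul_apply_one, convMul_apply_one]
    simp [augExt_one, j, φ, Algebra.TensorProduct.one_def]
  have h₂ := conv_mul_antipode ((includeLeft : P →ₐ[k] P ⊗[k] P).comp (inclH k H B))
  rw [AlgHom.comp_toLinearMap, LinearMap.comp_assoc] at h₂
  -- The leading factor j(S h₁) of ω is inverse to j, so j(h₁) ω(h₂) is β(π_ε h₁) j(h₂) plus 1 ⊗
  -- j(h), for the unital extension of ω.
  have h₃ : toConv (tinl k P P ∘ₗ j) *
      toConv (augExt ((univForms k P).subtype ∘ₗ biproductConn β)) =
      X * toConv (tinr k P P ∘ₗ j) + toConv (tinr k P P ∘ₗ j) := by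
    have hX : X = toConv (φ.toLinearMap ∘ₗ augExt ((univForms k B).subtype ∘ₗ β)) - 1 :=
      comp_augExt_sub_one φ _
    rw [h₁, ← mul_assoc, h₂, one_mul, hX, sub_mul, one_mul, sub_add_cancel]
  have h₄ (b : B) (t : H ⊗[k] H) : ∃ s ∈ strongHor (homogCoact (proj k H B)),
      (s : P ⊗[k] P) = (incl k H B b ⊗ₜ 1) *
        mul' k _ (TensorProduct.map X.ofConv (tinr k P P ∘ₗ j) t) := by
    induction t using TensorProduct.induction_on with
    | zero => exact ⟨0, Submodule.zero_mem _, by simp⟩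
    | add x y hx hy =>
      obtain ⟨s, hs, hs'⟩ := hx
      obtain ⟨r, hr, hr'⟩ := hy
      exact ⟨s + r, Submodule.add_mem _ hs hr, by
        rw [Submodule.coe_add, hs', hr', map_add, map_add, mul_add]⟩
    | tmul x y =>
      refine ⟨_, rmul_map_incl_mem_strongHor (univForms.lmul k B (b ⊗ₜ β (augProj k H x)))
        (inclH k H B y), ?_⟩
      rw [univForms.coe_rmul, univForms.coe_map, univForms.coe_lmul, map_mul, map_tmul, map_one,
        mul_assoc]
      rfl
  intro u
  induction u using induction_on with
  | hz => simp
  | ha x y hx hy =>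
    rw [map_add, map_add, add_sub_add_comm]
    exact Submodule.add_mem _ hx hy
  | ht b h =>
    -- With s = b β(π_ε h₁) j(h₂), the horizontal part of d(b j(h)) is (d b) j(h) − s, and each term
    -- lies in (Ω¹M)P.
    obtain ⟨s, hs, hs'⟩ := h₄ b (comul (R := k) h)
    have h₅ := rmul_map_incl_mem_strongHor (univForms.d k B b) (inclH k H B h)
    convert Submodule.sub_mem _ h₅ hs using 1
    ext : 1
    have h₆ : (toConv (tinl k P P ∘ₗ j) *
        toConv (augExt ((univForms k P).subtype ∘ₗ biproductConn β))) h =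
        mul' k _ (TensorProduct.map X.ofConv (tinr k P P ∘ₗ j) (comul (R := k) h)) +
          1 ⊗ₜ inclH k H B h := congrArg (fun f => f h) h₃
    rw [Submodule.coe_sub, Submodule.coe_sub, of_tmul, coe_connProj_d_mul, h₆, hs',
      univForms.coe_rmul, univForms.coe_map, univForms.coe_d, univForms.coe_d, map_sub, map_tmul,
      map_tmul, map_one, mul_sub, mul_add, sub_mul]
    simp only [tmul_mul_tmul, one_mul, mul_one]
    abel

/-- The splitting of a strong left-invariant connection is left colinear. -/
theorem leftColinear_of_isStrong {ω : augKer k H →ₗ[k] univForms k (Biproduct k H B)}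
    (hs : IsStrong (homogCoact (proj k H B)) ω) (hω : IsLeftInvariant ω) :
    toConv ((homogLeftCoact (proj k H B)).toLinearMap ∘ₗ
        augExt ((augKer k (Biproduct k H B)).subtype ∘ₗ counitForm ω)) =
      toConv (tinl k H (Biproduct k H B)) * toConv (tinr k H (Biproduct k H B) ∘ₗ
        augExt ((augKer k (Biproduct k H B)).subtype ∘ₗ counitForm ω)) := by
  let P := Biproduct k H B
  let j := (inclH k H B).toLinearMap
  let p := augExt ((augKer k P).subtype ∘ₗ counitForm ω)
  let κ := leftInvariant (HopfAlgebra.antipode k (A := P))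
  let π := (projHom k H B).toLinearMap
  have hκ : augExt ((univForms k P).subtype ∘ₗ ω) = κ ∘ₗ p := by
    rw [comp_augExt _ _ leftInvariant_one]
    congr 1
    exact LinearMap.ext fun h => (leftRegCoact_eq_iff _).1 (hω h)
  have h₁ : toConv (π.rTensor P ∘ₗ (toConv (tinl k P P ∘ₗ j) * toConv (κ ∘ₗ p)).ofConv) =
      toConv (tinl k H P) * toConv (π.rTensor P ∘ₗ κ ∘ₗ p) := by
    refine toConv_comp_convMul fun x y => ?_
    have (t : P ⊗[k] P) : π.rTensor P ((inclH k H B x ⊗ₜ 1) * t) = (x ⊗ₜ 1) * π.rTensor P t := by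
      induction t using TensorProduct.induction_on with
      | zero => simp
      | add x y hx hy => simp only [map_add, mul_add, hx, hy]
      | tmul a b => simp [π, projHom_inclH]
    exact this _
  have h₂ : toConv (counitLeft k P ∘ₗ (toConv (tinl k P P ∘ₗ j) * toConv (κ ∘ₗ p)).ofConv) =
      1 * toConv p := by
    refine toConv_comp_convMul fun x y => ?_
    refine (counitLeft_mul_left _ _).trans ?_
    change counit (R := k) (inclH k H B x) • counitLeft k P (κ (p y)) =
      algebraMap k P (counit (R := k) x) * p y
    rw [counit_inclH, counitLeft_leftInvariant_antipode, Algebra.algebraMap_eq_smul_one,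
      smul_mul_assoc, one_mul]
  -- Strongness at u = j(h) puts 1 ⊗ j(h) − j(h₁) κ(p(h₂)) in (Ω¹M)P. The test by π ⊗ id, in which
  -- the ε ⊗ id part of the second term is p(h), leaves h₁ (π ⊗ id)κ(p(h₂)) = 1 ⊗ p(h).
  have h₃ : toConv (tinl k H P) * toConv (π.rTensor P ∘ₗ κ ∘ₗ p) = toConv (tinr k H P ∘ₗ p) := by
    rw [← h₁]
    ext h
    let Y := (toConv (tinl k P P ∘ₗ j) * toConv (κ ∘ₗ p)) h
    have hY : counitLeft k P Y = p h := by
      rw [one_mul] at h₂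
      exact congrArg (fun f => f h) h₂
    have ht : ((univForms.d k P (incl k H B 1 * inclH k H B h) -
        connProj (homogCoact (proj k H B)) ω (univForms.d k P (incl k H B 1 * inclH k H B h)) :
          univForms k P) : P ⊗[k] P) = 1 ⊗ₜ inclH k H B h - Y := by
      rw [Submodule.coe_sub, coe_connProj_d_mul, hκ, map_one, one_mul, univForms.coe_d,
        ← Algebra.TensorProduct.one_def, one_mul]
      exact sub_sub_sub_cancel_right _ _ _
    have h₄ := rTensor_eq_of_mem_strongHor (hs (incl k H B 1 * inclH k H B h))
    rw [ht, map_sub, map_sub, hY, counitLeft_tmul, Bialgebra.counit_one, one_smul, rTensor_tmul,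
      AlgHom.toLinearMap_apply, map_one, TensorProduct.tmul_sub] at h₄
    exact sub_right_injective h₄
  -- T is a ⊗ y ↦ a π(y₁) ⊗ y₂, the image of the canonical map under π on the left leg. It turns (π
  -- ⊗ id)κ(p) into 1 ⊗ p and 1 ⊗ p into the left coaction of p, so applying it to `h₃` gives
  -- colinearity.
  let T : H ⊗[k] P →ₗ[k] H ⊗[k] P :=
    mul' k _ ∘ₗ TensorProduct.map (tinl k H P) (homogLeftCoact (proj k H B)).toLinearMap
  have hT (x : H) (t : H ⊗[k] P) : T ((x ⊗ₜ 1) * t) = (x ⊗ₜ 1) * T t := by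
    induction t using TensorProduct.induction_on with
    | zero => simp
    | add x y hx hy => simp only [map_add, mul_add, hx, hy]
    | tmul a b => simp [T, ← mul_assoc]
  have hT' (t : P ⊗[k] P) : T (π.rTensor P t) = π.rTensor P (galois k P t) := by
    induction t using TensorProduct.induction_on with
    | zero => simp
    | add x y hx hy => simp only [map_add, hx, hy]
    | tmul a b =>
      change (projHom k H B a ⊗ₜ 1) * Algebra.TensorProduct.map (projHom k H B) (AlgHom.id k P)
        (comul b) = Algebra.TensorProduct.map (projHom k H B) (AlgHom.id k P)
          ((a ⊗ₜ 1) * comul b)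
      rw [map_mul, map_tmul, map_one]
  have h₅ := congrArg (fun f => toConv (T ∘ₗ f.ofConv)) h₃
  have h₆ : toConv (T ∘ₗ (toConv (tinl k H P) * toConv (π.rTensor P ∘ₗ κ ∘ₗ p)).ofConv) =
      toConv (tinl k H P) * toConv (tinr k H P ∘ₗ p) := by
    refine toConv_comp_convMul fun x y => ?_
    refine (hT _ _).trans (congrArg _ ?_)
    refine (hT' _).trans ?_
    change π.rTensor P (galois k P (κ (p y))) = 1 ⊗ₜ p y
    rw [galois_leftInvariant antipode_mul_id, rTensor_tmul]
    simp [π]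
  refine Eq.trans ?_ (h₅.symm.trans h₆)
  ext h
  change homogLeftCoact (proj k H B) (p h) = (1 ⊗ₜ 1) * homogLeftCoact (proj k H B) (p h)
  rw [← Algebra.TensorProduct.one_def, one_mul]

/-- Everything passes through γ: forms correspond to intertwiners by `formOfMap_bijOn`, and the
connection of γ is the canonical connection of its splitting. Surjectivity is the reconstruction of
γ from the colinearity on both sides of the splitting of ω. -/
theorem biproductConn_bijOn :
    Set.BijOn biproductConn (invariantForms k H B) (strongLeftInvariantConnections k H B) := by
  refine ⟨fun β hβ => ?_, fun β hβ β' hβ' h => ?_, fun ω hω => ?_⟩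
  · obtain ⟨γ, hγ, rfl⟩ := formOfMap_bijOn.surjOn hβ
    refine ⟨?_, isStrong_biproductConn _, ?_⟩ <;> rw [biproductConn_formOfMap hγ]
    · exact (isSplitting_splittingOfMap hγ).isConnection
    · exact isLeftInvariant_canonicalConn _
  · obtain ⟨γ, hγ, rfl⟩ := formOfMap_bijOn.surjOn hβ
    obtain ⟨γ', hγ', rfl⟩ := formOfMap_bijOn.surjOn hβ'
    rw [biproductConn_formOfMap hγ, biproductConn_formOfMap hγ'] at h
    -- The connection determines its splitting by ε ⊗ id, and the splitting determines γ by
    -- `retract`.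
    have h₁ := congrArg counitForm h
    rw [counitForm_canonicalConn, counitForm_canonicalConn] at h₁
    have h₂ := augExt_splittingOfMap γ
    rw [h₁, augExt_splittingOfMap] at h₂
    have h₃ := congrArg (fun f => retract k H B ∘ₗ f) h₂
    simp only [retract_crossLift] at h₃
    congr 1
    ext x
    have h₄ := DFunLike.congr_fun h₃ (x : H)
    rw [augExt_coe, augExt_coe] at h₄
    exact h₄.symm
  · obtain ⟨hc, hs, hi⟩ := hω
    let p := augExt ((augKer k (Biproduct k H B)).subtype ∘ₗ counitForm ω)
    have hL := leftColinear_of_isStrong hs hi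
    have hA := (adR_covariant_iff (lTensor_adR_one (proj k H B))
      ((augKer k (Biproduct k H B)).subtype ∘ₗ counitForm ω)).1 (counitForm_covariant hc hi)
    -- Left colinearity from strongness converts Ad-covariance into right colinearity, so p is of
    -- the form γ(h₁) ⊗ h₂.
    have hp : p = crossLift (retract k H B ∘ₗ p) :=
      eq_crossLift ((adR_covariant_iff_rightColinear _ hL).1 hA)
    let γ : augKer k H →ₗ[k] augKer k B :=
      (retract k H B ∘ₗ (augKer k (Biproduct k H B)).subtype ∘ₗ counitForm ω).codRestrict _
        fun h => by
          change counit (R := k) (retract k H B (counitForm ω h : Biproduct k H B)) = 0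
          rw [counit_retract]
          exact (counitForm ω h).2
    have hγ' : augExt ((augKer k B).subtype ∘ₗ γ) = retract k H B ∘ₗ p := by
      rw [comp_augExt]
      · rfl
      · rw [← map_one (incl k H B), retract_incl]
    have hγ : γ ∈ adIntertwiners k H B := by
      rw [mem_adIntertwiners_iff, hγ', intertwiner_iff_leftColinear, ← hp]
      exact hL
    refine ⟨formOfMap γ, formOfMap_bijOn.mapsTo hγ, ?_⟩
    rw [biproductConn_formOfMap hγ]
    have hi' : splittingOfMap γ = counitForm ω := by
      ext h
      rw [coe_splittingOfMap, hγ', ← hp]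
      exact augExt_coe _ h
    rw [hi', canonicalConn_counitForm hi]

end

end Biproduct

theorem proposition6p6 {k H B : Type*} [Field k] [Ring H] [HopfAlgebra k H]
    [Ring B] [Algebra k B] [Coalgebra k B] [CrossedModule k H B] [BraidedGroup k H B] :
    Set.BijOn biproductConn (invariantForms k H B) (strongLeftInvariantConnections k H B) ∧
    Set.BijOn formOfMap (adIntertwiners k H B) (invariantForms k H B) ∧
    ∀ γ ∈ adIntertwiners k H B,
      IsSplitting (Biproduct.proj k H B) (splittingOfMap γ) ∧
      biproductConn (formOfMap γ) = canonicalConn (P := Biproduct k H B) (splittingOfMap γ) :=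
  ⟨Biproduct.biproductConn_bijOn, formOfMap_bijOn, fun _ hγ =>
    ⟨Biproduct.isSplitting_splittingOfMap hγ, Biproduct.biproductConn_formOfMap hγ⟩⟩
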